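/- **Setting.** $P\in\mathbb R^{n\times n}$ is a symmetric matrix with non-negative entries and row sums $1$, $T\subseteq[n]$, and $\beta>0$. For $V\subseteq[n]$ and $S\subseteq V$ put $$h_{P_V}(S)=\frac{\sum_{i\in S,\,j\in V\setminus S}P_{ij}}{\min(|S|,|V\setminus S|)},\qquad h_P=h_{P_{[n]}},\qquad u(S)=\frac1{|S|}\sum_{i,j\in S}P_{ij}.$$ The model of computation is a randomized real RAM: a fixed program with unit-cost exact arithmetic and comparison on real numbers, addition, truncated subtraction and comparison on natural numbers, conversion of natural numbers to reals, $\log$ of a natural number, array access, and fair coin flips. "Randomized polynomial time" means: the program stops with probability one and its expected number of steps is at most a polynomial in $n$. Statements about the output hold for every run that stops. **FindComp.** For $C>0$, a *FindComp algorithm with constant $C$* is a randomized polynomial time program which, given $T\subseteq V\subseteq[n]$ and a matrix $P$ with non-negative entries, returns a set $S^*\subseteq V\setminus T$; whenever there is a set $R\neq\emptyset$ with $T\subseteq R\subsetneq V$, then $\emptyset\ne S^*\subsetneq V$ and, for every such $R$, $$\frac{\sum_{i,j\in V}\delta_{S^*}(i,j)P_{ij}}{\sum_{i,j\in V}\delta_{S^*}(i,j)}\le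 C\log|V|\cdot\frac{\sum_{i,j\in V}\delta_{R}(i,j)P_{ij}}{\sum_{i,j\in V}\delta_{R}(i,j)},$$ where $\delta_S(i,j)=0$ if $i,j$ are both in $S$ or both outside $S$, and $\delta_S(i,j)=1$ otherwise. **Extract Component** $(P,T,\beta)$. 1. $S\leftarrow\mathrm{FindComp}([n],P,T)$. 2. If $h_P(S)\ge\beta/8$ (which counts as true if $S=\emptyset$ or $S=[n]$): put $S\leftarrow[n]\setminus T$, and if $S=\emptyset$ or $u(S)\le1-\beta/8$, return False. 3. While $|S|>1$: let $S'\leftarrow\mathrm{FindComp}(S,P_S,\emptyset)$. If $h_{P_S}(S')\ge\beta/(8\log n)$, leave the loop. Otherwise put $S\leftarrow S'$ if $u(S')\ge u(S\setminus S')$, and $S\leftarrow S\setminus S'$ if not. 4. Return $S$. **Lemma.** A FindComp algorithm (with some constant $C>0$) exists. Moreover, for every $C>0$ there is a constant $c>0$ such that, for every FindComp algorithm with constant $C$, Extract Component with this subroutine runs in randomized polynomial time (the polynomial depends only on the one that bounds the running time of FindComp), and for all $n$, $P$, $T$, $\beta$ as above every run that stops has one of the following two outcomes. * It returns a non-empty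 set $S$ disjoint from $T$ such that $$\frac{\sum_{i,j\in S}P_{ij}}{|S|}\ge1-\beta\qquad\text{and}\qquad\frac{\sum_{i\in R,\,j\in S\setminus R}P_{ij}}{\min(|R|,|S\setminus R|)}\ge c\,\frac{\beta}{\log^2n}\quad\text{for all }\emptyset\ne R\subsetneq S.$$ * It returns False, and then $$h_P(S)\ge c\,\frac{\beta}{\log n}\quad\text{for all }\emptyset\neq S\subseteq[n]\setminus T,\qquad\text{and, if }T\ne[n],\qquad\frac{\sum_{i,j\in[n]\setminus T}P_{ij}}{n-|T|}\le1-\frac\beta8.$$ -/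

import Mathlib

open scoped ENNReal

namespace RealRAM

/-! ### A randomized real RAM

Memory consists of two-dimensional arrays of natural numbers and two-dimensional arrays of real
numbers, each addressed by an array number and two natural-number indices. One step is an
assignment, a coin flip, or a test. On natural numbers the primitives are addition, truncated
subtraction and comparison (there is no multiplication and no conversion of a real number to a
natural number); on real numbers they are the four exact arithmetic operations, comparison, the
conversion of a natural number, and the natural logarithm of a natural number. The only constants
are natural numbers. A program is a finite text that does not depend on the size of the input. -/

/-- The memory: `nat a i j` is cell `(i, j)` of array number `a` of naturals,
`real a i j` is cell `(i, j)` of array number `a` of reals. -/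
structure Store where
  nat : ℕ → ℕ → ℕ → ℕ
  real : ℕ → ℕ → ℕ → ℝ

/-- Overwrite one natural-number cell. -/
def Store.setNat (σ : Store) (a i j v : ℕ) : Store :=
  { σ with nat := fun a' i' j' => if a' = a ∧ i' = i ∧ j' = j then v else σ.nat a' i' j' }

/-- Overwrite one real cell. -/
def Store.setReal (σ : Store) (a i j : ℕ) (v : ℝ) : Store :=
  { σ with real := fun a' i' j' => if a' = a ∧ i' = i ∧ j' = j then v else σ.real a' i' j' }

/-- Natural-number expressions. -/
inductive NExp where
  | lit (k : ℕ)
  | get (a : ℕ) (i j : NExp)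
  | add (e f : NExp)
  | sub (e f : NExp)

/-- Real expressions. -/
inductive RExp where
  | ofNat (e : NExp)
  | get (a : ℕ) (i j : NExp)
  | add (r s : RExp)
  | sub (r s : RExp)
  | mul (r s : RExp)
  | div (r s : RExp)
  | log (e : NExp)

/-- Tests. -/
inductive Test where
  | natLt (e f : NExp)
  | natEq (e f : NExp)
  | realLe (r s : RExp)
  | and (b c : Test)
  | or (b c : Test)
  | not (b : Test)

/-- Programs. `call c` runs the subroutine `c` in a memory of its own, see `Store.frame`. -/
inductive Cmd where
  | skip
  | setNat (a : ℕ) (i j e : NExp)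
  | setReal (a : ℕ) (i j : NExp) (r : RExp)
  | coin (a : ℕ) (i j : NExp)
  | seq (c d : Cmd)
  | ite (b : Test) (c d : Cmd)
  | loop (b : Test) (c : Cmd)
  | call (c : Cmd)

def NExp.eval (σ : Store) : NExp → ℕ
  | .lit k => k
  | .get a i j => σ.nat a (i.eval σ) (j.eval σ)
  | .add e f => e.eval σ + f.eval σ
  | .sub e f => e.eval σ - f.eval σ

noncomputable def RExp.eval (σ : Store) : RExp → ℝ
  | .ofNat e => (e.eval σ : ℝ)
  | .get a i j => σ.real a (i.eval σ) (j.eval σ)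
  | .add r s => r.eval σ + s.eval σ
  | .sub r s => r.eval σ - s.eval σ
  | .mul r s => r.eval σ * s.eval σ
  | .div r s => r.eval σ / s.eval σ
  | .log e => Real.log (e.eval σ : ℝ)

def Test.Holds (σ : Store) : Test → Prop
  | .natLt e f => e.eval σ < f.eval σ
  | .natEq e f => e.eval σ = f.eval σ
  | .realLe r s => r.eval σ ≤ s.eval σ
  | .and b c => b.Holds σ ∧ c.Holds σ
  | .or b c => b.Holds σ ∨ c.Holds σ
  | .not b => ¬ b.Holds σ

/-- The memory in which a subroutine starts: it sees the caller's natural-number arrays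
`0`, `1`, `2` and real array `0` (its parameters), and every other cell is `0`. -/
def Store.frame (σ : Store) : Store where
  nat := fun a => if a ≤ 2 then σ.nat a else fun _ _ => 0
  real := fun a => if a = 0 then σ.real a else fun _ _ => 0

/-- The memory of the caller after a subroutine has stopped in memory `ρ`: natural-number array
`3` (the result) is taken over from `ρ`, and everything else is as before the call. -/
def Store.receive (σ ρ : Store) : Store :=
  { σ with nat := fun a => if a = 3 then ρ.nat 3 else σ.nat a }

/-- `Exec c σ w σ' t`: when started in memory `σ`, the program `c` stops in memory `σ'` after
`t` steps, and the outcomes of the coins it has flipped are, in this order, exactly `w`. -/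
inductive Exec : Cmd → Store → List Bool → Store → ℕ → Prop where
  | skip (σ : Store) : Exec .skip σ [] σ 1
  | setNat (σ : Store) (a : ℕ) (i j e : NExp) :
      Exec (.setNat a i j e) σ [] (σ.setNat a (i.eval σ) (j.eval σ) (e.eval σ)) 1
  | setReal (σ : Store) (a : ℕ) (i j : NExp) (r : RExp) :
      Exec (.setReal a i j r) σ [] (σ.setReal a (i.eval σ) (j.eval σ) (r.eval σ)) 1
  | coin (σ : Store) (a : ℕ) (i j : NExp) (b : Bool) :
      Exec (.coin a i j) σ [b] (σ.setNat a (i.eval σ) (j.eval σ) b.toNat) 1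
  | seq {c d : Cmd} {σ σ' σ'' : Store} {w w' : List Bool} {t t' : ℕ} :
      Exec c σ w σ' t → Exec d σ' w' σ'' t' → Exec (.seq c d) σ (w ++ w') σ'' (t + t')
  | ite_pos {b : Test} {c d : Cmd} {σ σ' : Store} {w : List Bool} {t : ℕ} :
      b.Holds σ → Exec c σ w σ' t → Exec (.ite b c d) σ w σ' (t + 1)
  | ite_neg {b : Test} {c d : Cmd} {σ σ' : Store} {w : List Bool} {t : ℕ} :
      ¬ b.Holds σ → Exec d σ w σ' t → Exec (.ite b c d) σ w σ' (t + 1)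
  | loop_done {b : Test} {c : Cmd} {σ : Store} :
      ¬ b.Holds σ → Exec (.loop b c) σ [] σ 1
  | loop_next {b : Test} {c : Cmd} {σ σ' σ'' : Store} {w w' : List Bool} {t t' : ℕ} :
      b.Holds σ → Exec c σ w σ' t → Exec (.loop b c) σ' w' σ'' t' →
        Exec (.loop b c) σ (w ++ w') σ'' (t + t' + 1)
  | call {c : Cmd} {σ ρ : Store} {w : List Bool} {t : ℕ} :
      Exec c σ.frame w ρ t → Exec (.call c) σ w (σ.receive ρ) (t + 1)

open Classical in
/-- The probability that `c`, started in `σ`, stops. The coin sequences `w` on which `c` stops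
form a prefix-free set, and `w` comes up with probability `2 ^ (-|w|)`. -/
noncomputable def haltProb (c : Cmd) (σ : Store) : ℝ≥0∞ :=
  ∑' w : List Bool, if ∃ σ' t, Exec c σ w σ' t then (2⁻¹ : ℝ≥0∞) ^ w.length else 0

/-- The expectation, over the runs that stop, of the number of steps of `c` started in `σ`
(`w` determines the number of steps, so the supremum is over at most one value). -/
noncomputable def expectedSteps (c : Cmd) (σ : Store) : ℝ≥0∞ :=
  ∑' w : List Bool,
    (2⁻¹ : ℝ≥0∞) ^ w.length * ⨆ (σ' : Store) (t : ℕ) (_ : Exec c σ w σ' t), (t : ℝ≥0∞)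

/-- `c` started in `σ` stops with probability one, after at most `B` steps in expectation. -/
def RunsWithin (c : Cmd) (σ : Store) (B : ℕ) : Prop :=
  haltProb c σ = 1 ∧ expectedSteps c σ ≤ B

/-! ### Abbreviations for writing programs -/

/-- A natural-number variable: cell `(0, 0)` of an array. -/
def NExp.var (x : ℕ) : NExp := .get x (.lit 0) (.lit 0)

/-- A real variable: cell `(0, 0)` of an array. -/
def RExp.var (x : ℕ) : RExp := .get x (.lit 0) (.lit 0)

/-- The minimum, as `e - (e - f)` with truncated subtraction. -/
def NExp.min (e f : NExp) : NExp := .sub e (.sub e f)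

def Cmd.letNat (x : ℕ) (e : NExp) : Cmd := .setNat x (.lit 0) (.lit 0) e

def Cmd.letReal (x : ℕ) (r : RExp) : Cmd := .setReal x (.lit 0) (.lit 0) r

def Cmd.block : List Cmd → Cmd
  | [] => .skip
  | c :: cs => .seq c (Cmd.block cs)

/-! Names of the arrays. A subset of `[n]` is kept as the array of its indicator function,
`[n]` being `{0, …, n - 1}`. -/

/-- natural: the number `n` of states (parameter `0` of a subroutine) -/
abbrev vN : ℕ := 0
/-- natural: the ground set handed to FindComp (parameter `1` of a subroutine) -/
abbrev vGround : ℕ := 1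
/-- natural: the terminal set handed to FindComp (parameter `2` of a subroutine) -/
abbrev vTerm : ℕ := 2
/-- natural: the set returned by FindComp -/
abbrev vCut : ℕ := 3
/-- natural: the input `T` of Extract Component -/
abbrev vT : ℕ := 4
/-- natural: the current set `S_t` of Extract Component -/
abbrev vS : ℕ := 5
/-- natural: loop counters and counters -/
abbrev vI : ℕ := 6
abbrev vJ : ℕ := 7
abbrev vSize : ℕ := 8
abbrev vLeft : ℕ := 9
abbrev vRight : ℕ := 10
/-- natural: `1` as long as the main loop has to go on -/
abbrev vRun : ℕ := 11
/-- natural: `1` if the answer is the set `vS`, and `0` if the answer is False -/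
abbrev vAnswer : ℕ := 12
/-- real: the matrix `P` (real parameter of a subroutine) -/
abbrev rP : ℕ := 0
/-- real: the tolerance `β` -/
abbrev rBeta : ℕ := 1
/-- real: auxiliary variables -/
abbrev rSum : ℕ := 2
abbrev rV : ℕ := 3
abbrev rU : ℕ := 4
abbrev rU' : ℕ := 5

/-- For `x = 0, …, n - 1` do `body`. -/
def forAll (x : ℕ) (body : Cmd) : Cmd :=
  .block [.letNat x (.lit 0),
    .loop (.natLt (.var x) (.var vN)) (.block [body, .letNat x (.add (.var x) (.lit 1))])]

/-- Is the value of the variable `x` an element of the set kept in array `a`? -/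
def mem (a x : ℕ) : Test := .natLt (.lit 0) (.get a (.var x) (.lit 0))

/-- `a ← {i ∈ [n] | p i}`, where the test `p` speaks of `i` as the variable `vI`. -/
def assignSet (a : ℕ) (p : Test) : Cmd :=
  forAll vI (.ite p (.setNat a (.var vI) (.lit 0) (.lit 1)) (.setNat a (.var vI) (.lit 0) (.lit 0)))

/-- `x ← |{i ∈ [n] | p i}|`, where the test `p` speaks of `i` as the variable `vI`. -/
def assignCard (x : ℕ) (p : Test) : Cmd :=
  .block [.letNat x (.lit 0), forAll vI (.ite p (.letNat x (.add (.var x) (.lit 1))) .skip)]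

/-- `x ← ∑ P i j` over all `i` and `j` in `[n]` with `p i` and `q j`, where `p` speaks of `i` as
the variable `vI` and `q` speaks of `j` as the variable `vJ`. -/
def assignSum (x : ℕ) (p q : Test) : Cmd :=
  .block [.letReal x (.ofNat (.lit 0)),
    forAll vI (.ite p
      (forAll vJ (.ite q (.letReal x (.add (.var x) (.get rP (.var vI) (.var vJ)))) .skip))
      .skip)]

/-! ### The algorithm Extract Component -/

/-- The main loop: while `|S| > 1`, cut `S` by FindComp `(S, P_S, ∅)`; stop if the expansion in
`P_S` of the cut `S'` is at least `β / (8 log n)`, and otherwise go on with whichever of `S'` and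
`S \ S'` has the larger average internal mass. -/
def refine (findComp : Cmd) : Cmd :=
  .block [
    .letNat vRun (.lit 1),
    assignCard vSize (mem vS vI),
    .loop (.and (.natEq (.var vRun) (.lit 1)) (.natLt (.lit 1) (.var vSize))) (.block [
      -- S' ← FindComp (S, P_S, ∅)
      assignSet vGround (mem vS vI),
      assignSet vTerm (.natLt (.lit 1) (.lit 0)),
      .call findComp,
      -- v ← h_{P_S} (S')
      assignSum rSum (.and (mem vS vI) (mem vCut vI)) (.and (mem vS vJ) (.not (mem vCut vJ))),
      assignCard vLeft (.and (mem vS vI) (mem vCut vI)),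
      assignCard vRight (.and (mem vS vI) (.not (mem vCut vI))),
      .letReal rV (.div (.var rSum) (.ofNat (.min (.var vLeft) (.var vRight)))),
      .ite (.realLe (.div (.var rBeta) (.mul (.ofNat (.lit 8)) (.log (.var vN)))) (.var rV))
        -- break
        (.letNat vRun (.lit 0))
        (.block [
          -- the average internal masses u of S' and u' of S \ S'
          assignSum rSum (.and (mem vS vI) (mem vCut vI)) (.and (mem vS vJ) (mem vCut vJ)),
          .letReal rU (.div (.var rSum) (.ofNat (.var vLeft))),
          assignSum rSum (.and (mem vS vI) (.not (mem vCut vI)))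
            (.and (mem vS vJ) (.not (mem vCut vJ))),
          .letReal rU' (.div (.var rSum) (.ofNat (.var vRight))),
          .ite (.realLe (.var rU') (.var rU))
            (assignSet vS (.and (mem vS vI) (mem vCut vI)))
            (assignSet vS (.and (mem vS vI) (.not (mem vCut vI)))),
          assignCard vSize (mem vS vI)])])]

/-- The algorithm Extract Component with the subroutine `findComp`. A cut one side of which is
empty has infinite expansion, and an empty set of states passes the test of low internal mass;
this matters only if no cut is admissible in the first call, that is, if `T = [n]` or `n = 1`. -/
def extractComponent (findComp : Cmd) : Cmd :=
  .block [
    -- S ← FindComp ([n], P, T)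
    forAll vI (.setNat vGround (.var vI) (.lit 0) (.lit 1)),
    assignSet vTerm (mem vT vI),
    .call findComp,
    assignSet vS (mem vCut vI),
    -- v ← h_P (S)
    assignSum rSum (mem vS vI) (.not (mem vS vJ)),
    assignCard vLeft (mem vS vI),
    assignCard vRight (.not (mem vS vI)),
    .letReal rV (.div (.var rSum) (.ofNat (.min (.var vLeft) (.var vRight)))),
    .letNat vAnswer (.lit 1),
    .ite (.or (.natEq (.min (.var vLeft) (.var vRight)) (.lit 0))
        (.realLe (.div (.var rBeta) (.ofNat (.lit 8))) (.var rV)))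
      (.block [
        -- S ← [n] \ T, and v ← its average internal mass
        assignSet vS (.not (mem vT vI)),
        assignSum rSum (mem vS vI) (mem vS vJ),
        assignCard vLeft (mem vS vI),
        .letReal rV (.div (.var rSum) (.ofNat (.var vLeft))),
        .ite (.or (.natEq (.var vLeft) (.lit 0)) (.realLe (.var rV)
            (.sub (.ofNat (.lit 1)) (.div (.var rBeta) (.ofNat (.lit 8))))))
          -- return False
          (.letNat vAnswer (.lit 0))
          .skip])
      .skip,
    .ite (.natEq (.var vAnswer) (.lit 1)) (refine findComp) .skip]

/-! ### Inputs and outputs -/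

/-- The set kept in natural-number array `a`. -/
def Store.set (σ : Store) (n a : ℕ) : Finset (Fin n) :=
  Finset.univ.filter fun i => 0 < σ.nat a i 0

/-- The contents of an array that keeps the set `S`. -/
def setArray {n : ℕ} (S : Finset (Fin n)) (i j : ℕ) : ℕ :=
  if ∃ k ∈ S, (k : ℕ) = i ∧ j = 0 then 1 else 0

/-- The contents of an array that keeps the matrix `P`. -/
noncomputable def matrixArray {n : ℕ} (P : Matrix (Fin n) (Fin n) ℝ) (i j : ℕ) : ℝ :=
  if h : i < n ∧ j < n then P ⟨i, h.1⟩ ⟨j, h.2⟩ else 0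

/-- The memory that holds the input `(V, P, T)` of FindComp and is `0` elsewhere. -/
noncomputable def findCompInput {n : ℕ} (V : Finset (Fin n)) (P : Matrix (Fin n) (Fin n) ℝ)
    (T : Finset (Fin n)) : Store where
  nat := fun a i j =>
    if a = vN then (if i = 0 ∧ j = 0 then n else 0)
    else if a = vGround then setArray V i j
    else if a = vTerm then setArray T i j
    else 0
  real := fun a i j => if a = rP then matrixArray P i j else 0

/-- The memory that holds the input `(P, T, β)` of Extract Component and is `0` elsewhere. -/
noncomputable def extractInput {n : ℕ} (P : Matrix (Fin n) (Fin n) ℝ) (T : Finset (Fin n))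
    (β : ℝ) : Store where
  nat := fun a i j =>
    if a = vN then (if i = 0 ∧ j = 0 then n else 0)
    else if a = vT then setArray T i j
    else 0
  real := fun a i j =>
    if a = rP then matrixArray P i j
    else if a = rBeta then (if i = 0 ∧ j = 0 then β else 0)
    else 0

/-! ### Cuts and expansion -/

/-- The cut metric of `S`. -/
noncomputable def cutMetric {n : ℕ} (S : Finset (Fin n)) (i j : Fin n) : ℝ :=
  if (i ∈ S ↔ j ∈ S) then 0 else 1

/-- The ratio that is minimized in the sparsest cut problem on the state space `V` with the
matrix `P` restricted to `V`. -/
noncomputable def cutRatio {n : ℕ} (V : Finset (Fin n)) (P : Matrix (Fin n) (Fin n) ℝ)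
    (S : Finset (Fin n)) : ℝ :=
  (∑ i ∈ V, ∑ j ∈ V, cutMetric S i j * P i j) / ∑ i ∈ V, ∑ j ∈ V, cutMetric S i j

/-- The expansion of `S ⊆ V` with respect to the matrix `P` restricted to `V`. -/
noncomputable def expansion {n : ℕ} (V : Finset (Fin n)) (P : Matrix (Fin n) (Fin n) ℝ)
    (S : Finset (Fin n)) : ℝ :=
  (∑ i ∈ S, ∑ j ∈ V \ S, P i j) / min (S.card : ℝ) ((V \ S).card : ℝ)

/-- The average internal mass of `S`. -/
noncomputable def internalMass {n : ℕ} (P : Matrix (Fin n) (Fin n) ℝ) (S : Finset (Fin n)) : ℝ :=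
  (∑ i ∈ S, ∑ j ∈ S, P i j) / (S.card : ℝ)

/-- `findComp` is an approximation algorithm for the sparsest cut problem with component
constraints, with approximation factor `C log |V|` and expected running time at most `q n`: given a
state space `V ⊆ [n]`, a non-negative matrix `P` and `T ⊆ V`, it returns a set disjoint
from `T`, which, whenever there is an admissible cut (a set `R` with `T ⊆ R ⊂ V` and `R ≠ ∅`), is a
cut whose ratio is at most `C log |V|` times the ratio of any admissible cut. -/
def IsFindComp (findComp : Cmd) (C : ℝ) (q : Polynomial ℕ) : Prop :=
  ∀ (n : ℕ) (V : Finset (Fin n)) (P : Matrix (Fin n) (Fin n) ℝ) (T : Finset (Fin n)),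
    (∀ i j, 0 ≤ P i j) → T ⊆ V →
    RunsWithin findComp (findCompInput V P T) (q.eval n) ∧
    ∀ (w : List Bool) (σ : Store) (t : ℕ), Exec findComp (findCompInput V P T) w σ t →
      σ.set n vCut ⊆ V \ T ∧
      ∀ R : Finset (Fin n), T ⊆ R → R ⊂ V → R.Nonempty →
        (σ.set n vCut).Nonempty ∧ σ.set n vCut ⊂ V ∧
        cutRatio V P (σ.set n vCut) ≤ C * Real.log (V.card : ℝ) * cutRatio V P R

end RealRAM

/-! ### Probability and running time: coin words, expectations, composition of programs. -/

namespace RealRAM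

/-! Existence of FindComp. The program `findSparseCut` is deterministic and works by multiplicative
weights. Symmetrize `P` and add a tiny `η > 0` to every entry, so that all capacities `c` are
positive; pairs inside `T` get distance zero, which keeps `T` on one side of every cut that is
examined. Lengths `u` are kept on the remaining pairs. In each iteration `u / c` induces a
shortest-path semimetric `d` with total `α`, one unit is routed between any two points along
shortest paths, and every length grows in proportion to the congestion of its pair.

Two facts about `d` carry the argument. First, `rounding`: if all examined threshold cuts have ratio
at least `ρ` with respect to `c`, then `ρ α ≤ 256 log |V| · ∑ c d`. Thresholds of a 1-Lipschitz
function `f` show that `ρ ∑ |f x - f y| ≤ ∑ c d`, and `∑ |f x - f y|` is large when `f` is the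
distance from a ball with many points or, if no such ball exists, from one of two large sets far
apart, found by carving balls (`round_spec`). Second, the routed flow costs exactly `α` and crosses
every cut at least as often as the demands require. The flow is obtained without storing paths:
Floyd-Warshall records its relaxations on a stack, and undoing them reroutes the flow at unchanged
cost (`unwindStep_spec`).

Now fix an admissible cut `R`. The cost bound says that `log ∑ u` grows slowly, while the flow
across `R` forces the sum of `c log u` over the pairs cut by `R` to grow fast (`potential_step`).
After `n ^ 4` iterations `log ∑ u` dominates the logarithm of the number of pairs, and comparing the
two growths bounds the capacity of `R` below by the best ratio found, up to `1024 log |V|`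
(`potential_final`). A ratio for `P` is zero or bounded away from zero, so `η` can be removed again
(`ratio_of_perturbed`); the constant becomes `1536`.

Extract Component. For symmetric `P` expansion and ratio agree up to the size of the larger side,
that is up to a factor 2, so the cuts returned by FindComp are near-optimal for expansion too. If a
cut passes the expansion test, all competing cuts have expansion smaller by at most a logarithmic
factor; this gives the lower bounds in both outcomes. If the first cut fails the test, its small
boundary and the row sums 1 give it internal mass at least `1 - β / 8`. Passing to the better side
`A` of a sparse cut of `S` lowers the average internal mass by at most `β / (4 log n)` times `1 -
|A| / |S| ≤ log |S| - log |A|` (`Heavy.of_cut`); this telescopes to a total loss of at most `β / 4`.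

Running time. The expected cost of a program is bounded by an expression read off from its text,
with a factor `n` for each loop and a fixed price for each call (`Cmd.cost`). `Spec` carries this
bound along with a postcondition, so every loop comes with an argument that `n` rounds suffice. -/

/-- Halting coin words form a prefix-free set, because the only nondeterminism is the next coin. The
paddings `z₁`, `z₂` let the induction pass through sequential composition, where the two splittings
of the word are not known to coincide in advance. -/
theorem Exec.deterministic {c : Cmd} {σ σ₁ σ₂ : Store} {w₁ w₂ : List Bool} {t₁ t₂ : ℕ}
    (h₁ : Exec c σ w₁ σ₁ t₁) (h₂ : Exec c σ w₂ σ₂ t₂) (z₁ z₂ : List Bool)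
    (hw : w₁ ++ z₁ = w₂ ++ z₂) : w₁ = w₂ ∧ σ₁ = σ₂ ∧ t₁ = t₂ := by
  induction h₁ generalizing w₂ σ₂ t₂ z₁ z₂ with
  | skip => cases h₂; simp
  | setNat => cases h₂; simp
  | setReal => cases h₂; simp
  | coin σ a i j b =>
    cases h₂
    simp only [List.cons_append, List.nil_append, List.cons.injEq] at hw
    simp [hw.1]
  | seq _ _ ihc ihd =>
    cases h₂ with
    | seq h h' =>
      rw [List.append_assoc, List.append_assoc] at hw
      obtain ⟨rfl, rfl, rfl⟩ := ihc h _ _ hw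
      obtain ⟨rfl, rfl, rfl⟩ := ihd h' _ _ (List.append_cancel_left hw)
      simp
  | ite_pos hb _ ih =>
    cases h₂ with
    | ite_pos _ h => obtain ⟨rfl, rfl, rfl⟩ := ih h _ _ hw; simp
    | ite_neg hb' _ => exact absurd hb hb'
  | ite_neg hb _ ih =>
    cases h₂ with
    | ite_pos hb' _ => exact absurd hb' hb
    | ite_neg _ h => obtain ⟨rfl, rfl, rfl⟩ := ih h _ _ hw; simp
  | loop_done hb =>
    cases h₂ with
    | loop_done => simp
    | loop_next hb' => exact absurd hb' hb
  | loop_next hb _ _ ihc ihd =>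
    cases h₂ with
    | loop_done hb' => exact absurd hb hb'
    | loop_next _ h h' =>
      rw [List.append_assoc, List.append_assoc] at hw
      obtain ⟨rfl, rfl, rfl⟩ := ihc h _ _ hw
      obtain ⟨rfl, rfl, rfl⟩ := ihd h' _ _ (List.append_cancel_left hw)
      simp
  | call _ ih =>
    cases h₂ with
    | call h => obtain ⟨rfl, rfl, rfl⟩ := ih h _ _ hw; simp

theorem Exec.unique {c : Cmd} {σ σ₁ σ₂ : Store} {w : List Bool} {t₁ t₂ : ℕ}
    (h₁ : Exec c σ w σ₁ t₁) (h₂ : Exec c σ w σ₂ t₂) : σ₁ = σ₂ ∧ t₁ = t₂ :=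
  (h₁.deterministic h₂ [] [] rfl).2

/-- The value of `f` at the outcome of the run with coins `w`, and `0` if there is none. -/
noncomputable def outcome (c : Cmd) (f : Store → ℕ → ℝ≥0∞) (σ : Store) (w : List Bool) : ℝ≥0∞ :=
  ⨆ (σ' : Store) (t : ℕ) (_ : Exec c σ w σ' t), f σ' t

theorem Exec.outcome_eq {c : Cmd} {σ σ' : Store} {w : List Bool} {t : ℕ} (h : Exec c σ w σ' t)
    (f : Store → ℕ → ℝ≥0∞) : outcome c f σ w = f σ' t := by
  refine le_antisymm (iSup_le fun σ₁ => iSup_le fun t₁ => iSup_le fun h₁ => ?_) ?_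
  · obtain ⟨rfl, rfl⟩ := h.unique h₁
    exact le_rfl
  · exact le_iSup_of_le σ' (le_iSup_of_le t (le_iSup_of_le h le_rfl))

theorem outcome_eq_zero {c : Cmd} {σ : Store} {w : List Bool}
    (h : ¬ ∃ σ' t, Exec c σ w σ' t) (f : Store → ℕ → ℝ≥0∞) : outcome c f σ w = 0 := by
  refine le_antisymm (iSup_le fun σ₁ => iSup_le fun t₁ => iSup_le fun h₁ => ?_) zero_le
  exact absurd ⟨σ₁, t₁, h₁⟩ h

/-- The expectation of `f` over the runs that stop. -/
noncomputable def expect (c : Cmd) (f : Store → ℕ → ℝ≥0∞) (σ : Store) : ℝ≥0∞ :=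
  ∑' w : List Bool, (2⁻¹ : ℝ≥0∞) ^ w.length * outcome c f σ w

theorem expectedSteps_eq (c : Cmd) (σ : Store) :
    expectedSteps c σ = expect c (fun _ t => (t : ℝ≥0∞)) σ := rfl

theorem haltProb_eq (c : Cmd) (σ : Store) : haltProb c σ = expect c (fun _ _ => 1) σ := by
  classical
  refine tsum_congr fun w => ?_
  split_ifs with h
  · obtain ⟨σ', t, h⟩ := h
    rw [h.outcome_eq, mul_one]
  · rw [outcome_eq_zero h, mul_zero]

theorem expect_mono {c : Cmd} {σ : Store} {f g : Store → ℕ → ℝ≥0∞}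
    (h : ∀ w σ' t, Exec c σ w σ' t → f σ' t ≤ g σ' t) : expect c f σ ≤ expect c g σ := by
  refine ENNReal.tsum_le_tsum fun w => mul_le_mul_right ?_ _
  by_cases hw : ∃ σ' t, Exec c σ w σ' t
  · obtain ⟨σ', t, hw⟩ := hw
    rw [hw.outcome_eq, hw.outcome_eq]
    exact h _ _ _ hw
  · rw [outcome_eq_zero hw, outcome_eq_zero hw]

theorem expect_congr {c : Cmd} {σ : Store} {f g : Store → ℕ → ℝ≥0∞}
    (h : ∀ w σ' t, Exec c σ w σ' t → f σ' t = g σ' t) : expect c f σ = expect c g σ :=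
  le_antisymm (expect_mono fun w σ' t hw => (h w σ' t hw).le)
    (expect_mono fun w σ' t hw => (h w σ' t hw).ge)

theorem expect_add (c : Cmd) (σ : Store) (f g : Store → ℕ → ℝ≥0∞) :
    expect c (fun σ' t => f σ' t + g σ' t) σ = expect c f σ + expect c g σ := by
  unfold expect
  rw [← ENNReal.tsum_add]
  refine tsum_congr fun w => ?_
  rw [← mul_add]
  congr 1
  by_cases hw : ∃ σ' t, Exec c σ w σ' t
  · obtain ⟨σ', t, hw⟩ := hw
    simp only [hw.outcome_eq]
  · simp only [outcome_eq_zero hw, add_zero]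

theorem expect_mul_right (c : Cmd) (σ : Store) (f : Store → ℕ → ℝ≥0∞) (a : ℝ≥0∞) :
    expect c (fun σ' t => f σ' t * a) σ = expect c f σ * a := by
  unfold expect
  rw [← ENNReal.tsum_mul_right]
  refine tsum_congr fun w => ?_
  rw [mul_assoc]
  congr 1
  by_cases hw : ∃ σ' t, Exec c σ w σ' t
  · obtain ⟨σ', t, hw⟩ := hw
    simp only [hw.outcome_eq]
  · simp only [outcome_eq_zero hw, zero_mul]

/-- By prefix-freeness a halting word of the composition splits in exactly one way into a halting
word of `c` and one of `d`. So the double sum over pairs of words, regrouped along the fibres of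
concatenation, has at most one non-zero term in each fibre. -/
theorem expect_seq (c d : Cmd) (σ : Store) (f : Store → ℕ → ℝ≥0∞) :
    expect (.seq c d) f σ =
      expect c (fun σ' t => expect d (fun σ'' t' => f σ'' (t + t')) σ') σ := by
  classical
  let F : List Bool × List Bool → ℝ≥0∞ := fun p =>
    outcome c (fun σ' t => outcome d (fun σ'' t' => f σ'' (t + t')) σ' p.2) σ p.1
  have hr : expect c (fun σ' t => expect d (fun σ'' t' => f σ'' (t + t')) σ') σ =
      ∑' p : List Bool × List Bool, (2⁻¹ : ℝ≥0∞) ^ (p.1 ++ p.2).length * F p := by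
    rw [ENNReal.tsum_prod']
    refine tsum_congr fun u => ?_
    by_cases hu : ∃ σ' t, Exec c σ u σ' t
    · obtain ⟨σ', t, hu⟩ := hu
      simp only [F, hu.outcome_eq, expect]
      rw [← ENNReal.tsum_mul_left]
      refine tsum_congr fun v => ?_
      rw [List.length_append, pow_add, mul_assoc]
    · simp only [F, outcome_eq_zero hu, mul_zero, tsum_zero]
  rw [hr, ← (Equiv.sigmaFiberEquiv
    (fun p : List Bool × List Bool => p.1 ++ p.2)).tsum_eq, ENNReal.tsum_sigma']
  refine tsum_congr fun w => ?_
  have hz : ∀ p : List Bool × List Bool, F p ≠ 0 → ∃ σ' t σ'' t',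
      Exec c σ p.1 σ' t ∧ Exec d σ' p.2 σ'' t' := by
    intro p hp
    by_contra hne
    apply hp
    by_cases hu : ∃ σ' t, Exec c σ p.1 σ' t
    · obtain ⟨σ', t, hu⟩ := hu
      simp only [F, hu.outcome_eq]
      exact outcome_eq_zero (fun ⟨σ'', t', h⟩ => hne ⟨σ', t, σ'', t', hu, h⟩) _
    · exact outcome_eq_zero hu _
  by_cases hw : ∃ σ' t, Exec (.seq c d) σ w σ' t
  · obtain ⟨σ'', t'', hw⟩ := hw
    rw [hw.outcome_eq]
    cases hw with
    | @seq _ _ _ σ' _ u v t t' hu hv =>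
      rw [tsum_eq_single (⟨(u, v), rfl⟩ : {p : List Bool × List Bool // p.1 ++ p.2 = u ++ v})]
      · simp only [Equiv.sigmaFiberEquiv, Equiv.coe_fn_mk, F, hu.outcome_eq, hv.outcome_eq]
      · rintro ⟨⟨u', v'⟩, hp⟩ hne
        have : F (u', v') = 0 := by
          by_contra h0
          obtain ⟨σ₁, t₁, σ₂, t₂, h₁, h₂⟩ := hz _ h0
          obtain ⟨rfl, -, -⟩ := h₁.deterministic hu _ _ hp
          apply hne
          have := List.append_cancel_left hp
          simp only at this
          subst this
          rfl
        simp [Equiv.sigmaFiberEquiv, this]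
  · rw [outcome_eq_zero hw, mul_zero]
    symm
    rw [ENNReal.tsum_eq_zero]
    rintro ⟨⟨u, v⟩, hp⟩
    have : F (u, v) = 0 := by
      by_contra h0
      obtain ⟨σ₁, t₁, σ₂, t₂, h₁, h₂⟩ := hz _ h0
      exact hw ⟨_, _, hp ▸ h₁.seq h₂⟩
    simp [Equiv.sigmaFiberEquiv, this]

/-- If every run of `c` from `σ` comes from a run of `d` from `τ` with the same coins, one step
shorter, and conversely, the expectations correspond. -/
theorem expect_of_iff {c d : Cmd} {σ τ : Store} {g : Store → Store}
    (h : ∀ w σ' t, Exec c σ w σ' t ↔ ∃ τ' s, Exec d τ w τ' s ∧ σ' = g τ' ∧ t = s + 1)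
    (f : Store → ℕ → ℝ≥0∞) :
    expect c f σ = expect d (fun τ' s => f (g τ') (s + 1)) τ := by
  refine tsum_congr fun w => ?_
  congr 1
  by_cases hw : ∃ τ' s, Exec d τ w τ' s
  · obtain ⟨τ', s, hw⟩ := hw
    rw [hw.outcome_eq, ((h _ _ _).2 ⟨τ', s, hw, rfl, rfl⟩).outcome_eq]
  · rw [outcome_eq_zero hw, outcome_eq_zero]
    rintro ⟨σ', t, h'⟩
    obtain ⟨τ', s, h'', -, -⟩ := (h _ _ _).1 h'
    exact hw ⟨τ', s, h''⟩

theorem expect_of_nil {c : Cmd} {σ σ' : Store} {t : ℕ} (h : Exec c σ [] σ' t)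
    (f : Store → ℕ → ℝ≥0∞) : expect c f σ = f σ' t := by
  rw [expect, tsum_eq_single []]
  · simp [h.outcome_eq]
  · intro w hw
    rw [outcome_eq_zero, mul_zero]
    rintro ⟨σ₁, t₁, h₁⟩
    exact hw (h.deterministic h₁ w [] (by simp)).1.symm

theorem runsWithin_iff {c : Cmd} {σ : Store} {B : ℕ} :
    RunsWithin c σ B ↔
      expect c (fun _ _ => 1) σ = 1 ∧ expect c (fun _ t => (t : ℝ≥0∞)) σ ≤ B := by
  rw [RunsWithin, haltProb_eq, expectedSteps_eq]

theorem RunsWithin.mono {c : Cmd} {σ : Store} {B B' : ℕ} (h : RunsWithin c σ B) (hB : B ≤ B') :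
    RunsWithin c σ B' :=
  ⟨h.1, h.2.trans (by exact_mod_cast hB)⟩

theorem RunsWithin.of_nil {c : Cmd} {σ σ' : Store} {t : ℕ} (h : Exec c σ [] σ' t) :
    RunsWithin c σ t := by
  rw [runsWithin_iff, expect_of_nil h, expect_of_nil h]
  simp

/-- The bounds add because `d` stops almost surely from every final memory of `c`: the `t` steps
already made are counted with total weight one. -/
theorem RunsWithin.seq {c d : Cmd} {σ : Store} {B B' : ℕ} (hc : RunsWithin c σ B)
    (hd : ∀ w σ' t, Exec c σ w σ' t → RunsWithin d σ' B') :
    RunsWithin (.seq c d) σ (B + B') := by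
  rw [runsWithin_iff] at hc ⊢
  simp only [runsWithin_iff] at hd
  rw [expect_seq, expect_seq]
  constructor
  · rw [expect_congr fun w σ' t h => (hd w σ' t h).1, hc.1]
  · have h1 : expect c (fun σ' t => expect d (fun _ t' => ((t + t' : ℕ) : ℝ≥0∞)) σ') σ ≤
        expect c (fun σ' t => (t : ℝ≥0∞) + 1 * (B' : ℝ≥0∞)) σ := by
      refine expect_mono fun w σ' t h => ?_
      simp only [Nat.cast_add]
      rw [expect_add]
      refine add_le_add ?_ (by simpa using (hd w σ' t h).2)
      have := expect_mul_right d σ' (fun _ _ => 1) (t : ℝ≥0∞)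
      simp only [one_mul, (hd w σ' t h).1] at this
      exact this.le
    refine h1.trans ?_
    rw [expect_add, expect_mul_right, hc.1, one_mul, Nat.cast_add]
    exact add_le_add hc.2 le_rfl

theorem RunsWithin.of_iff {c d : Cmd} {σ τ : Store} {B : ℕ} {g : Store → Store}
    (h : ∀ w σ' t, Exec c σ w σ' t ↔ ∃ τ' s, Exec d τ w τ' s ∧ σ' = g τ' ∧ t = s + 1)
    (hd : RunsWithin d τ B) : RunsWithin c σ (B + 1) := by
  rw [runsWithin_iff] at hd ⊢
  rw [expect_of_iff h, expect_of_iff h]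
  refine ⟨hd.1, ?_⟩
  simp only [Nat.cast_add, Nat.cast_one]
  rw [expect_add, hd.1]
  exact add_le_add hd.2 le_rfl

theorem RunsWithin.ite_pos {b : Test} {c d : Cmd} {σ : Store} {B : ℕ} (hb : b.Holds σ)
    (h : RunsWithin c σ B) : RunsWithin (.ite b c d) σ (B + 1) := by
  refine h.of_iff (g := id) fun w σ' t => ⟨fun h => ?_, ?_⟩
  · cases h with
    | ite_pos _ h => exact ⟨_, _, h, rfl, rfl⟩
    | ite_neg hb' _ => exact absurd hb hb'
  · rintro ⟨τ', s, h, rfl, rfl⟩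
    exact .ite_pos hb h

theorem RunsWithin.ite_neg {b : Test} {c d : Cmd} {σ : Store} {B : ℕ} (hb : ¬ b.Holds σ)
    (h : RunsWithin d σ B) : RunsWithin (.ite b c d) σ (B + 1) := by
  refine h.of_iff (g := id) fun w σ' t => ⟨fun h => ?_, ?_⟩
  · cases h with
    | ite_pos hb' _ => exact absurd hb' hb
    | ite_neg _ h => exact ⟨_, _, h, rfl, rfl⟩
  · rintro ⟨τ', s, h, rfl, rfl⟩
    exact .ite_neg hb h

theorem RunsWithin.loop_next {b : Test} {c : Cmd} {σ : Store} {B : ℕ} (hb : b.Holds σ)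
    (h : RunsWithin (.seq c (.loop b c)) σ B) : RunsWithin (.loop b c) σ (B + 1) := by
  refine h.of_iff (g := id) fun w σ' t => ⟨fun h => ?_, ?_⟩
  · cases h with
    | loop_done hb' => exact absurd hb hb'
    | loop_next _ h h' => exact ⟨_, _, h.seq h', rfl, rfl⟩
  · rintro ⟨τ', s, h, rfl, rfl⟩
    cases h with
    | seq h h' => exact .loop_next hb h h'

theorem RunsWithin.call {c : Cmd} {σ : Store} {B : ℕ} (h : RunsWithin c σ.frame B) :
    RunsWithin (.call c) σ (B + 1) := by
  refine h.of_iff (g := σ.receive) fun w σ' t => ⟨fun h => ?_, ?_⟩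
  · cases h with
    | call h => exact ⟨_, _, h, rfl, rfl⟩
  · rintro ⟨τ', s, h, rfl, rfl⟩
    exact .call h

end RealRAM

/-! ### A program logic: frame conditions, cost bounds, rules for loops. -/

namespace RealRAM

attribute [simp] NExp.eval RExp.eval Test.Holds NExp.var RExp.var NExp.min Cmd.letNat
  Cmd.letReal

/-- The matrix `f` with the entry at `(a, b)` replaced by `v`. -/
def upd {α : Type*} (f : ℕ → ℕ → α) (a b : ℕ) (v : α) : ℕ → ℕ → α :=
  fun x y => if x = a ∧ y = b then v else f x y

@[simp] theorem upd_same {α : Type*} (f : ℕ → ℕ → α) (a b : ℕ) (v : α) : upd f a b v a b = v := by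
  simp [upd]

theorem upd_apply {α : Type*} (f : ℕ → ℕ → α) (a b x y : ℕ) (v : α) :
    upd f a b v x y = if x = a ∧ y = b then v else f x y := rfl

@[simp] theorem Store.setNat_nat_same (σ : Store) (a i j v : ℕ) :
    (σ.setNat a i j v).nat a = upd (σ.nat a) i j v := by
  funext x y; simp [Store.setNat, upd]

theorem Store.setNat_nat_of_ne (σ : Store) {a a' : ℕ} (i j v : ℕ) (h : a' ≠ a) :
    (σ.setNat a i j v).nat a' = σ.nat a' := by
  funext x y; simp [Store.setNat, h]

@[simp] theorem Store.setNat_real (σ : Store) (a i j v : ℕ) :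
    (σ.setNat a i j v).real = σ.real := rfl

@[simp] theorem Store.setReal_nat (σ : Store) (a i j : ℕ) (v : ℝ) :
    (σ.setReal a i j v).nat = σ.nat := rfl

@[simp] theorem Store.setReal_real_same (σ : Store) (a i j : ℕ) (v : ℝ) :
    (σ.setReal a i j v).real a = upd (σ.real a) i j v := by
  funext x y; simp [Store.setReal, upd]

theorem Store.setReal_real_of_ne (σ : Store) {a a' : ℕ} (i j : ℕ) (v : ℝ) (h : a' ≠ a) :
    (σ.setReal a i j v).real a' = σ.real a' := by
  funext x y; simp [Store.setReal, h]

/-- The natural-number arrays that a program may change. -/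
def Cmd.natW : Cmd → List ℕ
  | .skip => []
  | .setNat a _ _ _ => [a]
  | .setReal _ _ _ _ => []
  | .coin a _ _ => [a]
  | .seq c d => c.natW ++ d.natW
  | .ite _ c d => c.natW ++ d.natW
  | .loop _ c => c.natW
  | .call _ => [3]

/-- The real arrays that a program may change. -/
def Cmd.realW : Cmd → List ℕ
  | .skip => []
  | .setNat _ _ _ _ => []
  | .setReal a _ _ _ => [a]
  | .coin _ _ _ => []
  | .seq c d => c.realW ++ d.realW
  | .ite _ c d => c.realW ++ d.realW
  | .loop _ c => c.realW
  | .call _ => []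

/-- `τ` differs from `σ` at most in the arrays listed in `N` and `R`. -/
structure Agree (N R : List ℕ) (σ τ : Store) : Prop where
  nat : ∀ a, a ∉ N → τ.nat a = σ.nat a
  real : ∀ a, a ∉ R → τ.real a = σ.real a

theorem Agree.refl (N R : List ℕ) (σ : Store) : Agree N R σ σ := ⟨fun _ _ => rfl, fun _ _ => rfl⟩

theorem Agree.trans {N R N' R' : List ℕ} {σ τ ρ : Store} (h : Agree N R σ τ)
    (h' : Agree N' R' τ ρ) : Agree (N ++ N') (R ++ R') σ ρ := by
  constructor
  · intro a ha
    simp only [List.mem_append, not_or] at ha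
    rw [h'.nat a ha.2, h.nat a ha.1]
  · intro a ha
    simp only [List.mem_append, not_or] at ha
    rw [h'.real a ha.2, h.real a ha.1]

theorem Agree.mono {N R N' R' : List ℕ} {σ τ : Store} (h : Agree N R σ τ)
    (hN : N ⊆ N') (hR : R ⊆ R') : Agree N' R' σ τ :=
  ⟨fun a ha => h.nat a fun h' => ha (hN h'), fun a ha => h.real a fun h' => ha (hR h')⟩

theorem Agree.trans_self {N R : List ℕ} {σ τ ρ : Store} (h : Agree N R σ τ)
    (h' : Agree N R τ ρ) : Agree N R σ ρ :=
  ⟨fun a ha => by rw [h'.nat a ha, h.nat a ha], fun a ha => by rw [h'.real a ha, h.real a ha]⟩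

theorem agree_setNat (σ : Store) (a i j v : ℕ) : Agree [a] [] σ (σ.setNat a i j v) :=
  ⟨fun a' ha => σ.setNat_nat_of_ne i j v (by simpa using ha), fun _ _ => rfl⟩

theorem agree_setReal (σ : Store) (a i j : ℕ) (v : ℝ) : Agree [] [a] σ (σ.setReal a i j v) :=
  ⟨fun _ _ => rfl, fun a' ha => σ.setReal_real_of_ne i j v (by simpa using ha)⟩

/-- The frame property. Since the lists of written arrays are computed from the text, that a given
array has survived a piece of program is settled by `decide` in all later proofs. -/
theorem Exec.agree {c : Cmd} {σ τ : Store} {w : List Bool} {t : ℕ} (h : Exec c σ w τ t) :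
    Agree c.natW c.realW σ τ := by
  induction h with
  | skip => exact .refl _ _ _
  | setNat => exact agree_setNat ..
  | setReal => exact agree_setReal ..
  | coin => exact agree_setNat ..
  | seq _ _ h h' => exact h.trans h'
  | ite_pos _ _ h => exact h.mono (by simp [Cmd.natW]) (by simp [Cmd.realW])
  | ite_neg _ _ h => exact h.mono (by simp [Cmd.natW]) (by simp [Cmd.realW])
  | loop_done => exact .refl _ _ _
  | loop_next _ _ _ h h' => exact h.trans_self h'
  | call => exact ⟨fun a ha => by simp_all [Store.receive, Cmd.natW], fun _ _ => rfl⟩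

/-- A bound for the number of steps if every loop is iterated at most `n` times and every
subroutine takes at most `K` steps. -/
def Cmd.cost (n K : ℕ) : Cmd → ℕ
  | .skip => 1
  | .setNat _ _ _ _ => 1
  | .setReal _ _ _ _ => 1
  | .coin _ _ _ => 1
  | .seq c d => c.cost n K + d.cost n K
  | .ite _ c d => c.cost n K + d.cost n K + 1
  | .loop _ c => n * (c.cost n K + 1) + 1
  | .call _ => K + 1

/-- Every loop contributes one factor `n`, and a call is charged `q n + 1` whatever its body is;
hence the polynomial does not depend on the subroutines. -/
theorem Cmd.exists_polynomial_cost (c : Cmd) (q : Polynomial ℕ) :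
    ∃ p : Polynomial ℕ, ∀ n, p.eval n = c.cost n (q.eval n) := by
  induction c with
  | skip => exact ⟨1, fun n => by simp [cost]⟩
  | setNat => exact ⟨1, fun n => by simp [cost]⟩
  | setReal => exact ⟨1, fun n => by simp [cost]⟩
  | coin => exact ⟨1, fun n => by simp [cost]⟩
  | seq c d hc hd =>
    obtain ⟨p, hp⟩ := hc
    obtain ⟨p', hp'⟩ := hd
    exact ⟨p + p', fun n => by simp [cost, hp, hp']⟩
  | ite b c d hc hd =>
    obtain ⟨p, hp⟩ := hc
    obtain ⟨p', hp'⟩ := hd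
    exact ⟨p + p' + 1, fun n => by simp [cost, hp, hp']⟩
  | loop b c hc =>
    obtain ⟨p, hp⟩ := hc
    exact ⟨Polynomial.X * (p + 1) + 1, fun n => by simp [cost, hp]⟩
  | call c => exact ⟨q + 1, fun n => by simp [cost]⟩

/-- Started in `σ`, the program `c` stops with probability one, takes at most `c.cost n K` steps in
expectation, and every run that stops does so in a memory that satisfies `Q`. -/
def Spec (n K : ℕ) (c : Cmd) (σ : Store) (Q : Store → Prop) : Prop :=
  RunsWithin c σ (c.cost n K) ∧ ∀ w τ t, Exec c σ w τ t → Q τ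

variable {n K : ℕ} {c d : Cmd} {σ : Store} {Q Q' : Store → Prop}

theorem Spec.mono (h : Spec n K c σ Q)
    (hQ : ∀ τ, Agree c.natW c.realW σ τ → Q τ → Q' τ) : Spec n K c σ Q' :=
  ⟨h.1, fun w τ t e => hQ τ e.agree (h.2 w τ t e)⟩

theorem Spec.skip (h : Q σ) : Spec n K .skip σ Q :=
  ⟨.of_nil (.skip σ), fun w τ t e => by cases e; exact h⟩

theorem Spec.setNat {a : ℕ} {i j e : NExp}
    (h : Q (σ.setNat a (i.eval σ) (j.eval σ) (e.eval σ))) : Spec n K (.setNat a i j e) σ Q :=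
  ⟨.of_nil (.setNat ..), fun w τ t e => by cases e; exact h⟩

theorem Spec.setReal {a : ℕ} {i j : NExp} {r : RExp}
    (h : Q (σ.setReal a (i.eval σ) (j.eval σ) (r.eval σ))) : Spec n K (.setReal a i j r) σ Q :=
  ⟨.of_nil (.setReal ..), fun w τ t e => by cases e; exact h⟩

theorem Spec.seq (hc : Spec n K c σ Q')
    (hd : ∀ τ, Agree c.natW c.realW σ τ → Q' τ → Spec n K d τ Q) : Spec n K (.seq c d) σ Q := by
  refine ⟨hc.1.seq fun w τ t e => (hd τ e.agree (hc.2 w τ t e)).1, fun w τ t e => ?_⟩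
  cases e with
  | seq e e' => exact (hd _ e.agree (hc.2 _ _ _ e)).2 _ _ _ e'

theorem Spec.block_nil (h : Q σ) : Spec n K (.block []) σ Q := .skip h

theorem Spec.block_cons {cs : List Cmd} (hc : Spec n K c σ Q')
    (hd : ∀ τ, Agree c.natW c.realW σ τ → Q' τ → Spec n K (.block cs) τ Q) :
    Spec n K (.block (c :: cs)) σ Q := hc.seq hd

theorem Spec.setNat_seq {a : ℕ} {i j e : NExp}
    (h : Spec n K c (σ.setNat a (i.eval σ) (j.eval σ) (e.eval σ)) Q) :
    Spec n K (.seq (.setNat a i j e) c) σ Q :=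
  Spec.seq (Q' := fun τ => τ = σ.setNat a (i.eval σ) (j.eval σ) (e.eval σ)) (.setNat rfl)
    (by rintro τ - rfl; exact h)

theorem Spec.setReal_seq {a : ℕ} {i j : NExp} {r : RExp}
    (h : Spec n K c (σ.setReal a (i.eval σ) (j.eval σ) (r.eval σ)) Q) :
    Spec n K (.seq (.setReal a i j r) c) σ Q :=
  Spec.seq (Q' := fun τ => τ = σ.setReal a (i.eval σ) (j.eval σ) (r.eval σ)) (.setReal rfl)
    (by rintro τ - rfl; exact h)

theorem Spec.setNat_cons {cs : List Cmd} {a : ℕ} {i j e : NExp}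
    (h : ∀ τ, Agree [a] [] σ τ → τ.nat a = upd (σ.nat a) (i.eval σ) (j.eval σ) (e.eval σ) →
      Spec n K (.block cs) τ Q) : Spec n K (.block (.setNat a i j e :: cs)) σ Q :=
  Spec.setNat_seq (h _ (agree_setNat ..) (by simp))

theorem Spec.setReal_cons {cs : List Cmd} {a : ℕ} {i j : NExp} {r : RExp}
    (h : ∀ τ, Agree [] [a] σ τ → τ.real a = upd (σ.real a) (i.eval σ) (j.eval σ) (r.eval σ) →
      Spec n K (.block cs) τ Q) : Spec n K (.block (.setReal a i j r :: cs)) σ Q :=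
  Spec.setReal_seq (h _ (agree_setReal ..) (by simp))

theorem Spec.letNat_cons {cs : List Cmd} {x : ℕ} {e : NExp}
    (h : ∀ τ, Agree [x] [] σ τ → τ.nat x 0 0 = e.eval σ → Spec n K (.block cs) τ Q) :
    Spec n K (.block (.letNat x e :: cs)) σ Q :=
  Spec.setNat_cons fun τ a ht => h τ a (by rw [ht]; simp)

theorem Spec.letReal_cons {cs : List Cmd} {x : ℕ} {r : RExp}
    (h : ∀ τ, Agree [] [x] σ τ → τ.real x 0 0 = r.eval σ → Spec n K (.block cs) τ Q) :
    Spec n K (.block (.letReal x r :: cs)) σ Q :=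
  Spec.setReal_cons fun τ a ht => h τ a (by rw [ht]; simp)

theorem Spec.ite {b : Test} (hc : b.Holds σ → Spec n K c σ Q)
    (hd : ¬ b.Holds σ → Spec n K d σ Q) : Spec n K (.ite b c d) σ Q := by
  by_cases hb : b.Holds σ
  · refine ⟨((hc hb).1.ite_pos hb).mono (by simp only [Cmd.cost]; omega), fun w τ t e => ?_⟩
    cases e with
    | ite_pos _ e => exact (hc hb).2 _ _ _ e
    | ite_neg hb' _ => exact absurd hb hb'
  · refine ⟨((hd hb).1.ite_neg hb).mono (by simp only [Cmd.cost]; omega), fun w τ t e => ?_⟩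
    cases e with
    | ite_pos hb' _ => exact absurd hb' hb
    | ite_neg _ e => exact (hd hb).2 _ _ _ e

/-- A loop with a bound `k` for the number of iterations that are left. -/
theorem Spec.loop {b : Test} (Inv : ℕ → Store → Prop) (h0 : Inv n σ)
    (hs : ∀ k τ, Agree c.natW c.realW σ τ → Inv k τ → b.Holds τ →
      ∃ k', k = k' + 1 ∧ Spec n K c τ (Inv k'))
    (hQ : ∀ k τ, Agree c.natW c.realW σ τ → Inv k τ → ¬ b.Holds τ → Q τ) :
    Spec n K (.loop b c) σ Q := by
  have key : ∀ k τ, Agree c.natW c.realW σ τ → Inv k τ →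
      RunsWithin (.loop b c) τ (k * (c.cost n K + 1) + 1) ∧
        ∀ w τ' t, Exec (.loop b c) τ w τ' t → Q τ' := by
    intro k
    induction k with
    | zero =>
      intro τ ha hI
      by_cases hb : b.Holds τ
      · obtain ⟨k', hk, -⟩ := hs 0 τ ha hI hb
        omega
      · refine ⟨(RunsWithin.of_nil (.loop_done hb)).mono (by omega), fun w τ' t e => ?_⟩
        cases e with
        | loop_done => exact hQ _ _ ha hI hb
        | loop_next hb' => exact absurd hb' hb
    | succ k ih =>
      intro τ ha hI
      by_cases hb : b.Holds τ
      · obtain ⟨k', hk, h⟩ := hs _ τ ha hI hb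
        obtain rfl : k = k' := by omega
        have hn := fun w τ' t (e : Exec c τ w τ' t) =>
          ih τ' (ha.trans_self e.agree) (h.2 w τ' t e)
        refine ⟨((h.1.seq fun w τ' t e => (hn w τ' t e).1).loop_next hb).mono ?_,
          fun w τ' t e => ?_⟩
        · rw [Nat.succ_mul]; omega
        · cases e with
          | loop_done hb' => exact absurd hb hb'
          | loop_next _ e e' => exact (hn _ _ _ e).2 _ _ _ e'
      · refine ⟨(RunsWithin.of_nil (.loop_done hb)).mono (by omega), fun w τ' t e => ?_⟩
        cases e with
        | loop_done => exact hQ _ _ ha hI hb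
        | loop_next hb' => exact absurd hb' hb
  exact key n σ (.refl _ _ _) h0

theorem Spec.call (hr : RunsWithin c σ.frame K)
    (hQ : ∀ w ρ t, Exec c σ.frame w ρ t → Q (σ.receive ρ)) : Spec n K (.call c) σ Q :=
  ⟨hr.call, fun w τ t e => by cases e with | call e => exact hQ _ _ _ e⟩

theorem Spec.forAll {x : ℕ} {body : Cmd} (Inv : ℕ → Store → Prop)
    (hn : σ.nat vN 0 0 = n) (hW : x ≠ vN ∧ vN ∉ body.natW ∧ x ∉ body.natW)
    (hst : ∀ k τ τ', Agree [x] [] τ τ' → Inv k τ → Inv k τ')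
    (h0 : Inv 0 σ)
    (hs : ∀ k < n, ∀ τ, Agree (x :: body.natW) body.realW σ τ → τ.nat vN 0 0 = n →
      τ.nat x 0 0 = k → Inv k τ → Spec n K body τ (Inv (k + 1))) :
    Spec n K (forAll x body) σ (Inv n) := by
  obtain ⟨hxN, hN, hx⟩ := hW
  refine Spec.setNat_seq (Spec.block_cons (Q' := Inv n) ?_ fun τ _ h => .block_nil h)
  set W := x :: body.natW
  have ha0 : Agree W body.realW σ (σ.setNat x 0 0 0) :=
    (agree_setNat ..).mono (by simp [W]) (by simp)
  refine Spec.loop (fun k τ => Agree W body.realW σ τ ∧ τ.nat x 0 0 + k = n ∧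
    Inv (τ.nat x 0 0) τ) ?_ ?_ ?_
  · refine ⟨ha0, by simp, ?_⟩
    simpa using hst _ _ _ (agree_setNat ..) h0
  · rintro k τ - ⟨ha, hk, hI⟩ hb
    have hNW : vN ∉ W := by simp [W, hN, hxN.symm]
    have hτn : τ.nat vN 0 0 = n := by rw [ha.nat _ hNW, hn]
    simp only [Test.Holds, NExp.var, NExp.eval, hτn] at hb
    refine ⟨k - 1, by omega, ?_⟩
    refine Spec.block_cons (hs _ hb τ ha hτn rfl hI) fun τ' hτ hI' => ?_
    refine Spec.setNat_seq (.block_nil ?_)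
    have hxx : τ'.nat x 0 0 = τ.nat x 0 0 := by rw [hτ.nat _ hx]
    have hz : (τ'.setNat x ((NExp.lit 0).eval τ') ((NExp.lit 0).eval τ')
      ((NExp.var x).add (.lit 1) |>.eval τ')).nat x 0 0 = τ.nat x 0 0 + 1 := by
      simp [hxx]
    refine ⟨(ha.trans_self (hτ.mono (by simp [W]) (by simp))).trans_self
      ((agree_setNat ..).mono (by simp [W]) (by simp)), ?_, ?_⟩
    · rw [hz]; omega
    · rw [hz]
      exact hst _ _ _ (agree_setNat ..) hI'
  · rintro k τ - ⟨ha, hk, hI⟩ hb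
    have hNW : vN ∉ W := by simp [W, hN, hxN.symm]
    have hτn : τ.nat vN 0 0 = n := by rw [ha.nat _ hNW, hn]
    simp only [Test.Holds, NExp.var, NExp.eval, hτn] at hb
    obtain rfl : k = 0 := by omega
    rw [add_zero] at hk
    rwa [hk] at hI

/-- A loop over all pairs; `Inv i j` holds when the rows before `i` and the first `j` entries of
row `i` have been treated. -/
theorem Spec.forAll₂ {x y : ℕ} {body : Cmd} (Inv : ℕ → ℕ → Store → Prop)
    (hn : σ.nat vN 0 0 = n)
    (hW : x ≠ vN ∧ y ≠ vN ∧ x ≠ y ∧ vN ∉ body.natW ∧ x ∉ body.natW ∧ y ∉ body.natW)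
    (hst : ∀ i j τ τ', Agree [x, y] [] τ τ' → Inv i j τ → Inv i j τ')
    (h0 : Inv 0 0 σ) (hrow : ∀ i τ, Inv i n τ → Inv (i + 1) 0 τ)
    (hs : ∀ i < n, ∀ j < n, ∀ τ, Agree (x :: y :: body.natW) body.realW σ τ →
      τ.nat vN 0 0 = n → τ.nat x 0 0 = i → τ.nat y 0 0 = j → Inv i j τ →
        Spec n K body τ (Inv i (j + 1))) :
    Spec n K (RealRAM.forAll x (RealRAM.forAll y body)) σ (Inv n 0) := by
  obtain ⟨hxN, hyN, hxy, hN, hx, hy⟩ := hW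
  have hw : ∀ a, a ∈ (RealRAM.forAll y body).natW → a ∈ y :: body.natW := by
    intro a ha
    simp [RealRAM.forAll, Cmd.block, Cmd.natW] at ha ⊢
    tauto
  have hr : ∀ a, a ∈ (RealRAM.forAll y body).realW → a ∈ body.realW := by
    intro a ha
    simpa [RealRAM.forAll, Cmd.block, Cmd.realW] using ha
  refine Spec.forAll (fun i τ => Inv i 0 τ) hn
    ⟨hxN, fun h => ?_, fun h => ?_⟩
    (fun k τ τ' h => hst _ _ _ _ (h.mono (by simp) (by simp))) h0 ?_
  · have := hw _ h; simp_all
  · have := hw _ h; simp_all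
  · intro i hi τ ha hτn hτx hI
    have ha' : Agree (x :: y :: body.natW) body.realW σ τ :=
      ha.mono (List.cons_subset_cons _ hw) hr
    refine (Spec.forAll (fun j τ => Inv i j τ) hτn ⟨hyN, hN, hy⟩
      (fun k τ τ' h => hst _ _ _ _ (h.mono (by simp) (by simp))) hI ?_).mono
      fun τ _ h => hrow _ _ h
    intro j hj τ' hb hn' hy' hI'
    refine hs i hi j hj τ' (ha'.trans_self (hb.mono (by simp) (by simp))) hn' ?_ hy' hI'
    rw [hb.nat x (by simp [hxy, hx]), hτx]

/-- The set kept in an array. -/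
def toSet (n : ℕ) (A : ℕ → ℕ → ℕ) : Finset ℕ := (Finset.range n).filter fun i => 0 < A i 0

@[simp] theorem mem_toSet {n : ℕ} {A : ℕ → ℕ → ℕ} {i : ℕ} :
    i ∈ toSet n A ↔ i < n ∧ 0 < A i 0 := by simp [toSet]

/-- The array is overwritten in place, so the test may consult `a` only at the current index, where
the old value is still present. This admits updates such as `S ← S ∩ S'`. -/
theorem Spec.assignSet {a : ℕ} {p : Test} (φ : ℕ → Prop) [DecidablePred φ]
    (hn : σ.nat vN 0 0 = n) (ha : a ≠ vN ∧ a ≠ vI)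
    (hp : ∀ i < n, ∀ τ, Agree [vI, a] [] σ τ → τ.nat vI 0 0 = i → τ.nat a i 0 = σ.nat a i 0 →
      (p.Holds τ ↔ φ i)) :
    Spec n K (assignSet a p) σ (fun τ => τ.nat a =
      fun i j => if i < n ∧ j = 0 then (if φ i then 1 else 0) else σ.nat a i j) := by
  refine (Spec.forAll (fun k τ => τ.nat a =
      fun i j => if i < k ∧ j = 0 then (if φ i then 1 else 0) else σ.nat a i j) hn
      ⟨by decide, ?_, ?_⟩ ?_ ?_ ?_)
  · simpa [Cmd.natW] using ha.1.symm
  · simpa [Cmd.natW] using ha.2.symm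
  · intro k τ τ' h hI
    rw [h.nat a (by simpa using ha.2), hI]
  · simp
  · intro k hk τ hag hτn hτk hI
    have hp' := hp k hk τ (hag.mono (by simp [Cmd.natW]) (by simp [Cmd.realW])) hτk
      (by rw [hI]; simp)
    refine Spec.ite (fun h => .setNat ?_) (fun h => .setNat ?_)
    all_goals
      rw [hp'] at h
      funext i j
      simp only [NExp.eval, NExp.var, hτk, Store.setNat_nat_same, upd_apply, hI]
      by_cases h1 : i = k
      · subst h1
        by_cases h2 : j = 0
        · simp [h, h2]
        · simp [h2]
      · have : i < k + 1 ↔ i < k := by omega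
        simp [h1, this]

theorem Spec.assignCard {x : ℕ} {p : Test} (φ : ℕ → Prop) [DecidablePred φ]
    (hn : σ.nat vN 0 0 = n) (hx : x ≠ vN ∧ x ≠ vI)
    (hp : ∀ i < n, ∀ τ, Agree [vI, x] [] σ τ → τ.nat vI 0 0 = i → (p.Holds τ ↔ φ i)) :
    Spec n K (assignCard x p) σ (fun τ => τ.nat x 0 0 = ((Finset.range n).filter φ).card) := by
  refine Spec.setNat_seq (Spec.block_cons (Spec.forAll (fun k τ => τ.nat x 0 0 =
    ((Finset.range k).filter φ).card) ?_ ⟨by decide, ?_, ?_⟩ ?_ ?_ ?_)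
    fun τ _ h => .block_nil h)
  · rw [Store.setNat_nat_of_ne _ _ _ _ hx.1.symm, hn]
  · simpa [Cmd.natW] using hx.1.symm
  · simpa [Cmd.natW] using hx.2.symm
  · intro k τ τ' h hI
    rw [h.nat x (by simpa using hx.2), hI]
  · simp
  · intro k hk τ hag hτn hτk hI
    have hag' : Agree [vI, x] [] σ τ := (Agree.trans_self (N := [vI, x]) (R := [])
      ((agree_setNat ..).mono (by simp) (by simp))
      (hag.mono (by simp [Cmd.natW]) (by simp [Cmd.realW])))
    have hp' := hp k hk τ hag' hτk
    rw [Finset.range_add_one, Finset.filter_insert]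
    refine Spec.ite (fun h => .setNat ?_) (fun h => .skip ?_)
    · rw [hp'] at h
      simp [h, hI]
    · rw [hp'] at h
      simp [h, hI]

/-- `x ← ∑ r i j` over all `i` and `j` with `p i` and `q j`. -/
def sumArray (r x : ℕ) (p q : Test) : Cmd :=
  .block [.letReal x (.ofNat (.lit 0)),
    forAll vI (.ite p
      (forAll vJ (.ite q (.letReal x (.add (.var x) (.get r (.var vI) (.var vJ)))) .skip))
      .skip)]

theorem assignSum_eq (x : ℕ) (p q : Test) : assignSum x p q = sumArray rP x p q := rfl

theorem Spec.sumArray {r x : ℕ} {p q : Test} (φ ψ : ℕ → Prop) [DecidablePred φ] [DecidablePred ψ]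
    (hn : σ.nat vN 0 0 = n) (hx : x ≠ r)
    (hp : ∀ i < n, ∀ τ, Agree [vI, vJ] [x] σ τ → τ.nat vI 0 0 = i → (p.Holds τ ↔ φ i))
    (hq : ∀ i < n, ∀ τ, Agree [vI, vJ] [x] σ τ → τ.nat vJ 0 0 = i → (q.Holds τ ↔ ψ i)) :
    Spec n K (sumArray r x p q) σ (fun τ => τ.real x 0 0 =
      ∑ i ∈ (Finset.range n).filter φ, ∑ j ∈ (Finset.range n).filter ψ, σ.real r i j) := by
  refine Spec.setReal_seq (Spec.block_cons (Spec.forAll (fun k τ => τ.real x 0 0 =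
    ∑ i ∈ (Finset.range k).filter φ, ∑ j ∈ (Finset.range n).filter ψ, σ.real r i j)
    (by simpa using hn) (by simp [Cmd.natW, RealRAM.forAll, Cmd.block]) ?_ ?_ ?_)
    fun τ _ h => .block_nil h)
  · intro k τ τ' h hI
    rw [h.real x (by simp), hI]
  · simp
  · intro k hk τ hag hτn hτk hI
    have hag' : Agree [vI, vJ] [x] σ τ := (Agree.trans_self (N := [vI, vJ]) (R := [x])
      ((agree_setReal ..).mono (by simp) (by simp))
      (hag.mono (by simp [Cmd.natW, RealRAM.forAll, Cmd.block])
        (by simp [Cmd.realW, RealRAM.forAll, Cmd.block])))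
    have hp' := hp k hk τ hag' hτk
    rw [Finset.range_add_one, Finset.filter_insert]
    refine Spec.ite (fun h => ?_) (fun h => .skip ?_)
    · rw [hp'] at h
      rw [if_pos h, Finset.sum_insert (by simp), add_comm]
      refine Spec.forAll (fun l τ' => τ'.real x 0 0 =
        ∑ i ∈ (Finset.range k).filter φ, ∑ j ∈ (Finset.range n).filter ψ, σ.real r i j +
          ∑ j ∈ (Finset.range l).filter ψ, σ.real r k j) hτn (by simp [Cmd.natW]) ?_ ?_ ?_
      · intro l τ τ' h hI
        rw [h.real x (by simp), hI]
      · simpa using hI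
      · intro l hl τ' ha' hn' hl' hI'
        have hag'' : Agree [vI, vJ] [x] σ τ' :=
          hag'.trans_self (ha'.mono (by simp [Cmd.natW]) (by simp [Cmd.realW]))
        have hq' := hq l hl τ' hag'' hl'
        have hk' : τ'.nat vI 0 0 = k := by rw [ha'.nat _ (by simp [Cmd.natW]), hτk]
        rw [Finset.range_add_one, Finset.filter_insert]
        refine Spec.ite (fun h => .setReal ?_) (fun h => .skip ?_)
        · rw [hq'] at h
          rw [if_pos h, Finset.sum_insert (by simp)]
          simp [hI', hk', hl', hag''.real r (by simpa using hx.symm)]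
          ring
        · rw [hq'] at h
          rw [if_neg h, hI']
    · rw [hp'] at h
      rw [if_neg h, hI]

/-- Entry by entry assignment to a real array. -/
theorem Spec.map₂ {a : ℕ} {body : Cmd} (F : ℕ → ℕ → ℝ)
    (hn : σ.nat vN 0 0 = n) (hN : body.natW ⊆ []) (hR : body.realW ⊆ [a])
    (hs : ∀ i < n, ∀ j < n, ∀ τ, Agree [vI, vJ] [a] σ τ → τ.nat vI 0 0 = i → τ.nat vJ 0 0 = j →
      τ.real a i j = σ.real a i j →
        Spec n K body τ (fun τ' => τ'.real a = upd (τ.real a) i j (F i j))) :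
    Spec n K (RealRAM.forAll vI (RealRAM.forAll vJ body)) σ
      (fun τ => ∀ i < n, ∀ j < n, τ.real a i j = F i j) := by
  have hN' : body.natW = [] := by simpa using hN
  refine (Spec.forAll₂ (fun k l τ => ∀ i < n, ∀ j < n, τ.real a i j =
    if i < k ∨ i = k ∧ j < l then F i j else σ.real a i j) hn ?_ ?_ ?_ ?_ ?_).mono
    fun τ _ h i hi j hj => by rw [h i hi j hj, if_pos (Or.inl hi)]
  · rw [hN']; decide
  · intro i j τ τ' h hI
    simpa [h.real a (by simp)] using hI
  · simp
  · intro i τ h i' hi' j' hj'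
    rw [h i' hi' j' hj']
    have : (i' < i ∨ i' = i ∧ j' < n) ↔ (i' < i + 1 ∨ i' = i + 1 ∧ j' < 0) := by omega
    simp only [this]
  · intro i hi j hj τ ha hτn hτi hτj hI
    rw [hN'] at ha
    refine (hs i hi j hj τ (ha.mono (by simp) hR) hτi hτj ?_).mono fun τ' _ h i' hi' j' hj' => ?_
    · rw [hI i hi j hj, if_neg (by omega)]
    · rw [h, upd_apply]
      split_ifs with h1 h2 h2
      · rw [h1.1, h1.2]
      · omega
      · rw [hI _ hi' _ hj', if_pos (by omega)]
      · rw [hI _ hi' _ hj', if_neg (by omega)]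

end RealRAM

/-! ### Rounding a semimetric to a sparse cut. -/

namespace RealRAM

section Metric

variable {ι : Type*} [DecidableEq ι]

/-- The cut metric of a finite set. -/
def cutDist (S : Finset ι) (x y : ι) : ℝ := if (x ∈ S ↔ y ∈ S) then 0 else 1

theorem cutDist_nonneg (S : Finset ι) (x y : ι) : 0 ≤ cutDist S x y := by
  unfold cutDist; split_ifs <;> norm_num

theorem cutDist_le_one (S : Finset ι) (x y : ι) : cutDist S x y ≤ 1 := by
  unfold cutDist; split_ifs <;> norm_num

theorem cutDist_comm (S : Finset ι) (x y : ι) : cutDist S x y = cutDist S y x := by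
  unfold cutDist; simp only [iff_comm]

theorem cutDist_self (S : Finset ι) (x : ι) : cutDist S x x = 0 := by simp [cutDist]

theorem cutDist_triangle (S : Finset ι) (x y z : ι) :
    cutDist S x z ≤ cutDist S x y + cutDist S y z := by
  unfold cutDist
  by_cases hx : x ∈ S <;> by_cases hy : y ∈ S <;> by_cases hz : z ∈ S <;> simp [hx, hy, hz]

open MeasureTheory in
/-- If a linear functional is non-negative at the threshold cuts of `f`, it is non-negative at the
line metric of `f`. -/
theorem sum_mul_abs_sub_nonneg (V : Finset ι) (a : ι → ι → ℝ) (f : ι → ℝ)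
    (h : ∀ z ∈ V, 0 ≤ ∑ x ∈ V, ∑ y ∈ V, a x y * cutDist (V.filter fun x => f x ≤ f z) x y) :
    0 ≤ ∑ x ∈ V, ∑ y ∈ V, a x y * |f x - f y| := by
  classical
  rcases V.eq_empty_or_nonempty with rfl | hV
  · simp
  obtain ⟨x₀, hx₀, hmin⟩ := V.exists_min_image f hV
  obtain ⟨x₁, hx₁, hmax⟩ := V.exists_max_image f hV
  have hle : f x₀ ≤ f x₁ := hmin _ hx₁
  -- `D x y θ` tells whether the threshold `θ` separates `f x` from `f y`; its integral over `θ` is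
  -- `|f x - f y|`.
  let D : ι → ι → ℝ → ℝ := fun x y θ =>
    (Set.Ico (min (f x) (f y)) (max (f x) (f y))).indicator (fun _ => (1 : ℝ)) θ
  have hD : ∀ x ∈ V, ∀ y ∈ V, ∫ θ in Set.Icc (f x₀) (f x₁), D x y θ = |f x - f y| := by
    intro x hx y hy
    rw [setIntegral_indicator measurableSet_Ico]
    have : Set.Icc (f x₀) (f x₁) ∩ Set.Ico (min (f x) (f y)) (max (f x) (f y)) =
        Set.Ico (min (f x) (f y)) (max (f x) (f y)) := by
      rw [Set.inter_eq_right]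
      intro θ hθ
      exact ⟨(le_min (hmin x hx) (hmin y hy)).trans hθ.1,
        hθ.2.le.trans (max_le (hmax x hx) (hmax y hy))⟩
    rw [this, setIntegral_const, measureReal_def, Real.volume_Ico, max_sub_min_eq_abs,
      ENNReal.toReal_ofReal (abs_nonneg _), abs_sub_comm, smul_eq_mul, mul_one]
  have hint : ∀ x y, IntegrableOn (D x y) (Set.Icc (f x₀) (f x₁)) := by
    intro x y
    refine IntegrableOn.indicator ?_ measurableSet_Ico
    exact integrableOn_const (by simp)
  have heq : ∑ x ∈ V, ∑ y ∈ V, a x y * |f x - f y| =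
      ∫ θ in Set.Icc (f x₀) (f x₁), ∑ x ∈ V, ∑ y ∈ V, a x y * D x y θ := by
    rw [integral_finsetSum]
    · refine Finset.sum_congr rfl fun x hx => ?_
      rw [integral_finsetSum]
      · refine Finset.sum_congr rfl fun y hy => ?_
        rw [integral_const_mul, hD x hx y hy]
      · intro y _
        exact (hint x y).const_mul _
    · intro x _
      exact integrable_finsetSum _ fun y _ => (hint x y).const_mul _
  rw [heq]
  refine setIntegral_nonneg measurableSet_Icc fun θ hθ => ?_
  -- The threshold cut at `θ` does not change when `θ` is lowered to the largest value `f z` below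
  -- it, and for that threshold the hypothesis applies.
  obtain ⟨z, hz, hzmax⟩ := (V.filter fun x => f x ≤ θ).exists_max_image f
    ⟨x₀, Finset.mem_filter.2 ⟨hx₀, hθ.1⟩⟩
  rw [Finset.mem_filter] at hz
  refine (h z hz.1).trans_eq (Finset.sum_congr rfl fun x hx => Finset.sum_congr rfl fun y hy => ?_)
  congr 1
  have key : ∀ w ∈ V, (w ∈ V.filter fun x => f x ≤ f z) ↔ f w ≤ θ := by
    intro w hw
    rw [Finset.mem_filter]
    exact ⟨fun h => h.2.trans hz.2, fun h => ⟨hw, hzmax w (Finset.mem_filter.2 ⟨hw, h⟩)⟩⟩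
  unfold cutDist
  simp only [key x hx, key y hy]
  simp only [D, Set.indicator_apply, Set.mem_Ico, min_le_iff, lt_max_iff]
  by_cases h1 : f x ≤ θ <;> by_cases h2 : f y ≤ θ <;> simp [h1, h2, not_lt.2, not_le.1]

/-- The points of `V` at distance at most `r` from `A`. -/
noncomputable def near (V : Finset ι) (d : ι → ι → ℝ) (A : Finset ι) (r : ℝ) : Finset ι :=
  V.filter fun x => ∃ a ∈ A, d a x ≤ r

/-- Every cut of `V` that consists of the points near `A` has ratio at least `ρ` with respect to
the capacities `c`. -/
def Swept (V : Finset ι) (d c : ι → ι → ℝ) (ρ : ℝ) (A : Finset ι) : Prop :=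
  ∀ y ∈ V, ∀ z ∈ V, (near V d A (d y z)).Nonempty → near V d A (d y z) ⊂ V →
    ρ * ∑ x ∈ V, ∑ y' ∈ V, cutDist (near V d A (d y z)) x y' ≤
      ∑ x ∈ V, ∑ y' ∈ V, cutDist (near V d A (d y z)) x y' * c x y'

/-- A semimetric on `V`. -/
structure Semimetric (V : Finset ι) (d : ι → ι → ℝ) : Prop where
  nonneg : ∀ x ∈ V, ∀ y ∈ V, 0 ≤ d x y
  self : ∀ x ∈ V, d x x = 0
  symm : ∀ x ∈ V, ∀ y ∈ V, d x y = d y x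
  triangle : ∀ x ∈ V, ∀ y ∈ V, ∀ z ∈ V, d x z ≤ d x y + d y z

/-- The distance from `A`. -/
noncomputable def distFrom (d : ι → ι → ℝ) {A : Finset ι} (hA : A.Nonempty) (x : ι) : ℝ :=
  A.inf' hA fun a => d a x

variable {V A : Finset ι} {d c : ι → ι → ℝ} {ρ : ℝ}

omit [DecidableEq ι] in
theorem abs_distFrom_sub_le (hd : Semimetric V d) (hA : A.Nonempty) (hAV : A ⊆ V) {x y : ι}
    (hx : x ∈ V) (hy : y ∈ V) : |distFrom d hA x - distFrom d hA y| ≤ d x y := by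
  have key : ∀ x ∈ V, ∀ y ∈ V, distFrom d hA x ≤ distFrom d hA y + d y x := by
    intro x hx y hy
    obtain ⟨a, ha, h⟩ := A.exists_mem_eq_inf' hA fun a => d a y
    unfold distFrom
    rw [h]
    exact (Finset.inf'_le _ ha).trans (hd.triangle a (hAV ha) y hy x hx)
  rw [abs_le]
  have h1 := key x hx y hy
  have h2 := key y hy x hx
  rw [hd.symm y hy x hx] at h1
  constructor <;> linarith

/-- The distance from `A` is 1-Lipschitz, and its sublevel sets at values taken on `V` are the sets
near `A` of radius `d a z`, all of which were swept. A threshold cut that is all of `V` separates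
nothing and contributes zero. -/
theorem Swept.mul_sum_le (h : Swept V d c ρ A) (hd : Semimetric V d)
    (hc : ∀ x ∈ V, ∀ y ∈ V, 0 ≤ c x y) (hA : A.Nonempty) (hAV : A ⊆ V) :
    ρ * ∑ x ∈ V, ∑ y ∈ V, |distFrom d hA x - distFrom d hA y| ≤
      ∑ x ∈ V, ∑ y ∈ V, c x y * d x y := by
  set f := distFrom d hA
  have h0 := sum_mul_abs_sub_nonneg V (fun x y => c x y - ρ) f ?_
  · simp only [sub_mul, Finset.sum_sub_distrib, ← Finset.mul_sum] at h0
    refine (sub_nonneg.1 h0).trans (Finset.sum_le_sum fun x hx => Finset.sum_le_sum fun y hy => ?_)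
    exact mul_le_mul_of_nonneg_left (abs_distFrom_sub_le hd hA hAV hx hy) (hc x hx y hy)
  · intro z hz
    obtain ⟨a, ha, hfa⟩ := A.exists_mem_eq_inf' hA fun a => d a z
    have hS : (V.filter fun x => f x ≤ f z) = near V d A (d a z) := by
      refine Finset.filter_congr fun x _ => ?_
      change A.inf' hA (fun a => d a x) ≤ A.inf' hA (fun a => d a z) ↔ _
      rw [hfa, Finset.inf'_le_iff]
    have hn : (near V d A (d a z)).Nonempty := by
      rw [← hS]; exact ⟨z, by simp [hz]⟩
    rw [hS]
    by_cases hp : near V d A (d a z) ⊂ V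
    · have := h a (hAV ha) z hz hn hp
      simp only [sub_mul, Finset.sum_sub_distrib, ← Finset.mul_sum]
      simp only [mul_comm (c _ _)]
      linarith
    · have : near V d A (d a z) = V := by
        by_contra hne
        exact hp ((Finset.filter_subset _ _).ssubset_of_ne hne)
      rw [this]
      refine Finset.sum_nonneg fun x hx => Finset.sum_nonneg fun y hy => ?_
      simp [cutDist, hx, hy]

/-- Only the ordered pairs in `A × B` and `B × A` are counted. -/
theorem sum_abs_sub_ge (f : ι → ℝ) {B : Finset ι} (hA : A ⊆ V) (hB : B ⊆ V) {h : ℝ} (hh : 0 < h)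
    (hAf : ∀ a ∈ A, f a = 0) (hBf : ∀ b ∈ B, h ≤ f b) :
    2 * (A.card : ℝ) * B.card * h ≤ ∑ x ∈ V, ∑ y ∈ V, |f x - f y| := by
  have hdisj : Disjoint A B := Finset.disjoint_left.2 fun a ha hb => by
    have := hBf a hb; rw [hAf a ha] at this; linarith
  have h1 : ∀ x ∈ A, (B.card : ℝ) * h ≤ ∑ y ∈ V, |f x - f y| := by
    intro x hx
    refine le_trans ?_ (Finset.sum_le_sum_of_subset_of_nonneg hB fun _ _ _ => abs_nonneg _)
    rw [← nsmul_eq_mul]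
    refine Finset.card_nsmul_le_sum _ _ _ fun y hy => ?_
    rw [hAf x hx, zero_sub, abs_neg]
    exact (hBf y hy).trans (le_abs_self _)
  have h2 : ∀ x ∈ B, (A.card : ℝ) * h ≤ ∑ y ∈ V, |f x - f y| := by
    intro x hx
    refine le_trans ?_ (Finset.sum_le_sum_of_subset_of_nonneg hA fun _ _ _ => abs_nonneg _)
    rw [← nsmul_eq_mul]
    refine Finset.card_nsmul_le_sum _ _ _ fun y hy => ?_
    rw [hAf y hy, sub_zero]
    exact (hBf x hx).trans (le_abs_self _)
  have h3 : ∑ x ∈ A ∪ B, ∑ y ∈ V, |f x - f y| ≤ ∑ x ∈ V, ∑ y ∈ V, |f x - f y| :=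
    Finset.sum_le_sum_of_subset_of_nonneg (Finset.union_subset hA hB)
      fun _ _ _ => Finset.sum_nonneg fun _ _ => abs_nonneg _
  rw [Finset.sum_union hdisj] at h3
  have h4 := Finset.card_nsmul_le_sum A _ _ h1
  have h5 := Finset.card_nsmul_le_sum B _ _ h2
  rw [nsmul_eq_mul] at h4 h5
  nlinarith

/-- The rounding theorem: thresholds of the distance from a ball, if there is a ball with many
points, and otherwise from one of two large sets far from each other. -/
theorem rounding (hd : Semimetric V d) (hc : ∀ x ∈ V, ∀ y ∈ V, 0 ≤ c x y) (hρ : 0 ≤ ρ)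
    (hm : 2 ≤ V.card) {α L : ℝ} (hα : α = ∑ x ∈ V, ∑ y ∈ V, d x y)
    (hL : ∑ x ∈ V, ∑ y ∈ V, c x y * d x y ≤ L)
    (h1 : ∀ v ∈ V, Swept V d c ρ (V.filter fun x => d v x ≤ α / V.card ^ 2 / 4))
    (h2 : (∀ v ∈ V, 4 * (V.filter fun x => d v x ≤ α / V.card ^ 2 / 4).card < V.card) →
      ∃ A B, A ⊆ V ∧ B ⊆ V ∧ Swept V d c ρ A ∧ V.card ≤ 8 * A.card ∧ V.card ≤ 8 * B.card ∧
        ∀ a ∈ A, ∀ b ∈ B, α / V.card ^ 2 / (8 * Real.log V.card) < d a b) :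
    ρ * α ≤ 256 * Real.log V.card * L := by
  set m : ℝ := ((V.card : ℕ) : ℝ) with hmdef
  have hm2 : (2 : ℝ) ≤ m := by rw [hmdef]; exact_mod_cast hm
  have hlog2 : (1 / 2 : ℝ) ≤ Real.log 2 := by have := Real.log_two_gt_d9; linarith
  have hlog : (1 / 2 : ℝ) ≤ Real.log m :=
    hlog2.trans (Real.log_le_log (by norm_num) hm2)
  have hα0 : 0 ≤ α := by
    rw [hα]; exact Finset.sum_nonneg fun x hx => Finset.sum_nonneg fun y hy => hd.nonneg x hx y hy
  have hL0 : 0 ≤ L := le_trans (Finset.sum_nonneg fun x hx => Finset.sum_nonneg fun y hy =>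
    mul_nonneg (hc x hx y hy) (hd.nonneg x hx y hy)) hL
  rcases hα0.eq_or_lt with h0 | hαpos
  · rw [← h0, mul_zero]; positivity
  by_cases hbig : ∀ v ∈ V, 4 * (V.filter fun x => d v x ≤ α / m ^ 2 / 4).card < V.card
  · obtain ⟨A, B, hAV, hBV, hsw, hA, hB, hAB⟩ := h2 hbig
    have hA' : m ≤ 8 * (A.card : ℝ) := by rw [hmdef]; exact_mod_cast hA
    have hB' : m ≤ 8 * (B.card : ℝ) := by rw [hmdef]; exact_mod_cast hB
    have hAne : A.Nonempty := by
      rw [← Finset.card_pos]; omega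
    have hh : 0 < α / m ^ 2 / (8 * Real.log m) := by positivity
    have hs := sum_abs_sub_ge (V := V) (A := A) (B := B) (distFrom d hAne) hAV hBV hh ?_ ?_
    · have h3 := hsw.mul_sum_le hd hc hAne hAV
      -- Two sets of at least `m / 8` points at distance `α / (8 m² log m)`: this is where `256 = 64
      -- · 8 / 2` comes from.
      have h4 : 2 * (m / 8) * (m / 8) * (α / m ^ 2 / (8 * Real.log m)) ≤
          2 * (A.card : ℝ) * B.card * (α / m ^ 2 / (8 * Real.log m)) := by
        gcongr <;> linarith
      have h5 : 2 * (m / 8) * (m / 8) * (α / m ^ 2 / (8 * Real.log m)) =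
          α / (256 * Real.log m) := by
        field_simp; norm_num
      have h6 : ρ * (α / (256 * Real.log m)) ≤ L :=
        (mul_le_mul_of_nonneg_left ((h5.symm.le.trans h4).trans hs) hρ).trans (h3.trans hL)
      rw [mul_div_assoc', div_le_iff₀ (by positivity)] at h6
      linarith
    · intro a ha
      refine le_antisymm ?_ ?_
      · exact (Finset.inf'_le _ ha).trans_eq (hd.self a (hAV ha))
      · exact Finset.le_inf' _ _ fun b hb => hd.nonneg b (hAV hb) a (hAV ha)
    · intro b hb
      exact Finset.le_inf' _ _ fun a ha => (hAB a ha b hb).le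
  · push Not at hbig
    obtain ⟨v, hv, hbig⟩ := hbig
    set A := V.filter fun x => d v x ≤ α / m ^ 2 / 4 with hA
    have hA' : m ≤ 4 * (A.card : ℝ) := by rw [hmdef]; exact_mod_cast hbig
    have hAV : A ⊆ V := Finset.filter_subset _ _
    have hAne : A.Nonempty := ⟨v, by
      rw [hA, Finset.mem_filter, hd.self v hv]; exact ⟨hv, by positivity⟩⟩
    have h3 := (h1 v hv).mul_sum_le hd hc hAne hAV
    set f := distFrom d hAne
    have hf0 : ∀ a ∈ A, f a = 0 := by
      intro a ha
      refine le_antisymm ?_ ?_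
      · exact (Finset.inf'_le _ ha).trans_eq (hd.self a (hAV ha))
      · exact Finset.le_inf' _ _ fun b hb => hd.nonneg b (hAV hb) a (hAV ha)
    have hfn : ∀ x ∈ V, 0 ≤ f x := fun x hx =>
      Finset.le_inf' _ _ fun b hb => hd.nonneg b (hAV hb) x hx
    -- Walk from `x` to its nearest point of the ball, through the centre, and on to `y`. The
    -- passage through the ball costs at most half the mean distance.
    have hd1 : ∀ x ∈ V, ∀ y ∈ V, d x y ≤ f x + f y + α / m ^ 2 / 2 := by
      intro x hx y hy
      obtain ⟨a, ha, hfa⟩ := A.exists_mem_eq_inf' hAne fun a => d a x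
      obtain ⟨b, hb, hfb⟩ := A.exists_mem_eq_inf' hAne fun a => d a y
      change f x = _ at hfa
      change f y = _ at hfb
      have ha' := (Finset.mem_filter.1 ha)
      have hb' := (Finset.mem_filter.1 hb)
      have e1 := hd.triangle x hx a ha'.1 y hy
      have e2 := hd.triangle a ha'.1 b hb'.1 y hy
      have e3 := hd.triangle a ha'.1 v hv b hb'.1
      rw [hd.symm a ha'.1 v hv] at e3
      rw [hd.symm x hx a ha'.1] at e1
      rw [hfa, hfb]
      linarith [ha'.2, hb'.2]
    -- Consequently `∑ f ≥ α / (4 m)`; the at least `m / 4` zeros of `f` in the ball then give `α /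
    -- 16` below.
    have hsum : α ≤ 2 * m * ∑ x ∈ V, f x + α / 2 := by
      have : α ≤ ∑ x ∈ V, ∑ y ∈ V, (f x + f y + α / m ^ 2 / 2) := by
        rw [hα]
        refine Finset.sum_le_sum fun x hx => Finset.sum_le_sum fun y hy => ?_
        rw [← hα]
        exact hd1 x hx y hy
      refine this.trans_eq ?_
      simp only [Finset.sum_add_distrib, Finset.sum_const, nsmul_eq_mul, ← Finset.mul_sum,
        ← hmdef]
      field_simp
      ring
    have hge : (A.card : ℝ) * ∑ x ∈ V, f x ≤ ∑ x ∈ V, ∑ y ∈ V, |f x - f y| := by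
      refine le_trans ?_ (Finset.sum_le_sum_of_subset_of_nonneg hAV
        fun _ _ _ => Finset.sum_nonneg fun _ _ => abs_nonneg _)
      rw [← nsmul_eq_mul]
      refine Finset.card_nsmul_le_sum _ _ _ fun a ha => Finset.sum_le_sum fun y hy => ?_
      rw [hf0 a ha, zero_sub, abs_neg]
      exact le_abs_self _
    have hF : 0 ≤ ∑ x ∈ V, f x := Finset.sum_nonneg hfn
    have h7 : α / 16 ≤ ∑ x ∈ V, ∑ y ∈ V, |f x - f y| := by
      refine le_trans ?_ hge
      nlinarith
    have h8 : ρ * (α / 16) ≤ L := (mul_le_mul_of_nonneg_left h7 hρ).trans (h3.trans hL)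
    -- Here `ρ α ≤ 16 L`, which is more than enough as `log m ≥ 1 / 2`.
    nlinarith [mul_nonneg hL0 (by linarith : (0 : ℝ) ≤ Real.log m - 1 / 2)]

end Metric

end RealRAM

/-! ### Estimates for multiplicative weights, Floyd-Warshall rounds, rerouting, and the
perturbation. -/

namespace RealRAM

theorem mul_log_two_le_log_one_add {s : ℝ} (h0 : 0 ≤ s) (h1 : s ≤ 1) :
    s * Real.log 2 ≤ Real.log (1 + s) := by
  have h := rpow_one_add_le_one_add_mul_self (s := 1) (by norm_num) h0 h1
  rw [mul_one, one_add_one_eq_two] at h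
  rw [← Real.log_rpow (by norm_num)]
  exact Real.log_le_log (by positivity) h

section Potential

variable {ε : Type*} {E : Finset ε} {u w c δ : ε → ℝ} {y : ℝ}

/-- Here `δ` is the indicator of a cut, `w` the flow and `y` the maximal congestion. With `L = ∑ u`
and `X = ∑ u w / c`, the update raises `log L` by at most `X / (y L)`, and `β X ≤ 2 L`. Each
relative increment is at most 1, so `log (1 + s) ≥ s log 2` raises the right-hand side by at least
`(log 2 / y) ∑ δ w ≥ 2 N log 2 / y`. The right-hand side therefore gains at least as much as the
left. -/
theorem potential_step (hu : ∀ e ∈ E, 1 ≤ u e) (hw : ∀ e ∈ E, 0 ≤ w e) (hc : ∀ e ∈ E, 0 < c e)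
    (hδ : ∀ e ∈ E, 0 ≤ δ e) (hy : 0 < y) (hwy : ∀ e ∈ E, w e * (1 / c e) ≤ y)
    {β N ℓ : ℝ} (hβ : 0 ≤ β) (hN : 0 ≤ N)
    (h1 : β * ∑ e ∈ E, u e * (w e * (1 / c e)) ≤ 2 * ∑ e ∈ E, u e)
    (h2 : 2 * N ≤ ∑ e ∈ E, δ e * w e)
    (h3 : β * N * Real.log 2 * (Real.log (∑ e ∈ E, u e) - ℓ) ≤
      ∑ e ∈ E, δ e * c e * Real.log (u e)) :
    β * N * Real.log 2 * (Real.log (∑ e ∈ E, u e * (1 + w e * (1 / c e) / y)) - ℓ) ≤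
      ∑ e ∈ E, δ e * c e * Real.log (u e * (1 + w e * (1 / c e) / y)) := by
  have hlog2 : 0 < Real.log 2 := Real.log_pos (by norm_num)
  have hs0 : ∀ e ∈ E, 0 ≤ w e * (1 / c e) / y := fun e he =>
    div_nonneg (mul_nonneg (hw e he) (by have := hc e he; positivity)) hy.le
  have hR : ∑ e ∈ E, δ e * c e * Real.log (u e) + Real.log 2 / y * ∑ e ∈ E, δ e * w e ≤
      ∑ e ∈ E, δ e * c e * Real.log (u e * (1 + w e * (1 / c e) / y)) := by
    rw [Finset.mul_sum, ← Finset.sum_add_distrib]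
    refine Finset.sum_le_sum fun e he => ?_
    have hce := hc e he
    have hs := mul_log_two_le_log_one_add (hs0 e he) ((div_le_one hy).2 (hwy e he))
    rw [Real.log_mul (by linarith [hu e he]) (by linarith [hs0 e he]), mul_add]
    refine add_le_add le_rfl ?_
    refine le_trans (le_of_eq ?_) (mul_le_mul_of_nonneg_left hs (mul_nonneg (hδ e he) hce.le))
    field_simp
  rcases E.eq_empty_or_nonempty with rfl | hE
  · have hN0 : N = 0 := by simp at h2; linarith
    simp [hN0]
  set L := ∑ e ∈ E, u e
  have hLpos : 0 < L := Finset.sum_pos (fun e he => by linarith [hu e he]) hE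
  set X := ∑ e ∈ E, u e * (w e * (1 / c e))
  have hX : 0 ≤ X := Finset.sum_nonneg fun e he => mul_nonneg (by linarith [hu e he])
    (mul_nonneg (hw e he) (by have := hc e he; positivity))
  have hL' : ∑ e ∈ E, u e * (1 + w e * (1 / c e) / y) = L + X / y := by
    rw [Finset.sum_div, ← Finset.sum_add_distrib]
    exact Finset.sum_congr rfl fun e _ => by ring
  rw [hL']
  have hXy : 0 ≤ X / y := div_nonneg hX hy.le
  have hlog : Real.log (L + X / y) ≤ Real.log L + X / y / L := by
    have : L + X / y = L * (1 + X / y / L) := by field_simp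
    rw [this, Real.log_mul hLpos.ne' (by positivity)]
    have := Real.log_le_sub_one_of_pos (x := 1 + X / y / L) (by positivity)
    linarith
  have hβX : β * (X / y / L) ≤ 2 / y := by
    have : β * (X / y / L) = (β * X) / L / y := by ring
    rw [this]
    gcongr
    rw [div_le_iff₀ hLpos]
    exact h1
  calc β * N * Real.log 2 * (Real.log (L + X / y) - ℓ)
      ≤ β * N * Real.log 2 * (Real.log L + X / y / L - ℓ) := by gcongr
    _ = β * N * Real.log 2 * (Real.log L - ℓ) + N * Real.log 2 * (β * (X / y / L)) := by ring
    _ ≤ ∑ e ∈ E, δ e * c e * Real.log (u e) + N * Real.log 2 * (2 / y) := by gcongr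
    _ = ∑ e ∈ E, δ e * c e * Real.log (u e) + Real.log 2 / y * (2 * N) := by ring
    _ ≤ ∑ e ∈ E, δ e * c e * Real.log (u e) + Real.log 2 / y * ∑ e ∈ E, δ e * w e := by gcongr
    _ ≤ _ := hR

/-- The pair of maximal congestion has its length doubled, and no length shrinks. -/
theorem sum_log_step (hu : ∀ e ∈ E, 1 ≤ u e) (hw : ∀ e ∈ E, 0 ≤ w e) (hc : ∀ e ∈ E, 0 < c e)
    (hy : 0 < y) {e₀ : ε} (he₀ : e₀ ∈ E) (hwy : w e₀ * (1 / c e₀) = y) :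
    ∑ e ∈ E, Real.log (u e) + Real.log 2 ≤
      ∑ e ∈ E, Real.log (u e * (1 + w e * (1 / c e) / y)) := by
  classical
  have hs0 : ∀ e ∈ E, 0 ≤ w e * (1 / c e) / y := fun e he =>
    div_nonneg (mul_nonneg (hw e he) (by have := hc e he; positivity)) hy.le
  have h1 : ∑ e ∈ E, Real.log (u e * (1 + w e * (1 / c e) / y)) =
      ∑ e ∈ E, Real.log (u e) + ∑ e ∈ E, Real.log (1 + w e * (1 / c e) / y) := by
    rw [← Finset.sum_add_distrib]
    exact Finset.sum_congr rfl fun e he =>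
      Real.log_mul (by linarith [hu e he]) (by linarith [hs0 e he])
  rw [h1]
  refine add_le_add le_rfl ?_
  have h2 : Real.log 2 = Real.log (1 + w e₀ * (1 / c e₀) / y) := by
    rw [hwy, div_self hy.ne', one_add_one_eq_two]
  rw [h2]
  exact Finset.single_le_sum (f := fun e => Real.log (1 + w e * (1 / c e) / y))
    (fun e he => Real.log_nonneg (by linarith [hs0 e he])) he₀

theorem pow_four_le_two_pow_sq {n : ℕ} (hn : 2 ≤ n) : n ^ 4 ≤ 2 ^ n ^ 2 := by
  rcases Nat.lt_or_ge n 4 with h | h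
  · interval_cases n <;> norm_num
  · calc n ^ 4 ≤ (2 ^ n) ^ 4 := Nat.pow_le_pow_left Nat.lt_two_pow_self.le 4
      _ = 2 ^ (n * 4) := by rw [pow_mul]
      _ ≤ 2 ^ n ^ 2 := Nat.pow_le_pow_right (by norm_num) (by nlinarith)

/-- Each `log (u e)` is at most `log L`, and there are at most `n ^ 2` of them with sum at least `n
^ 4 log 2`, so `log L ≥ n ^ 2 log 2`. As `n ^ 4 ≤ 2 ^ (n ^ 2)`, the starting value `log |E|` is at
most half of `log L`. Bounding the right-hand side of `h3` by `(∑ δ c) log L` and cancelling `log L`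
leaves the factor 4, one 2 from this half and one from `log 2 ≥ 1 / 2`. -/
theorem potential_final (hu : ∀ e ∈ E, 1 ≤ u e) (hcδ : ∀ e ∈ E, 0 ≤ δ e * c e) {n : ℕ}
    (hn : 2 ≤ n) (hE : E.Nonempty) (hEn : E.card ≤ n ^ 2) {β N : ℝ} (hβ : 0 ≤ β) (hN : 0 ≤ N)
    (h1 : (n ^ 4 : ℕ) * Real.log 2 ≤ ∑ e ∈ E, Real.log (u e))
    (h3 : β * N * Real.log 2 * (Real.log (∑ e ∈ E, u e) - Real.log E.card) ≤
      ∑ e ∈ E, δ e * c e * Real.log (u e)) :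
    β * N ≤ 4 * ∑ e ∈ E, δ e * c e := by
  set L := ∑ e ∈ E, u e
  have hlog2 : (1 / 2 : ℝ) ≤ Real.log 2 := by have := Real.log_two_gt_d9; linarith
  have huL : ∀ e ∈ E, u e ≤ L := fun e he =>
    Finset.single_le_sum (f := u) (fun e he => by linarith [hu e he]) he
  have hlogu : ∀ e ∈ E, Real.log (u e) ≤ Real.log L := fun e he =>
    Real.log_le_log (by linarith [hu e he]) (huL e he)
  have hL1 : 0 ≤ Real.log L := by
    obtain ⟨e, he⟩ := hE
    exact Real.log_nonneg ((hu e he).trans (huL e he))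
  have hn0 : (0 : ℝ) < n := by exact_mod_cast (by omega : 0 < n)
  have hnL : (n : ℝ) ^ 2 * Real.log 2 ≤ Real.log L := by
    have h4 : (n ^ 4 : ℕ) * Real.log 2 ≤ (n : ℝ) ^ 2 * Real.log L := by
      refine h1.trans ((Finset.sum_le_card_nsmul _ _ _ hlogu).trans ?_)
      rw [nsmul_eq_mul]
      exact mul_le_mul_of_nonneg_right (by exact_mod_cast hEn) hL1
    push_cast at h4
    have : (n : ℝ) ^ 2 * ((n : ℝ) ^ 2 * Real.log 2) ≤ (n : ℝ) ^ 2 * Real.log L := by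
      linarith [h4, (by ring : (n : ℝ) ^ 2 * ((n : ℝ) ^ 2 * Real.log 2) = n ^ 4 * Real.log 2)]
    exact le_of_mul_le_mul_left this (by positivity)
  have hE0 : Real.log E.card ≤ Real.log L / 2 := by
    have h5 : Real.log E.card ≤ Real.log ((n : ℝ) ^ 2) :=
      Real.log_le_log (by exact_mod_cast hE.card_pos) (by exact_mod_cast hEn)
    have h6 : Real.log ((n : ℝ) ^ 4) ≤ Real.log (2 ^ n ^ 2) :=
      Real.log_le_log (by positivity) (by exact_mod_cast pow_four_le_two_pow_sq hn)
    rw [Real.log_pow] at h5 h6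
    rw [Real.log_pow] at h6
    push_cast at h5 h6
    linarith
  have hLpos : 0 < Real.log L := lt_of_lt_of_le (by positivity) hnL
  have hup : ∑ e ∈ E, δ e * c e * Real.log (u e) ≤ (∑ e ∈ E, δ e * c e) * Real.log L := by
    rw [Finset.sum_mul]
    exact Finset.sum_le_sum fun e he => mul_le_mul_of_nonneg_left (hlogu e he) (hcδ e he)
  have hlow : β * N * (1 / 2) * (Real.log L / 2) ≤
      β * N * Real.log 2 * (Real.log L - Real.log E.card) := by
    gcongr
    linarith
  have : β * N * (1 / 4) * Real.log L ≤ (∑ e ∈ E, δ e * c e) * Real.log L := by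
    linarith [hlow.trans (h3.trans hup)]
  linarith [le_of_mul_le_mul_right this hLpos]

end Potential

section FloydWarshall

variable {V : Finset ℕ} {d d₀ : ℕ → ℕ → ℝ}

/-- One round of the algorithm of Floyd and Warshall. -/
noncomputable def fwRound (V : Finset ℕ) (d : ℕ → ℕ → ℝ) (k : ℕ) (i j : ℕ) : ℝ :=
  if k ∈ V then min (d i j) (d i k + d k j) else d i j

/-- The properties of a matrix after `m` rounds. -/
structure FWInv (V : Finset ℕ) (d₀ : ℕ → ℕ → ℝ) (m : ℕ) (d : ℕ → ℕ → ℝ) : Prop where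
  nonneg : ∀ x ∈ V, ∀ y ∈ V, 0 ≤ d x y
  self : ∀ x ∈ V, d x x = 0
  symm : ∀ x ∈ V, ∀ y ∈ V, d x y = d y x
  le : ∀ x ∈ V, ∀ y ∈ V, d x y ≤ d₀ x y
  triangle : ∀ k ∈ V, k < m → ∀ x ∈ V, ∀ y ∈ V, d x y ≤ d x k + d k y

theorem FWInv.congr {m : ℕ} {d' : ℕ → ℕ → ℝ} (h : FWInv V d₀ m d)
    (hd : ∀ x ∈ V, ∀ y ∈ V, d' x y = d x y) : FWInv V d₀ m d' where
  nonneg x hx y hy := by rw [hd x hx y hy]; exact h.nonneg x hx y hy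
  self x hx := by rw [hd x hx x hx]; exact h.self x hx
  symm x hx y hy := by rw [hd x hx y hy, hd y hy x hx]; exact h.symm x hx y hy
  le x hx y hy := by rw [hd x hx y hy]; exact h.le x hx y hy
  triangle k hk hkm x hx y hy := by
    rw [hd x hx y hy, hd x hx k hk, hd k hk y hy]; exact h.triangle k hk hkm x hx y hy

/-- Round `m` leaves row and column `m` unchanged because `d m m = 0`, which gives the triangle
inequality through `m`. That through an earlier `k` survives by concatenating ways. -/
theorem FWInv.round {m : ℕ} (h : FWInv V d₀ m d) : FWInv V d₀ (m + 1) (fwRound V d m) := by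
  by_cases hm : m ∈ V
  · constructor
    · intro x hx y hy
      rw [fwRound, if_pos hm]
      exact le_min (h.nonneg x hx y hy) (add_nonneg (h.nonneg x hx m hm) (h.nonneg m hm y hy))
    · intro x hx
      rw [fwRound, if_pos hm, h.self x hx]
      exact min_eq_left (add_nonneg (h.nonneg x hx m hm) (h.nonneg m hm x hx))
    · intro x hx y hy
      rw [fwRound, fwRound, if_pos hm, if_pos hm, h.symm x hx y hy, h.symm x hx m hm,
        h.symm m hm y hy, add_comm]
    · intro x hx y hy
      rw [fwRound, if_pos hm]
      exact (min_le_left _ _).trans (h.le x hx y hy)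
    · intro k hk hkm x hx y hy
      simp only [fwRound, if_pos hm]
      have hmm := h.self m hm
      rcases Nat.lt_succ_iff_lt_or_eq.1 hkm with hlt | rfl
      · have t := h.triangle k hk hlt
        have e1 := t x hx y hy
        have e2 := t m hm y hy
        have e3 := t x hx m hm
        have e4 := h.nonneg m hm k hk
        have e5 := h.nonneg k hk m hm
        -- If both legs were shortened through `m`, their sum contains a loop from `m` to `k` and
        -- back, of non-negative length, which can be dropped. If one leg was, the old inequality
        -- through `k` between `m` and the other endpoint suffices.
        rcases min_cases (d x k) (d x m + d m k) with ⟨h1, -⟩ | ⟨h1, -⟩ <;>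
          rcases min_cases (d k y) (d k m + d m y) with ⟨h2, -⟩ | ⟨h2, -⟩ <;> rw [h1, h2]
        · exact (min_le_left _ _).trans e1
        all_goals exact (min_le_right _ _).trans (by linarith)
      · rw [hmm, add_zero, min_self, zero_add, min_self]
        exact min_le_right _ _
  · have : fwRound V d m = d := by funext i j; simp [fwRound, hm]
    rw [this]
    refine ⟨h.nonneg, h.self, h.symm, h.le, fun k hk hkm => h.triangle k hk ?_⟩
    have : k ≠ m := fun e => hm (e ▸ hk)
    omega

end FloydWarshall

section Reroute

variable {V : Finset ℕ}

theorem sum_upd_mul (g h : ℕ → ℕ → ℝ) {a b : ℕ} (ha : a ∈ V) (hb : b ∈ V) (v : ℝ) :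
    ∑ x ∈ V, ∑ y ∈ V, upd g a b v x y * h x y =
      ∑ x ∈ V, ∑ y ∈ V, g x y * h x y + (v - g a b) * h a b := by
  have : ∀ x ∈ V, ∀ y ∈ V, upd g a b v x y * h x y =
      g x y * h x y + if x = a then (if y = b then (v - g a b) * h a b else 0) else 0 := by
    intro x _ y _
    rw [upd_apply]
    by_cases hx : x = a <;> by_cases hy : y = b <;> simp [hx, hy]
    ring
  rw [Finset.sum_congr rfl fun x hx => Finset.sum_congr rfl fun y hy => this x hx y hy]
  simp only [Finset.sum_add_distrib]
  congr 1
  rw [Finset.sum_eq_single a (fun x _ hx => by simp [hx]) (fun h => absurd ha h),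
    Finset.sum_eq_single b (fun x _ hx => by simp [hx]) (fun h => absurd hb h)]
  simp

/-- Send the flow between `i` and `j` through `k`. -/
noncomputable def reroute (g : ℕ → ℕ → ℝ) (i j k : ℕ) : ℕ → ℕ → ℝ :=
  let g₁ := upd g i k (g i k + g i j)
  let g₂ := upd g₁ k j (g₁ k j + g₁ i j)
  upd g₂ i j 0

/-- Since `k` differs from `i` and `j`, the three entries touched are distinct. With `h` a distance
matrix this shows that rerouting compensates the undoing of a relaxation; with `h` a cut metric the
extra term is non-negative by the triangle inequality. -/
theorem sum_reroute_mul (g h : ℕ → ℕ → ℝ) {i j k : ℕ} (hi : i ∈ V) (hj : j ∈ V) (hk : k ∈ V)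
    (hki : k ≠ i) (hkj : k ≠ j) :
    ∑ x ∈ V, ∑ y ∈ V, reroute g i j k x y * h x y =
      ∑ x ∈ V, ∑ y ∈ V, g x y * h x y + g i j * (h i k + h k j - h i j) := by
  rw [reroute, sum_upd_mul _ _ hi hj, sum_upd_mul _ _ hk hj, sum_upd_mul _ _ hi hk]
  simp only [upd_apply, hki, hki.symm, hkj.symm]
  simp
  ring

theorem reroute_nonneg {g : ℕ → ℕ → ℝ} {i j k : ℕ} (hi : i ∈ V) (hj : j ∈ V) (hk : k ∈ V)
    (hg : ∀ x ∈ V, ∀ y ∈ V, 0 ≤ g x y) : ∀ x ∈ V, ∀ y ∈ V, 0 ≤ reroute g i j k x y := by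
  have h1 := hg i hi j hj
  have h2 := hg i hi k hk
  have h3 := hg k hk j hj
  intro x hx y hy
  have h4 := hg x hx y hy
  simp only [reroute, upd_apply]
  split_ifs <;> positivity

end Reroute

/-- Here `a` and `b` stand for the ratios of the cut found and of a competitor, both subject to the
gap `p / n ^ 2`. If `b = 0`, the right-hand side is below `1024 n η = p / n ^ 2`, which forces `a`
under the gap. Otherwise `η ≤ b`, and `2 b + η ≤ 3 b` turns `1024` into `1536`. -/
theorem ratio_of_perturbed {n m : ℕ} (hm : 2 ≤ m) (hmn : m ≤ n) {p η a b : ℝ} (hp : 0 < p)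
    (hη : η = p / (1024 * n * n * n)) (hb0 : 0 ≤ b)
    (ha : a ≤ 0 ∨ p / n ^ 2 ≤ a) (hb : b = 0 ∨ p / n ^ 2 ≤ b)
    (h : 2 * a + η ≤ 1024 * Real.log m * (2 * b + η)) : a ≤ 1536 * Real.log m * b := by
  have hm0 : (2 : ℝ) ≤ m := by exact_mod_cast hm
  have hn0 : (2 : ℝ) ≤ n := by exact_mod_cast hm.trans hmn
  have hlog : 0 ≤ Real.log m := Real.log_nonneg (by linarith)
  have hη0 : 0 < η := by rw [hη]; positivity
  rcases hb with rfl | hb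
  · rcases ha with ha | ha
    · simpa using ha
    · exfalso
      have h1 : Real.log m < n := by
        have h2 := Real.log_le_sub_one_of_pos (x := (m : ℝ)) (by linarith)
        have h3 : (m : ℝ) ≤ n := by exact_mod_cast hmn
        linarith
      have h4 : 1024 * Real.log m * η ≤ 1024 * n * η := by gcongr
      have h5 : 1024 * n * η = p / n ^ 2 := by rw [hη]; field_simp
      rw [mul_zero, zero_add] at h
      have : 0 < p / n ^ 2 := by positivity
      linarith
  · have h1 : η ≤ b := by
      refine le_trans ?_ hb
      rw [hη]
      apply div_le_div_of_nonneg_left hp.le (by positivity)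
      nlinarith [sq_nonneg (n : ℝ)]
    have h2 : 1024 * Real.log m * (2 * b + η) ≤ 1024 * Real.log m * (3 * b) := by
      gcongr; linarith
    linarith

end RealRAM

/-! ### Cut ratios, and the search through threshold cuts. -/

namespace RealRAM

section CutSums

variable {ι : Type*} [DecidableEq ι]

theorem sum_cutDist_mul {V S : Finset ι} (hS : S ⊆ V) (f : ι → ι → ℝ) :
    ∑ x ∈ V, ∑ y ∈ V, cutDist S x y * f x y =
      ∑ x ∈ S, ∑ y ∈ V \ S, f x y + ∑ x ∈ V \ S, ∑ y ∈ S, f x y := by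
  have hx1 : ∀ x ∈ S, ∑ y ∈ V, cutDist S x y * f x y = ∑ y ∈ V \ S, f x y := by
    intro x hx
    rw [← Finset.sum_sdiff hS, ← add_zero (∑ y ∈ V \ S, f x y)]
    congr 1
    · exact Finset.sum_congr rfl fun y hy => by
        simp [cutDist, hx, (Finset.mem_sdiff.1 hy).2]
    · exact Finset.sum_eq_zero fun y hy => by simp [cutDist, hx, hy]
  have hx2 : ∀ x ∈ V \ S, ∑ y ∈ V, cutDist S x y * f x y = ∑ y ∈ S, f x y := by
    intro x hx
    rw [← Finset.sum_sdiff hS, ← zero_add (∑ y ∈ S, f x y)]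
    congr 1
    · exact Finset.sum_eq_zero fun y hy => by
        simp [cutDist, (Finset.mem_sdiff.1 hx).2, (Finset.mem_sdiff.1 hy).2]
    · exact Finset.sum_congr rfl fun y hy => by
        simp [cutDist, hy, (Finset.mem_sdiff.1 hx).2]
  rw [← Finset.sum_sdiff hS, Finset.sum_congr rfl hx1, Finset.sum_congr rfl hx2, add_comm]

theorem sum_cutDist {V S : Finset ι} (hS : S ⊆ V) :
    ∑ x ∈ V, ∑ y ∈ V, cutDist S x y = 2 * (S.card : ℝ) * (V \ S).card := by
  have := sum_cutDist_mul hS (fun _ _ => 1)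
  simp only [mul_one, Finset.sum_const, nsmul_eq_mul] at this
  rw [this]; ring

/-- The ratio of a cut of `V`. -/
noncomputable def ratio (V : Finset ι) (P : ι → ι → ℝ) (S : Finset ι) : ℝ :=
  (∑ x ∈ V, ∑ y ∈ V, cutDist S x y * P x y) / ∑ x ∈ V, ∑ y ∈ V, cutDist S x y

theorem sum_cutDist_pos {V S : Finset ι} (hS : S.Nonempty) (hSV : S ⊂ V) :
    0 < ∑ x ∈ V, ∑ y ∈ V, cutDist S x y := by
  rw [sum_cutDist hSV.1]
  have h1 : (0 : ℝ) < S.card := by exact_mod_cast hS.card_pos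
  have h2 : (0 : ℝ) < (V \ S).card := by
    exact_mod_cast Finset.card_pos.2 (Finset.sdiff_nonempty.2 hSV.2)
  positivity

theorem ratio_sdiff {V : Finset ι} (P : ι → ι → ℝ) (S : Finset ι) :
    ratio V P (V \ S) = ratio V P S := by
  have : ∀ x ∈ V, ∀ y ∈ V, cutDist (V \ S) x y = cutDist S x y := by
    intro x hx y hy
    simp [cutDist, hx, hy, not_iff_not]
  unfold ratio
  congr 1
  · exact Finset.sum_congr rfl fun x hx => Finset.sum_congr rfl fun y hy => by rw [this x hx y hy]
  · exact Finset.sum_congr rfl fun x hx => Finset.sum_congr rfl fun y hy => by rw [this x hx y hy]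

theorem ratio_nonneg {V : Finset ι} {P : ι → ι → ℝ} (hP : ∀ x y, 0 ≤ P x y) (S : Finset ι) :
    0 ≤ ratio V P S :=
  div_nonneg
    (Finset.sum_nonneg fun x _ => Finset.sum_nonneg fun y _ =>
      mul_nonneg (cutDist_nonneg S x y) (hP x y))
    (Finset.sum_nonneg fun x _ => Finset.sum_nonneg fun y _ => cutDist_nonneg S x y)

/-- Adding the reversed matrix and a constant. -/
theorem sum_cutDist_mul_cap (V S : Finset ι) (P : ι → ι → ℝ) (η : ℝ) :
    ∑ x ∈ V, ∑ y ∈ V, cutDist S x y * (P x y + P y x + η) =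
      2 * ∑ x ∈ V, ∑ y ∈ V, cutDist S x y * P x y + η * ∑ x ∈ V, ∑ y ∈ V, cutDist S x y := by
  have : ∑ x ∈ V, ∑ y ∈ V, cutDist S x y * P y x = ∑ x ∈ V, ∑ y ∈ V, cutDist S x y * P x y := by
    rw [Finset.sum_comm]
    exact Finset.sum_congr rfl fun x _ => Finset.sum_congr rfl fun y _ => by rw [cutDist_comm]
  simp only [mul_add, Finset.sum_add_distrib, this, ← Finset.sum_mul]
  ring

end CutSums

/-! ### The program -/

abbrev vA : ℕ := 20
abbrev vRem : ℕ := 21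
abbrev vCand : ℕ := 22
abbrev vSI : ℕ := 23
abbrev vSJ : ℕ := 24
abbrev vSK : ℕ := 25
abbrev vTop : ℕ := 26
abbrev vHave : ℕ := 27
abbrev vM : ℕ := 28
abbrev vCnt : ℕ := 29
abbrev vCnt' : ℕ := 30
abbrev vV : ℕ := 31
abbrev vY : ℕ := 32
abbrev vZ : ℕ := 33
abbrev vX : ℕ := 34
abbrev vRnd : ℕ := 35
abbrev vK : ℕ := 36
abbrev vW₁ : ℕ := 37
abbrev vW₂ : ℕ := 38
abbrev vW₃ : ℕ := 39
abbrev vMI : ℕ := 41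
abbrev vMJ : ℕ := 42
abbrev vMK : ℕ := 43
abbrev rEta : ℕ := 10
abbrev rQ : ℕ := 11
abbrev rLen : ℕ := 12
abbrev rD : ℕ := 13
abbrev rG : ℕ := 14
abbrev rY : ℕ := 15
abbrev rBest : ℕ := 16
abbrev rNum : ℕ := 17
abbrev rNum' : ℕ := 18
abbrev rAlpha : ℕ := 19
abbrev rH : ℕ := 20
abbrev rR : ℕ := 21
abbrev rRatio : ℕ := 22
abbrev rQuart : ℕ := 23

/-- Entry of a real matrix at the values of two variables. -/
abbrev RExp.at (a x y : ℕ) : RExp := .get a (.var x) (.var y)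

/-- The constants handed to FindComp. -/
structure Ctx (n : ℕ) (V T : Finset ℕ) (P : ℕ → ℕ → ℝ) (σ : Store) : Prop where
  size : σ.nat vN 0 0 = n
  ground : toSet n (σ.nat vGround) = V
  term : toSet n (σ.nat vTerm) = T
  mat : σ.real rP = P

variable {n K : ℕ} {V T : Finset ℕ} {P : ℕ → ℕ → ℝ} {σ τ : Store}

theorem Ctx.agree (h : Ctx n V T P σ) {N R : List ℕ} (ha : Agree N R σ τ)
    (hW : vN ∉ N ∧ vGround ∉ N ∧ vTerm ∉ N ∧ rP ∉ R) : Ctx n V T P τ where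
  size := by rw [ha.nat _ hW.1, h.size]
  ground := by rw [ha.nat _ hW.2.1, h.ground]
  term := by rw [ha.nat _ hW.2.2.1, h.term]
  mat := by rw [ha.real _ hW.2.2.2, h.mat]

theorem Ctx.V_subset (h : Ctx n V T P σ) : V ⊆ Finset.range n := by
  rw [← h.ground]; exact Finset.filter_subset _ _

theorem holds_mem {a x i : ℕ} (hx : τ.nat x 0 0 = i) (hi : i < n) :
    (mem a x).Holds τ ↔ i ∈ toSet n (τ.nat a) := by
  simp [mem, hx, hi]

theorem filter_mem_range {S : Finset ℕ} (h : S ⊆ Finset.range n) :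
    (Finset.range n).filter (fun i => i ∈ S) = S := by
  ext i
  simp only [Finset.mem_filter]
  exact ⟨fun h => h.2, fun hi => ⟨h hi, hi⟩⟩

/-- The ratio of the best cut found so far. -/
noncomputable def score (σ : Store) : WithTop ℝ :=
  if σ.nat vHave 0 0 = 0 then ⊤ else ((σ.real rBest 0 0 : ℝ) : WithTop ℝ)

theorem score_congr (h : τ.nat vHave = σ.nat vHave) (h' : τ.real rBest = σ.real rBest) :
    score τ = score σ := by simp [score, h, h']

/-- The best cut found so far does not separate points of `T`. -/
structure BestInv (n : ℕ) (V T : Finset ℕ) (P : ℕ → ℕ → ℝ) (σ : Store) : Prop where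
  none : σ.nat vHave 0 0 = 0 → toSet n (σ.nat vCut) = ∅
  some : σ.nat vHave 0 0 ≠ 0 → (toSet n (σ.nat vCut)).Nonempty ∧ toSet n (σ.nat vCut) ⊂ V ∧
    σ.real rBest 0 0 = ratio V P (toSet n (σ.nat vCut))
  resp : ∀ s ∈ T, ∀ t ∈ T, s ∈ toSet n (σ.nat vCut) → t ∈ toSet n (σ.nat vCut)

theorem BestInv.congr (h : BestInv n V T P σ) (h1 : τ.nat vHave = σ.nat vHave)
    (h2 : τ.real rBest = σ.real rBest) (h3 : τ.nat vCut = σ.nat vCut) : BestInv n V T P τ := by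
  constructor
  · rw [h1, h3]; exact h.none
  · rw [h1, h2, h3]; exact h.some
  · rw [h3]; exact h.resp

theorem BestInv.agree (h : BestInv n V T P σ) {N R : List ℕ} (ha : Agree N R σ τ)
    (hW : vHave ∉ N ∧ vCut ∉ N ∧ rBest ∉ R) : BestInv n V T P τ :=
  h.congr (ha.nat _ hW.1) (ha.real _ hW.2.2) (ha.nat _ hW.2.1)

theorem score_agree {N R : List ℕ} (ha : Agree N R σ τ)
    (hW : vHave ∉ N ∧ rBest ∉ R) : score τ = score σ :=
  score_congr (ha.nat _ hW.1) (ha.real _ hW.2)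

/-- Compare the cut `vCand` with the best cut found so far. -/
def evaluate : Cmd :=
  .block [
    sumArray rP rNum (.and (mem vGround vI) (mem vCand vI))
      (.and (mem vGround vJ) (.not (mem vCand vJ))),
    sumArray rP rNum' (.and (mem vGround vI) (.not (mem vCand vI)))
      (.and (mem vGround vJ) (mem vCand vJ)),
    assignCard vCnt (.and (mem vGround vI) (mem vCand vI)),
    assignCard vCnt' (.and (mem vGround vI) (.not (mem vCand vI))),
    .letReal rRatio (.div (.add (.var rNum) (.var rNum'))
      (.mul (.mul (.ofNat (.lit 2)) (.ofNat (.var vCnt))) (.ofNat (.var vCnt')))),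
    .ite (.and (.and (.natLt (.lit 0) (.var vCnt)) (.natLt (.lit 0) (.var vCnt')))
        (.or (.natEq (.var vHave) (.lit 0)) (.not (.realLe (.var rBest) (.var rRatio)))))
      (.block [.letNat vHave (.lit 1), .letReal rBest (.var rRatio),
        assignSet vCut (mem vCand vI)])
      .skip]

theorem toSet_assign {A : ℕ → ℕ → ℕ} {S : Finset ℕ} (hS : S ⊆ Finset.range n) :
    toSet n (fun i j => if i < n ∧ j = 0 then (if i ∈ S then 1 else 0) else A i j) = S := by
  ext i
  simp only [mem_toSet]
  constructor
  · rintro ⟨hi, h⟩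
    by_contra hne
    simp [hi, hne] at h
  · intro hi
    have := Finset.mem_range.1 (hS hi)
    simp [this, hi]

/-- The program computes the quotient before it knows that both sides are non-empty. For a
degenerate candidate this is a division by zero, and the test on the two counters discards the
value. -/
theorem evaluate_spec (hc : Ctx n V T P σ) (hb : BestInv n V T P σ) {S : Finset ℕ}
    (hS : toSet n (σ.nat vCand) = S) (hSV : S ⊆ V)
    (hST : ∀ s ∈ T, ∀ t ∈ T, s ∈ S → t ∈ S) :
    Spec n K evaluate σ fun τ => BestInv n V T P τ ∧ score τ ≤ score σ ∧
      (S.Nonempty → S ⊂ V → score τ ≤ (ratio V P S : ℝ)) := by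
  have hSr : S ⊆ Finset.range n := hSV.trans hc.V_subset
  have hDr : V \ S ⊆ Finset.range n := Finset.sdiff_subset.trans hc.V_subset
  have mS : ∀ i, i ∈ V ∧ i ∈ S ↔ i ∈ S := fun i => ⟨fun h => h.2, fun h => ⟨hSV h, h⟩⟩
  refine Spec.block_cons (Spec.sumArray (· ∈ S) (· ∈ V \ S) hc.size (by decide) ?_ ?_)
    fun τ₁ a₁ h₁ => ?_
  · intro i hi τ a hx
    simp only [Test.Holds, holds_mem hx hi, a.nat vGround (by decide), a.nat vCand (by decide),
      hc.ground, hS, mS]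
  · intro i hi τ a hx
    simp only [Test.Holds, holds_mem hx hi, a.nat vGround (by decide), a.nat vCand (by decide),
      hc.ground, hS, Finset.mem_sdiff]
  have hc₁ := hc.agree a₁ (by decide)
  have hS₁ : toSet n (τ₁.nat vCand) = S := by rw [a₁.nat _ (by decide), hS]
  refine Spec.block_cons (Spec.sumArray (· ∈ V \ S) (· ∈ S) hc₁.size (by decide) ?_ ?_)
    fun τ₂ a₂ h₂ => ?_
  · intro i hi τ a hx
    simp only [Test.Holds, holds_mem hx hi, a.nat vGround (by decide), a.nat vCand (by decide),
      hc₁.ground, hS₁, Finset.mem_sdiff]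
  · intro i hi τ a hx
    simp only [Test.Holds, holds_mem hx hi, a.nat vGround (by decide), a.nat vCand (by decide),
      hc₁.ground, hS₁, mS]
  have hc₂ := hc₁.agree a₂ (by decide)
  have hS₂ : toSet n (τ₂.nat vCand) = S := by rw [a₂.nat _ (by decide), hS₁]
  refine Spec.block_cons (Spec.assignCard (· ∈ S) hc₂.size (by decide) ?_)
    fun τ₃ a₃ h₃ => ?_
  · intro i hi τ a hx
    simp only [Test.Holds, holds_mem hx hi, a.nat vGround (by decide), a.nat vCand (by decide),
      hc₂.ground, hS₂, mS]
  have hc₃ := hc₂.agree a₃ (by decide)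
  have hS₃ : toSet n (τ₃.nat vCand) = S := by rw [a₃.nat _ (by decide), hS₂]
  refine Spec.block_cons (Spec.assignCard (· ∈ V \ S) hc₃.size (by decide) ?_)
    fun τ₄ a₄ h₄ => ?_
  · intro i hi τ a hx
    simp only [Test.Holds, holds_mem hx hi, a.nat vGround (by decide), a.nat vCand (by decide),
      hc₃.ground, hS₃, Finset.mem_sdiff]
  have hc₄ := hc₃.agree a₄ (by decide)
  have hS₄ : toSet n (τ₄.nat vCand) = S := by rw [a₄.nat _ (by decide), hS₃]
  rw [filter_mem_range hSr] at h₃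
  rw [filter_mem_range hDr] at h₄
  rw [filter_mem_range hSr, filter_mem_range hDr] at h₁ h₂
  rw [hc.mat] at h₁
  rw [hc₁.mat] at h₂
  have hall := ((a₁.trans a₂).trans a₃).trans a₄
  have hb₄ := hb.agree hall (by decide)
  have hs₄ : score τ₄ = score σ := score_agree hall (by decide)
  have e1 : τ₄.real rNum 0 0 = ∑ i ∈ S, ∑ j ∈ V \ S, P i j := by
    rw [((a₂.trans a₃).trans a₄).real rNum (by decide), h₁]
  have e2 : τ₄.real rNum' 0 0 = ∑ i ∈ V \ S, ∑ j ∈ S, P i j := by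
    rw [(a₃.trans a₄).real rNum' (by decide), h₂]
  have e3 : τ₄.nat vCnt 0 0 = S.card := by rw [a₄.nat vCnt (by decide), h₃]
  have hr : (τ₄.real rNum 0 0 + τ₄.real rNum' 0 0) /
      (2 * (τ₄.nat vCnt 0 0 : ℝ) * (τ₄.nat vCnt' 0 0 : ℝ)) = ratio V P S := by
    rw [e1, e2, e3, h₄, ratio, sum_cutDist_mul hSV, sum_cutDist hSV]
  rw [e3, h₄] at hr
  refine Spec.letReal_cons fun τ₅ a₅ h₅ => ?_
  replace h₅ : τ₅.real rRatio 0 0 = ratio V P S := by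
    rw [h₅, ← hr]
    simp [e3, h₄]
  have hc₅ := hc₄.agree a₅ (by decide)
  have hb₅ := hb₄.agree a₅ (by decide)
  have hs₅ : score τ₅ = score σ := by rw [score_agree a₅ (by decide), hs₄]
  refine Spec.block_cons (Spec.ite (fun ht => ?_) (fun ht => ?_)) fun _ _ h => .block_nil h
  · simp only [Test.Holds, NExp.eval, RExp.eval, NExp.var, RExp.var, h₅,
      a₅.nat vCnt (by decide), a₅.nat vCnt' (by decide), e3, h₄] at ht
    obtain ⟨⟨hpos, hpos'⟩, hlt⟩ := ht
    have hne : S.Nonempty := Finset.card_pos.1 hpos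
    have hss : S ⊂ V := by
      refine hSV.ssubset_of_ne ?_
      rintro rfl
      simp at hpos'
    refine Spec.letNat_cons fun τ₆ a₆ h₆ => Spec.letReal_cons fun τ₇ a₇ h₇ => ?_
    have a₆₇ := a₆.trans a₇
    refine Spec.block_cons (Spec.assignSet (· ∈ S) (hc₅.agree a₆₇ (by decide)).size (by decide) ?_)
      fun τ₈ a₈ h₈ => .block_nil ?_
    · intro i hi τ a hx _
      rw [holds_mem hx hi, a.nat vCand (by decide), a₆₇.nat vCand (by decide),
        a₅.nat vCand (by decide), hS₄]
    have hcut : toSet n (τ₈.nat vCut) = S := by rw [h₈, toSet_assign hSr]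
    have hhave : τ₈.nat vHave 0 0 = 1 := by
      rw [(a₇.trans a₈).nat vHave (by decide), h₆]; rfl
    have hbest : τ₈.real rBest 0 0 = ratio V P S := by
      rw [a₈.real rBest (by decide), h₇]
      simp only [RExp.eval, RExp.var, NExp.eval]
      rw [a₆.real rRatio (by decide), h₅]
    have hsc : score τ₈ = (ratio V P S : ℝ) := by simp [score, hhave, hbest]
    refine ⟨⟨fun h => by omega, fun _ => ?_, ?_⟩, ?_, fun _ _ => hsc.le⟩
    · rw [hcut]; exact ⟨hne, hss, hbest⟩
    · rw [hcut]; exact hST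
    · rw [hsc, ← hs₅, score]
      split_ifs with h0
      · exact le_top
      · rcases hlt with hlt | hlt
        · exact absurd hlt h0
        · exact WithTop.coe_le_coe.2 (not_le.1 hlt).le
  · simp only [Test.Holds, NExp.eval, RExp.eval, NExp.var, RExp.var, h₅,
      a₅.nat vCnt (by decide), a₅.nat vCnt' (by decide), e3, h₄] at ht
    refine .skip ⟨hb₅, hs₅.le, fun hne hss => ?_⟩
    have h1 : 0 < S.card := hne.card_pos
    have h2 : 0 < (V \ S).card := Finset.card_pos.2 (Finset.sdiff_nonempty.2 hss.2)
    simp only [h1, h2, true_and, not_or, not_not] at ht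
    rw [score, if_neg ht.1]
    exact WithTop.coe_le_coe.2 ht.2

/-- Compare all cuts consisting of the points near the set `vA`. -/
def sweep : Cmd :=
  forAll vY (forAll vZ (.ite (.and (mem vGround vY) (mem vGround vZ))
    (.block [
      forAll vX (.block [
        assignCard vCnt (.and (mem vA vI) (.realLe (.at rD vI vX) (.at rD vY vZ))),
        .ite (.and (mem vGround vX) (.natLt (.lit 0) (.var vCnt)))
          (.setNat vCand (.var vX) (.lit 0) (.lit 1))
          (.setNat vCand (.var vX) (.lit 0) (.lit 0))]),
      evaluate])
    .skip))

/-- No cut consisting of the points near `A` has a ratio below `s`. -/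
def Tested (V : Finset ℕ) (P d : ℕ → ℕ → ℝ) (s : WithTop ℝ) (A : Finset ℕ) : Prop :=
  ∀ y ∈ V, ∀ z ∈ V, (near V d A (d y z)).Nonempty → near V d A (d y z) ⊂ V →
    s ≤ (ratio V P (near V d A (d y z)) : ℝ)

theorem Tested.mono {d : ℕ → ℕ → ℝ} {s s' : WithTop ℝ} {A : Finset ℕ} (h : Tested V P d s A)
    (hs : s' ≤ s) : Tested V P d s' A :=
  fun y hy z hz h1 h2 => hs.trans (h y hy z hz h1 h2)

/-- Symmetrizing doubles what crosses a cut, and the constant adds `η` for each separated pair;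
hence the passage from `ρ` to `2 ρ + η`. -/
theorem Tested.swept {d : ℕ → ℕ → ℝ} {ρ : ℝ} {s : WithTop ℝ} {A : Finset ℕ}
    (h : Tested V P d s A) (hρ : (ρ : WithTop ℝ) ≤ s) (η : ℝ) :
    Swept V d (fun x y => P x y + P y x + η) (2 * ρ + η) A := by
  intro y hy z hz h1 h2
  have h3 := WithTop.coe_le_coe.1 (hρ.trans (h y hy z hz h1 h2))
  rw [ratio, le_div_iff₀ (sum_cutDist_pos h1 h2)] at h3
  rw [sum_cutDist_mul_cap]
  linarith

/-- Points of `T` have equal distance from `A`, so no threshold cut splits `T`. Up to complement,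
every proper non-empty candidate is therefore disjoint from `T`. -/
theorem near_resp {d : ℕ → ℕ → ℝ} {A : Finset ℕ} {r : ℝ} (hd : Semimetric V d) (hA : A ⊆ V)
    (hTV : T ⊆ V) (hT : ∀ s ∈ T, ∀ t ∈ T, d s t = 0) :
    ∀ s ∈ T, ∀ t ∈ T, s ∈ near V d A r → t ∈ near V d A r := by
  intro s hs t ht h
  obtain ⟨hsV, a, ha, hr⟩ := Finset.mem_filter.1 h
  refine Finset.mem_filter.2 ⟨hTV ht, a, ha, ?_⟩
  have := hd.triangle a (hA ha) s hsV t (hTV ht)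
  rw [hT s hs t ht] at this
  linarith

theorem sweep_spec (hc : Ctx n V T P σ)
    (hb : BestInv n V T P σ) (hTV : T ⊆ V)
    {d : ℕ → ℕ → ℝ} (hdσ : σ.real rD = d) (hd : Semimetric V d)
    (hdT : ∀ s ∈ T, ∀ t ∈ T, d s t = 0) {A : Finset ℕ} (hA : toSet n (σ.nat vA) = A)
    (hAV : A ⊆ V) :
    Spec n K sweep σ fun τ => BestInv n V T P τ ∧ score τ ≤ score σ ∧
      Tested V P d (score τ) A := by
  refine (Spec.forAll₂ (fun k l τ => BestInv n V T P τ ∧ score τ ≤ score σ ∧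
    ∀ y ∈ V, ∀ z ∈ V, (y < k ∨ y = k ∧ z < l) → (near V d A (d y z)).Nonempty →
      near V d A (d y z) ⊂ V → score τ ≤ (ratio V P (near V d A (d y z)) : ℝ))
    hc.size (by decide) ?_ ?_ ?_ ?_).mono ?_
  · rintro k l τ τ' h ⟨h1, h2, h3⟩
    rw [score_agree h (by decide)]
    exact ⟨h1.agree h (by decide), h2, h3⟩
  · exact ⟨hb, le_rfl, fun y _ z _ h => by omega⟩
  · rintro k τ ⟨h1, h2, h3⟩
    refine ⟨h1, h2, fun y hy z hz h => h3 y hy z hz ?_⟩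
    have := Finset.mem_range.1 (hc.V_subset hz)
    omega
  · rintro y hy z hz τ ha hτn hτy hτz ⟨h1, h2, h3⟩
    have hcτ : Ctx n V T P τ := hc.agree ha (by decide)
    have hAτ : toSet n (τ.nat vA) = A := by
      rw [ha.nat vA (by decide), hA]
    have hdτ : τ.real rD = d := by rw [ha.real rD (by decide), hdσ]
    refine Spec.ite (fun ht => ?_) (fun ht => .skip ?_)
    · simp only [Test.Holds, holds_mem hτy hy, holds_mem hτz hz, hcτ.ground] at ht
      refine Spec.block_cons (Q' := fun τ' => toSet n (τ'.nat vCand) = near V d A (d y z)) ?_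
        fun τ₁ a₁ hcand => ?_
      · refine (Spec.forAll (fun k τ' => ∀ x < k, 0 < τ'.nat vCand x 0 ↔ x ∈ near V d A (d y z))
          hτn (by decide) ?_ ?_ ?_).mono ?_
        · intro k ρ ρ' hρ h
          rwa [hρ.nat vCand (by decide)]
        · intro x hx; omega
        · intro x hx ρ aρ hρn hρx hI
          have hcρ : Ctx n V T P ρ := hcτ.agree aρ (by decide)
          have hAρ : toSet n (ρ.nat vA) = A := by
            rw [aρ.nat vA (by decide), hAτ]
          have hdρ : ρ.real rD = d := by rw [aρ.real rD (by decide), hdτ]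
          have hyρ : ρ.nat vY 0 0 = y := by rw [aρ.nat vY (by decide), hτy]
          have hzρ : ρ.nat vZ 0 0 = z := by rw [aρ.nat vZ (by decide), hτz]
          refine Spec.block_cons (Spec.assignCard (fun i => i ∈ A ∧ d i x ≤ d y z) hρn
            (by decide) ?_) fun π aπ hπ => ?_
          · intro i hi π aπ hπ
            simp only [Test.Holds, RExp.eval, NExp.eval, NExp.var]
            rw [holds_mem hπ hi, aπ.nat vA (by decide), hAρ,
              aπ.real rD (by decide), hdρ, hπ, aπ.nat vX (by decide), hρx,
              aπ.nat vY (by decide), hyρ, aπ.nat vZ (by decide), hzρ]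
          have hcπ : Ctx n V T P π := hcρ.agree aπ (by decide)
          have hxπ : π.nat vX 0 0 = x := by rw [aπ.nat vX (by decide), hρx]
          have key : (x ∈ V ∧ 0 < π.nat vCnt 0 0) ↔ x ∈ near V d A (d y z) := by
            rw [hπ, Finset.card_pos, near, Finset.mem_filter]
            refine and_congr_right fun _ => ?_
            constructor
            · rintro ⟨i, hi⟩
              exact ⟨i, (Finset.mem_filter.1 hi).2⟩
            · rintro ⟨i, hi⟩
              exact ⟨i, Finset.mem_filter.2 ⟨hcτ.V_subset (hAV hi.1), hi⟩⟩
          have hold : π.nat vCand = ρ.nat vCand := aπ.nat _ (by decide)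
          refine Spec.block_cons (Spec.ite (fun h => .setNat ?_) (fun h => .setNat ?_))
            fun _ _ h => .block_nil h
          all_goals
            simp only [Test.Holds, holds_mem hxπ hx, hcπ.ground, NExp.eval, NExp.var, key] at h
            intro x' hx'
            simp only [NExp.eval, NExp.var, Store.setNat_nat_same, upd_apply, hxπ, hold]
            by_cases hxx : x' = x
            · subst hxx; simp [h]
            · simp [hxx, hI x' (by omega)]
        · intro π _ hπ
          ext i
          rw [mem_toSet]
          refine ⟨fun h => (hπ i h.1).1 h.2, fun h => ?_⟩
          have hi := Finset.mem_range.1 (hc.V_subset (Finset.filter_subset _ _ h))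
          exact ⟨hi, (hπ i hi).2 h⟩
      · have hs1 := score_agree a₁ (by decide)
        refine Spec.block_cons (evaluate_spec (hcτ.agree a₁ (by decide))
          (h1.agree a₁ (by decide)) hcand (Finset.filter_subset _ _)
          (near_resp hd hAV hTV hdT)) fun τ₂ _ h => .block_nil ?_
        obtain ⟨g1, g2, g3⟩ := h
        rw [hs1] at g2
        refine ⟨g1, g2.trans h2, fun y' hy' z' hz' hlt hne hss => ?_⟩
        by_cases heq : y' = y ∧ z' = z
        · obtain ⟨rfl, rfl⟩ := heq
          exact g3 hne hss
        · exact g2.trans (h3 y' hy' z' hz' (by omega) hne hss)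
    · simp only [Test.Holds, holds_mem hτy hy, holds_mem hτz hz, hcτ.ground] at ht
      refine ⟨h1, h2, fun y' hy' z' hz' hlt hne hss => h3 y' hy' z' hz' ?_ hne hss⟩
      by_contra hcon
      obtain ⟨rfl, rfl⟩ : y' = y ∧ z' = z := by omega
      exact ht ⟨hy', hz'⟩
  · rintro τ - ⟨h1, h2, h3⟩
    exact ⟨h1, h2, fun y hy z hz => h3 y hy z hz
      (Or.inl (Finset.mem_range.1 (hc.V_subset hy)))⟩

end RealRAM

/-! ### Shortest distances with a record of changes, and the flow recovered from it. -/

namespace RealRAM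

variable {n K : ℕ} {V T : Finset ℕ} {P : ℕ → ℕ → ℝ} {σ τ : Store}

/-- A loop whose body makes `m` steps of an iteration. -/
theorem Spec.iterate {x m : ℕ} {body : Cmd} (Inv : ℕ → Store → Prop)
    (hn : ∀ t τ, Inv t τ → τ.nat vN 0 0 = n) (hW : x ≠ vN ∧ vN ∉ body.natW ∧ x ∉ body.natW)
    (hst : ∀ t τ τ', Agree [x] [] τ τ' → Inv t τ → Inv t τ')
    (hs : ∀ t τ, Inv t τ → Spec n K body τ (Inv (t + m))) (t : ℕ) (σ : Store) (h0 : Inv t σ) :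
    Spec n K (RealRAM.forAll x body) σ (Inv (t + n * m)) := by
  refine Spec.forAll (fun k τ => Inv (t + k * m) τ) (hn _ _ h0) hW (fun k => hst _) (by simpa) ?_
  intro k _ τ _ _ _ hI
  have := hs _ τ hI
  rwa [add_assoc, ← Nat.succ_mul] at this

/-- Replace the distance of `vI` and `vJ` by the length of the way through `vK`, and record this
on the stack. -/
def relax : Cmd :=
  .block [
    .setReal rD (.var vI) (.var vJ) (.add (.at rD vI vK) (.at rD vK vJ)),
    .setNat vSI (.var vTop) (.lit 0) (.var vI),
    .setNat vSJ (.var vTop) (.lit 0) (.var vJ),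
    .setNat vSK (.var vTop) (.lit 0) (.var vK),
    .letNat vTop (.add (.var vTop) (.lit 1))]

/-- All shortest distances, by the algorithm of Floyd and Warshall, with a record of all changes. -/
def floydWarshall : Cmd :=
  .block [.letNat vTop (.lit 0),
    forAll vK (forAll vI (forAll vJ
      (.ite (.and (.and (mem vGround vK) (mem vGround vI)) (.and (mem vGround vJ)
          (.not (.realLe (.at rD vI vJ) (.add (.at rD vI vK) (.at rD vK vJ))))))
        relax .skip)))]

/-- The entries of the stack below `m` lead from the matrix `D 0` to the matrix `D m`. -/
def Recorded (V : Finset ℕ) (D : ℕ → ℕ → ℕ → ℝ) (σ : Store) (m : ℕ) : Prop :=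
  ∀ q < m, ∃ i ∈ V, ∃ j ∈ V, ∃ k ∈ V, k ≠ i ∧ k ≠ j ∧
    σ.nat vSI q 0 = i ∧ σ.nat vSJ q 0 = j ∧ σ.nat vSK q 0 = k ∧
      D (q + 1) = upd (D q) i j (D q i k + D q k j)

/-- The stack leads from `d₀` to the current matrix of distances. -/
def History (V : Finset ℕ) (d₀ : ℕ → ℕ → ℝ) (σ : Store) : Prop :=
  ∃ D : ℕ → ℕ → ℕ → ℝ, D 0 = d₀ ∧ D (σ.nat vTop 0 0) = σ.real rD ∧
    Recorded V D σ (σ.nat vTop 0 0)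

theorem Recorded.agree {D : ℕ → ℕ → ℕ → ℝ} {m : ℕ} (h : Recorded V D σ m) {N R : List ℕ}
    (ha : Agree N R σ τ) (hW : vSI ∉ N ∧ vSJ ∉ N ∧ vSK ∉ N) : Recorded V D τ m := by
  unfold Recorded
  rw [ha.nat _ hW.1, ha.nat _ hW.2.1, ha.nat _ hW.2.2]
  exact h

theorem History.agree {d₀ : ℕ → ℕ → ℝ} (h : History V d₀ σ) {N R : List ℕ}
    (ha : Agree N R σ τ) (hW : (vSI ∉ N ∧ vSJ ∉ N ∧ vSK ∉ N) ∧ vTop ∉ N ∧ rD ∉ R) :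
    History V d₀ τ := by
  obtain ⟨D, h0, h1, h2⟩ := h
  refine ⟨D, h0, ?_, ?_⟩
  · rw [ha.nat _ hW.2.1, ha.real _ hW.2.2, h1]
  · rw [ha.nat _ hW.2.1]; exact h2.agree ha hW.1

theorem relax_spec {d₀ : ℕ → ℕ → ℝ} {i j k : ℕ} (hi : σ.nat vI 0 0 = i) (hj : σ.nat vJ 0 0 = j)
    (hk : σ.nat vK 0 0 = k) (hiV : i ∈ V) (hjV : j ∈ V) (hkV : k ∈ V) (hki : k ≠ i) (hkj : k ≠ j)
    (hh : History V d₀ σ) :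
    Spec n K relax σ fun τ => History V d₀ τ ∧ τ.nat vTop 0 0 = σ.nat vTop 0 0 + 1 ∧
      τ.real rD = upd (σ.real rD) i j (σ.real rD i k + σ.real rD k j) := by
  refine Spec.setReal_cons fun τ₁ a₁ h₁ => Spec.setNat_cons fun τ₂ a₂ h₂ =>
    Spec.setNat_cons fun τ₃ a₃ h₃ => Spec.setNat_cons fun τ₄ a₄ h₄ =>
    Spec.letNat_cons fun τ₅ a₅ h₅ => .block_nil ?_
  simp only [NExp.eval, RExp.eval, NExp.var, hi, hj, hk] at h₁
  simp only [NExp.eval, NExp.var, a₁.nat vTop (by decide), a₁.nat vI (by decide), hi] at h₂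
  simp only [NExp.eval, NExp.var, (a₁.trans a₂).nat vTop (by decide),
    (a₁.trans a₂).nat vJ (by decide), hj] at h₃
  simp only [NExp.eval, NExp.var, ((a₁.trans a₂).trans a₃).nat vTop (by decide),
    ((a₁.trans a₂).trans a₃).nat vK (by decide), hk] at h₄
  simp only [NExp.eval, NExp.var, (((a₁.trans a₂).trans a₃).trans a₄).nat vTop (by decide)] at h₅
  have eD : τ₅.real rD = upd (σ.real rD) i j (σ.real rD i k + σ.real rD k j) := by
    rw [(((a₂.trans a₃).trans a₄).trans a₅).real rD (by decide), h₁]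
  have eI : τ₅.nat vSI = upd (σ.nat vSI) (σ.nat vTop 0 0) 0 i := by
    rw [((a₃.trans a₄).trans a₅).nat vSI (by decide), h₂, a₁.nat vSI (by decide)]
  have eJ : τ₅.nat vSJ = upd (σ.nat vSJ) (σ.nat vTop 0 0) 0 j := by
    rw [(a₄.trans a₅).nat vSJ (by decide), h₃, (a₁.trans a₂).nat vSJ (by decide)]
  have eK : τ₅.nat vSK = upd (σ.nat vSK) (σ.nat vTop 0 0) 0 k := by
    rw [a₅.nat vSK (by decide), h₄, ((a₁.trans a₂).trans a₃).nat vSK (by decide)]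
  refine ⟨?_, h₅, eD⟩
  obtain ⟨D, h0, h1, h2⟩ := hh
  set t := σ.nat vTop 0 0
  refine ⟨Function.update D (t + 1) (upd (D t) i j (D t i k + D t k j)), ?_, ?_, ?_⟩
  · rw [Function.update_of_ne (by omega), h0]
  · rw [h₅, Function.update_self, h1, eD]
  · intro q hq
    rw [h₅] at hq
    rcases Nat.lt_succ_iff_lt_or_eq.1 hq with hlt | rfl
    · obtain ⟨i', hi', j', hj', k', hk', e1, e2, e3, e4, e5, e6⟩ := h2 q hlt
      refine ⟨i', hi', j', hj', k', hk', e1, e2, ?_, ?_, ?_, ?_⟩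
      · rw [eI, upd_apply, if_neg (by omega), e3]
      · rw [eJ, upd_apply, if_neg (by omega), e4]
      · rw [eK, upd_apply, if_neg (by omega), e5]
      · rw [Function.update_of_ne (by omega), Function.update_of_ne (by omega), e6]
    · refine ⟨i, hiV, j, hjV, k, hkV, hki, hkj, by rw [eI]; simp, by rw [eJ]; simp,
        by rw [eK]; simp, ?_⟩
      rw [Function.update_self, Function.update_of_ne (by omega)]

/-- The matrix is updated in place. This is harmless, since in round `k` the entries `(i, k)` and
`(k, j)` keep their values, `d k k` being zero. Each triple `(k, i, j)` pushes at most one record,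
whence the height `n * n * n`. -/
theorem floydWarshall_spec (hc : Ctx n V T P σ) {d₀ : ℕ → ℕ → ℝ} (hd : σ.real rD = d₀)
    (h0 : FWInv V d₀ 0 d₀) :
    Spec n K floydWarshall σ fun τ => FWInv V d₀ n (τ.real rD) ∧ History V d₀ τ ∧
      τ.nat vTop 0 0 ≤ n * n * n := by
  refine Spec.letNat_cons fun τ₀ a₀ e₀ => Spec.block_cons
    (Spec.forAll (fun k τ => FWInv V d₀ k (τ.real rD) ∧ History V d₀ τ ∧
      τ.nat vTop 0 0 ≤ k * n * n) (hc.agree a₀ (by decide)).size (by decide) ?_ ?_ ?_)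
    fun _ _ h => .block_nil h
  · rintro k τ τ' h ⟨h1, h2, h3⟩
    rw [h.real rD (by decide), h.nat vTop (by decide)]
    exact ⟨h1, h2.agree h (by decide), h3⟩
  · rw [a₀.real rD (by decide), hd, e₀]
    refine ⟨h0, ⟨fun _ => d₀, rfl, ?_, ?_⟩, by simp [NExp.eval]⟩
    · rw [a₀.real rD (by decide), hd]
    · intro q hq
      rw [e₀] at hq
      exact absurd hq (Nat.not_lt_zero q)
  · rintro k hk τ a hn hτk ⟨h1, h2, h3⟩
    have hcτ := (hc.agree a₀ (by decide)).agree a (by decide)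
    set d := τ.real rD with hdd
    refine (Spec.forAll₂ (fun i j ρ => (∀ x ∈ V, ∀ y ∈ V, ρ.real rD x y =
      if x < i ∨ x = i ∧ y < j then fwRound V d k x y else d x y) ∧ History V d₀ ρ ∧
      ρ.nat vTop 0 0 ≤ (k * n + i) * n + j) hn (by decide) ?_ ?_ ?_ ?_).mono ?_
    · rintro i j ρ ρ' h ⟨g1, g2, g3⟩
      rw [h.real rD (by decide), h.nat vTop (by decide)]
      exact ⟨g1, g2.agree h (by decide), g3⟩
    · exact ⟨fun x _ y _ => by simp [hdd], h2, by simpa using h3⟩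
    · rintro i ρ ⟨g1, g2, g3⟩
      refine ⟨fun x hx y hy => ?_, g2, by nlinarith⟩
      have := Finset.mem_range.1 (hc.V_subset hy)
      rw [g1 x hx y hy]
      have : (x < i ∨ x = i ∧ y < n) ↔ (x < i + 1 ∨ x = i + 1 ∧ y < 0) := by omega
      simp only [this]
    · rintro i hi j hj ρ aρ hnρ hiρ hjρ ⟨g1, g2, g3⟩
      have hcρ := hcτ.agree aρ (by decide)
      have hkρ : ρ.nat vK 0 0 = k := by rw [aρ.nat vK (by decide), hτk]
      have hout : ∀ v : ℝ, (i ∈ V → j ∈ V → fwRound V d k i j = v) → ∀ f : ℕ → ℕ → ℝ,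
          (∀ x ∈ V, ∀ y ∈ V, f x y = upd (ρ.real rD) i j v x y) → ∀ x ∈ V, ∀ y ∈ V, f x y =
          if x < i ∨ x = i ∧ y < j + 1 then fwRound V d k x y else d x y := by
        intro v hv f hf x hx y hy
        rw [hf x hx y hy, upd_apply]
        split_ifs with c1 c2 c2
        · obtain ⟨rfl, rfl⟩ := c1
          exact (hv hx hy).symm
        · omega
        · rw [g1 x hx y hy, if_pos (by omega)]
        · rw [g1 x hx y hy, if_neg (by omega)]
      have hself : ∀ v : ℝ, v = ρ.real rD i j → ∀ x ∈ V, ∀ y ∈ V,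
          ρ.real rD x y = upd (ρ.real rD) i j v x y := by
        rintro v rfl x _ y _
        rw [upd_apply]
        split_ifs with c
        · rw [c.1, c.2]
        · rfl
      by_cases hkij : k ∈ V ∧ i ∈ V ∧ j ∈ V
      · obtain ⟨hkV, hiV, hjV⟩ := hkij
        have ekk := h1.self k hkV
        have eij : ρ.real rD i j = d i j := by rw [g1 i hiV j hjV, if_neg (by omega)]
        have eik : ρ.real rD i k = d i k := by
          rw [g1 i hiV k hkV, fwRound, if_pos hkV, ekk, add_zero, min_self, ite_self]
        have ekj : ρ.real rD k j = d k j := by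
          rw [g1 k hkV j hjV, fwRound, if_pos hkV, ekk, zero_add, min_self, ite_self]
        refine Spec.ite (fun ht => ?_) (fun ht => .skip ?_)
        · simp only [Test.Holds, RExp.eval, NExp.eval, NExp.var, hiρ, hjρ, hkρ, eij, eik,
            ekj, not_le] at ht
          have hlt := ht.2.2
          refine (relax_spec hiρ hjρ hkρ hiV hjV hkV ?_ ?_ g2).mono ?_
          -- A way through one of its own endpoints is never strictly shorter, because `d k k = 0`.
          · rintro rfl
            rw [ekk] at hlt; linarith
          · rintro rfl
            rw [ekk] at hlt; linarith
          · rintro π - ⟨p1, p2, p3⟩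
            refine ⟨hout _ (fun _ _ => ?_) _ (fun x _ y _ => by rw [p3]), p1, by omega⟩
            rw [fwRound, if_pos hkV, eik, ekj, min_eq_right hlt.le]
        · simp only [Test.Holds, holds_mem hkρ hk, holds_mem hiρ hi, holds_mem hjρ hj,
            hcρ.ground, hkV, hiV, hjV, RExp.eval, NExp.eval, NExp.var, hiρ, hjρ, hkρ, eij, eik,
            ekj, not_le, true_and, not_lt] at ht
          refine ⟨hout (ρ.real rD i j) (fun _ _ => ?_) _ (hself _ rfl), g2, by omega⟩
          rw [fwRound, if_pos hkV, eij, min_eq_left ht]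
      · refine Spec.ite (fun ht => ?_) (fun ht => .skip ?_)
        · simp only [Test.Holds, holds_mem hkρ hk, holds_mem hiρ hi, holds_mem hjρ hj,
            hcρ.ground] at ht
          exact absurd ⟨ht.1.1, ht.1.2, ht.2.1⟩ hkij
        · refine ⟨hout (ρ.real rD i j) (fun hiV hjV => ?_) _ (hself _ rfl), g2, by omega⟩
          have hkV : k ∉ V := fun h => hkij ⟨h, hiV, hjV⟩
          rw [fwRound, if_neg hkV, g1 i hiV j hjV, if_neg (by omega)]
    · rintro ρ - ⟨g1, g2, g3⟩
      refine ⟨h1.round.congr fun x hx y hy => ?_, g2, by nlinarith⟩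
      rw [g1 x hx y hy, if_pos (Or.inl (Finset.mem_range.1 (hc.V_subset hx)))]

/-- Undo the last change of the distances, and reroute the flow accordingly. -/
def unwindStep : Cmd :=
  .ite (.natLt (.lit 0) (.var vTop))
    (.block [
      .letNat vTop (.sub (.var vTop) (.lit 1)),
      .letNat vMI (.get vSI (.var vTop) (.lit 0)),
      .letNat vMJ (.get vSJ (.var vTop) (.lit 0)),
      .letNat vMK (.get vSK (.var vTop) (.lit 0)),
      .setReal rG (.var vMI) (.var vMK) (.add (.at rG vMI vMK) (.at rG vMI vMJ)),
      .setReal rG (.var vMK) (.var vMJ) (.add (.at rG vMK vMJ) (.at rG vMI vMJ)),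
      .setReal rG (.var vMI) (.var vMJ) (.ofNat (.lit 0))])
    .skip

def unwind : Cmd := forAll vW₁ (forAll vW₂ (forAll vW₃ unwindStep))

/-- A flow that routes one unit between any two points of `V`: it crosses every cut often enough,
and its cost with respect to `d` is `α`. -/
structure IsFlow (V : Finset ℕ) (d : ℕ → ℕ → ℝ) (α : ℝ) (g : ℕ → ℕ → ℝ) : Prop where
  nonneg : ∀ x ∈ V, ∀ y ∈ V, 0 ≤ g x y
  cost : ∑ x ∈ V, ∑ y ∈ V, g x y * d x y = α
  cut : ∀ R : Finset ℕ, ∑ x ∈ V, ∑ y ∈ V, cutDist R x y ≤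
    ∑ x ∈ V, ∑ y ∈ V, g x y * cutDist R x y

/-- A relaxation set the distance of `i` and `j` to the length of the way through `k`. Sending the
flow from `i` to `j` over `k` therefore gives the same cost with respect to the matrix before the
relaxation, and the flow crosses each cut at least as much as before. Once the stack is empty, the
cost refers to the original lengths. -/
theorem unwindStep_spec {D : ℕ → ℕ → ℕ → ℝ} {α : ℝ} {t : ℕ} (hn : σ.nat vN 0 0 = n)
    (hr : Recorded V D σ (σ.nat vTop 0 0)) (ht : σ.nat vTop 0 0 ≤ n * n * n - t)
    (hf : IsFlow V (D (σ.nat vTop 0 0)) α (σ.real rG)) :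
    Spec n K unwindStep σ fun τ => τ.nat vN 0 0 = n ∧ Recorded V D τ (τ.nat vTop 0 0) ∧
      τ.nat vTop 0 0 ≤ n * n * n - (t + 1) ∧ IsFlow V (D (τ.nat vTop 0 0)) α (τ.real rG) := by
  refine Spec.ite (fun hb => ?_) (fun hb => .skip ?_)
  · simp only [Test.Holds, NExp.eval, NExp.var] at hb
    obtain ⟨s, hs⟩ : ∃ s, σ.nat vTop 0 0 = s + 1 := ⟨σ.nat vTop 0 0 - 1, by omega⟩
    rw [hs] at hr hf ht
    obtain ⟨i, hi, j, hj, k, hk, hki, hkj, e1, e2, e3, e4⟩ := hr s (by omega)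
    refine Spec.letNat_cons fun τ₁ a₁ h₁ => Spec.letNat_cons fun τ₂ a₂ h₂ =>
      Spec.letNat_cons fun τ₃ a₃ h₃ => Spec.letNat_cons fun τ₄ a₄ h₄ =>
      Spec.setReal_cons fun τ₅ a₅ h₅ => Spec.setReal_cons fun τ₆ a₆ h₆ =>
      Spec.setReal_cons fun τ₇ a₇ h₇ => .block_nil ?_
    simp only [NExp.eval, NExp.var, hs, Nat.add_sub_cancel] at h₁
    simp only [NExp.eval, NExp.var, h₁, a₁.nat vSI (by decide), e1] at h₂
    simp only [NExp.eval, NExp.var, a₂.nat vTop (by decide), h₁,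
      (a₁.trans a₂).nat vSJ (by decide), e2] at h₃
    simp only [NExp.eval, NExp.var, (a₂.trans a₃).nat vTop (by decide), h₁,
      ((a₁.trans a₂).trans a₃).nat vSK (by decide), e3] at h₄
    have hI₄ : τ₄.nat vMI 0 0 = i := by rw [(a₃.trans a₄).nat vMI (by decide), h₂]
    have hJ₄ : τ₄.nat vMJ 0 0 = j := by rw [a₄.nat vMJ (by decide), h₃]
    simp only [RExp.eval, NExp.eval, NExp.var, hI₄, hJ₄, h₄,
      (((a₁.trans a₂).trans a₃).trans a₄).real rG (by decide)] at h₅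
    simp only [RExp.eval, NExp.eval, NExp.var, a₅.nat vMI (by decide), a₅.nat vMJ (by decide),
      a₅.nat vMK (by decide), hI₄, hJ₄, h₄, h₅] at h₆
    simp only [RExp.eval, NExp.eval, NExp.var, (a₅.trans a₆).nat vMI (by decide),
      (a₅.trans a₆).nat vMJ (by decide), hI₄, hJ₄, h₆, Nat.cast_zero] at h₇
    have hg : τ₇.real rG = reroute (σ.real rG) i j k := h₇
    have hall := (((((a₂.trans a₃).trans a₄).trans a₅).trans a₆).trans a₇)
    have htop : τ₇.nat vTop 0 0 = s := by rw [hall.nat vTop (by decide), h₁]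
    rw [htop, hg]
    refine ⟨?_, ?_, by omega, ⟨reroute_nonneg hi hj hk hf.nonneg, ?_, fun R => ?_⟩⟩
    · rw [(a₁.trans hall).nat vN (by decide), hn]
    · exact Recorded.agree (fun q hq => hr q (by omega)) (a₁.trans hall) (by decide)
    · rw [sum_reroute_mul _ _ hi hj hk hki hkj, ← hf.cost, e4]
      simp only [mul_comm (σ.real rG _ _)]
      rw [← sum_upd_mul (V := V) (D s) (σ.real rG) hi hj]
    · rw [sum_reroute_mul _ _ hi hj hk hki hkj]
      have h1 := hf.nonneg i hi j hj
      have h2 := cutDist_triangle R i k j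
      nlinarith [hf.cut R, mul_nonneg h1 (sub_nonneg.2 h2)]
  · simp only [Test.Holds, NExp.eval, NExp.var] at hb
    exact ⟨hn, hr, by omega, hf⟩

theorem unwind_spec {d₀ : ℕ → ℕ → ℝ} {α : ℝ} (hn : σ.nat vN 0 0 = n)
    (hh : History V d₀ σ) (ht : σ.nat vTop 0 0 ≤ n * n * n)
    (hf : IsFlow V (σ.real rD) α (σ.real rG)) :
    Spec n K unwind σ fun τ => IsFlow V d₀ α (τ.real rG) := by
  obtain ⟨D, h0, h1, h2⟩ := hh
  rw [← h1] at hf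
  let Inv : ℕ → Store → Prop := fun t τ => τ.nat vN 0 0 = n ∧
    Recorded V D τ (τ.nat vTop 0 0) ∧ τ.nat vTop 0 0 ≤ n * n * n - t ∧
      IsFlow V (D (τ.nat vTop 0 0)) α (τ.real rG)
  have hst : ∀ x ∈ [vW₁, vW₂, vW₃], ∀ t τ τ', Agree [x] [] τ τ' → Inv t τ → Inv t τ' := by
    rintro x hx t τ τ' a ⟨i1, i2, i3, i4⟩
    have b : Agree [vW₁, vW₂, vW₃] [] τ τ' := a.mono (by simpa using hx) (by simp)
    refine ⟨?_, ?_, ?_, ?_⟩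
    · rw [b.nat vN (by decide), i1]
    · rw [b.nat vTop (by decide)]; exact i2.agree b (by decide)
    · rw [b.nat vTop (by decide)]; exact i3
    · rw [b.nat vTop (by decide), b.real rG (by decide)]; exact i4
  have hstep : ∀ t τ, Inv t τ → Spec n K unwindStep τ (Inv (t + 1)) :=
    fun t τ h => unwindStep_spec h.1 h.2.1 h.2.2.1 h.2.2.2
  have hI : Inv 0 σ := ⟨hn, h2, by simpa using ht, hf⟩
  refine (Spec.iterate Inv (fun _ _ h => h.1) (by decide) (hst vW₁ (by decide))
    (Spec.iterate Inv (fun _ _ h => h.1) (by decide) (hst vW₂ (by decide))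
      (Spec.iterate Inv (fun _ _ h => h.1) (by decide) (hst vW₃ (by decide)) hstep)) 0 σ hI).mono ?_
  rintro τ - ⟨-, -, h3, h4⟩
  have : τ.nat vTop 0 0 = 0 := by
    rw [mul_one, zero_add, ← mul_assoc, Nat.sub_self] at h3
    omega
  rwa [this, h0] at h4

end RealRAM

/-! ### Carving balls: one round of the search for sparse cuts. -/

namespace RealRAM

variable {n K : ℕ} {V T : Finset ℕ} {P : ℕ → ℕ → ℝ} {σ τ : Store}

/-- Enlarge the radius about `vV` in steps of `rH` as long as this doubles the number of points. -/
def findRadius : Cmd :=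
  .block [.letReal rR (.ofNat (.lit 0)),
    forAll vRnd (.block [
      assignCard vCnt (.and (mem vRem vI) (.realLe (.at rD vV vI) (.var rR))),
      assignCard vCnt' (.and (mem vRem vI)
        (.realLe (.at rD vV vI) (.add (.var rR) (.var rH)))),
      .ite (.natLt (.add (.var vCnt) (.var vCnt)) (.var vCnt'))
        (.letReal rR (.add (.var rR) (.var rH))) .skip])]

/-- Compare the cuts near the balls of radius `rQuart`, and then those near the union of the
components carved so far. -/
def round : Cmd :=
  .block [
    .letReal rQuart (.div (.div (.var rAlpha) (.mul (.ofNat (.var vM)) (.ofNat (.var vM))))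
      (.ofNat (.lit 4))),
    .letReal rH (.div (.div (.var rAlpha) (.mul (.ofNat (.var vM)) (.ofNat (.var vM))))
      (.mul (.ofNat (.lit 8)) (.log (.var vM)))),
    forAll vV (.ite (mem vGround vV)
      (.block [
        assignSet vA (.and (mem vGround vI) (.realLe (.at rD vV vI) (.var rQuart))),
        sweep])
      .skip),
    assignSet vRem (mem vGround vI),
    assignSet vA (.natLt (.lit 1) (.lit 0)),
    forAll vV (.ite (mem vRem vV)
      (.block [
        findRadius,
        assignSet vA (.or (mem vA vI) (.and (mem vRem vI) (.realLe (.at rD vV vI) (.var rR)))),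
        assignSet vRem (.and (mem vRem vI)
          (.not (.realLe (.at rD vV vI) (.add (.var rR) (.var rH))))),
        sweep])
      .skip)]

/-- Each enlargement more than doubles the ball, so `j` of them force `2 ^ j` points. If all `n`
rounds enlarged the radius, there would be `2 ^ n > n` points; hence the doubling has stopped when
the loop ends. -/
theorem findRadius_spec (hn : σ.nat vN 0 0 = n) {d : ℕ → ℕ → ℝ} (hd : σ.real rD = d)
    {W : Finset ℕ} (hW : toSet n (σ.nat vRem) = W) {v : ℕ} (hv : σ.nat vV 0 0 = v) (hvW : v ∈ W)
    (hvv : d v v = 0) {h : ℝ} (hh : σ.real rH 0 0 = h) :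
    Spec n K findRadius σ fun τ => ∃ j : ℕ, τ.real rR 0 0 = j * h ∧
      2 ^ j ≤ W.card ∧
      (W.filter fun x => d v x ≤ j * h + h).card ≤
        2 * (W.filter fun x => d v x ≤ j * h).card := by
  have hWr : W ⊆ Finset.range n := by rw [← hW]; exact Finset.filter_subset _ _
  have hcard : ∀ r : ℝ, ((Finset.range n).filter fun x => x ∈ W ∧ d v x ≤ r).card =
      (W.filter fun x => d v x ≤ r).card := by
    intro r
    rw [← Finset.filter_filter, filter_mem_range hWr]
  refine Spec.letReal_cons fun τ₀ a₀ h₀ => Spec.block_cons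
    (Q' := fun τ => ∃ j : ℕ, τ.real rR 0 0 = j * h ∧ 2 ^ j ≤ W.card ∧
      (W.filter fun x => d v x ≤ j * h + h).card ≤ 2 * (W.filter fun x => d v x ≤ j * h).card)
    ?_ fun _ _ h => .block_nil h
  refine (Spec.forAll (fun k τ => ∃ j : ℕ, τ.real rR 0 0 = j * h ∧
    2 ^ j ≤ (W.filter fun x => d v x ≤ j * h).card ∧ (j = k ∨
      (W.filter fun x => d v x ≤ j * h + h).card ≤ 2 * (W.filter fun x => d v x ≤ j * h).card))
    (by rw [a₀.nat _ (by decide), hn]) (by decide) ?_ ?_ ?_).mono ?_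
  · rintro k τ τ' a ⟨j, h1, h2⟩
    exact ⟨j, by rw [a.real rR (by decide), h1], h2⟩
  · refine ⟨0, by simp [h₀], ?_, Or.inl rfl⟩
    rw [pow_zero, Nat.one_le_iff_ne_zero, ← Nat.pos_iff_ne_zero, Finset.card_pos]
    exact ⟨v, by simp [hvW, hvv]⟩
  · rintro k hk τ a hτn - ⟨j, h1, h2, h3⟩
    have b := a₀.trans a
    have hdτ : τ.real rD = d := by rw [b.real rD (by decide), hd]
    have hWτ : toSet n (τ.nat vRem) = W := by rw [b.nat vRem (by decide), hW]
    have hvτ : τ.nat vV 0 0 = v := by rw [b.nat vV (by decide), hv]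
    have hhτ : τ.real rH 0 0 = h := by rw [b.real rH (by decide), hh]
    refine Spec.block_cons (Spec.assignCard (fun i => i ∈ W ∧ d v i ≤ j * h) hτn (by decide) ?_)
      fun τ₁ a₁ e₁ => ?_
    · intro i hi ρ aρ hx
      simp only [Test.Holds, holds_mem hx hi, RExp.eval, NExp.eval, NExp.var, RExp.var,
        aρ.nat vRem (by decide), hWτ, aρ.real rD (by decide), hdτ, aρ.nat vV (by decide), hvτ, hx,
        aρ.real rR (by decide), h1]
    refine Spec.block_cons (Spec.assignCard (fun i => i ∈ W ∧ d v i ≤ j * h + h)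
      (by rw [a₁.nat vN (by decide), hτn]) (by decide) ?_) fun τ₂ a₂ e₂ => ?_
    · intro i hi ρ aρ' hx
      have aρ := a₁.trans aρ'
      simp only [Test.Holds, holds_mem hx hi, RExp.eval, NExp.eval, NExp.var, RExp.var,
        aρ.nat vRem (by decide), hWτ, aρ.real rD (by decide), hdτ, aρ.nat vV (by decide), hvτ, hx,
        aρ.real rR (by decide), h1, aρ.real rH (by decide), hhτ]
    rw [hcard] at e₁ e₂
    have a₁₂ := a₁.trans a₂
    refine Spec.block_cons (Spec.ite (fun ht => .setReal ?_) (fun ht => .skip ?_))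
      fun _ _ h => .block_nil h
    all_goals
      simp only [Test.Holds, NExp.eval, NExp.var, a₂.nat vCnt (by decide), e₁, e₂] at ht
    · refine ⟨j + 1, ?_, ?_, ?_⟩
      · simp [a₁₂.real rR (by decide), a₁₂.real rH (by decide), h1, hhτ]
        ring
      · push_cast
        rw [add_mul, one_mul, pow_succ]
        omega
      · rcases h3 with h3 | h3
        · exact Or.inl (by rw [h3])
        · omega
    · exact ⟨j, by rw [a₁₂.real rR (by decide), h1], h2, Or.inr (by omega)⟩
  · rintro τ - ⟨j, h1, h2, h3⟩
    have h4 : 2 ^ j ≤ W.card := h2.trans (Finset.card_filter_le _ _)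
    refine ⟨j, h1, h4, ?_⟩
    rcases h3 with rfl | h3
    · have h5 := Finset.card_le_card hWr
      rw [Finset.card_range] at h5
      have := j.lt_two_pow_self
      omega
    · exact h3

/-- Each carving step adds a ball of the remaining set `W` to `A` and removes from `W` a ball of
radius larger by `h`, with at most twice as many points. So `A` stays at distance more than `h` from
`W`, and in the end `A` has at least half of all points. If no ball of radius `quart` has a quarter
of the points, `A` grows slowly: when it first reaches `m / 8` points it has fewer than `3 m / 8`.
That set is `A'`, and what is carved later is `B`. Because `A` is swept after every step, the
program need not know which step yields `A'`. -/
theorem round_spec (hc : Ctx n V T P σ) (hb : BestInv n V T P σ) (hTV : T ⊆ V)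
    {d : ℕ → ℕ → ℝ} (hdσ : σ.real rD = d) (hd : Semimetric V d)
    (hdT : ∀ s ∈ T, ∀ t ∈ T, d s t = 0) (hM : σ.nat vM 0 0 = V.card) {α : ℝ}
    (hα : α = ∑ x ∈ V, ∑ y ∈ V, d x y) (hασ : σ.real rAlpha 0 0 = α) :
    Spec n K round σ fun τ => BestInv n V T P τ ∧ score τ ≤ score σ ∧
      (∀ v ∈ V, Tested V P d (score τ) (V.filter fun x => d v x ≤ α / V.card ^ 2 / 4)) ∧
      (2 ≤ V.card → (∀ v ∈ V, 4 * (V.filter fun x => d v x ≤ α / V.card ^ 2 / 4).card < V.card) →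
        ∃ A B, A ⊆ V ∧ B ⊆ V ∧ Tested V P d (score τ) A ∧ V.card ≤ 8 * A.card ∧
          V.card ≤ 8 * B.card ∧
          ∀ a ∈ A, ∀ b ∈ B, α / V.card ^ 2 / (8 * Real.log V.card) < d a b) := by
  have hα0 : 0 ≤ α := by
    rw [hα]; exact Finset.sum_nonneg fun x hx => Finset.sum_nonneg fun y hy => hd.nonneg x hx y hy
  have hlog0 : 0 ≤ Real.log V.card := Real.log_natCast_nonneg _
  refine Spec.letReal_cons fun τ₁ a₁ h₁ => Spec.letReal_cons fun τ₂ a₂ h₂ => ?_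
  have a₁₂ := a₁.trans a₂
  set quart := α / V.card ^ 2 / 4 with hquart
  set h := α / V.card ^ 2 / (8 * Real.log V.card) with hh
  have hh0 : 0 ≤ h := by positivity
  have hq₂ : τ₂.real rQuart 0 0 = quart := by
    rw [a₂.real rQuart (by decide), h₁]
    simp [hM, hασ, hquart, sq]
  have hh₂ : τ₂.real rH 0 0 = h := by
    rw [h₂]
    simp [a₁.nat vM (by decide), a₁.real rAlpha (by decide), hM, hασ, hh, sq]
  have hc₂ := hc.agree a₁₂ (by decide)
  have hb₂ := hb.agree a₁₂ (by decide)
  have hs₂ := score_agree a₁₂ (by decide)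
  have hd₂ : τ₂.real rD = d := by rw [a₁₂.real rD (by decide), hdσ]
  refine Spec.block_cons (Spec.forAll (fun k τ => BestInv n V T P τ ∧ score τ ≤ score σ ∧
    ∀ v ∈ V, v < k → Tested V P d (score τ) (V.filter fun x => d v x ≤ quart)) hc₂.size
    (by decide) ?_ ?_ ?_) fun τ₃ a₃ h₃ => ?_
  · rintro k τ τ' a ⟨i1, i2, i3⟩
    rw [score_agree a (by decide)]
    exact ⟨i1.agree a (by decide), i2, i3⟩
  · exact ⟨hb₂, hs₂.le, fun v _ hv => absurd hv (Nat.not_lt_zero v)⟩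
  · rintro v hv τ a hτn hτv ⟨i1, i2, i3⟩
    have hcτ := hc₂.agree a (by decide)
    have hdτ : τ.real rD = d := by rw [a.real rD (by decide), hd₂]
    refine Spec.ite (fun ht => ?_) (fun ht => .skip ?_)
    all_goals rw [holds_mem hτv hv, hcτ.ground] at ht
    · refine Spec.block_cons (Spec.assignSet (· ∈ V.filter fun x => d v x ≤ quart) hτn (by decide)
        ?_) fun τ₄ a₄ h₄ => ?_
      · intro i hi ρ aρ hx _
        have aρ' := a.trans aρ
        simp only [Test.Holds, holds_mem hx hi, RExp.eval, NExp.eval, NExp.var, RExp.var,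
          aρ.nat vGround (by decide), hcτ.ground, aρ.real rD (by decide), hdτ,
          aρ.nat vV (by decide), hτv, hx, aρ'.real rQuart (by decide), hq₂, Finset.mem_filter]
      have hA₄ : toSet n (τ₄.nat vA) = V.filter fun x => d v x ≤ quart := by
        rw [h₄]
        exact toSet_assign ((Finset.filter_subset _ _).trans hc.V_subset)
      refine Spec.block_cons (sweep_spec (hcτ.agree a₄ (by decide)) (i1.agree a₄ (by decide)) hTV
        (by rw [a₄.real rD (by decide), hdτ]) hd hdT hA₄ (Finset.filter_subset _ _))
        fun τ₅ a₅ h₅ => .block_nil ?_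
      obtain ⟨g1, g2, g3⟩ := h₅
      rw [score_agree a₄ (by decide)] at g2
      refine ⟨g1, g2.trans i2, fun v' hv' hlt => ?_⟩
      rcases Nat.lt_succ_iff_lt_or_eq.1 hlt with hlt | rfl
      · exact (i3 v' hv' hlt).mono g2
      · exact g3
    · refine ⟨i1, i2, fun v' hv' hlt => i3 v' hv' ?_⟩
      have : v' ≠ v := fun e => ht (e ▸ hv')
      omega
  obtain ⟨b1, b2, b3⟩ := h₃
  replace b3 : ∀ v ∈ V, Tested V P d (score τ₃) (V.filter fun x => d v x ≤ quart) :=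
    fun v hv => b3 v hv (Finset.mem_range.1 (hc.V_subset hv))
  have hc₃ := hc₂.agree a₃ (by decide)
  refine Spec.block_cons (Spec.assignSet (· ∈ V) hc₃.size (by decide) ?_) fun τ₄ a₄ h₄ => ?_
  · intro i hi ρ aρ hx _
    simp only [holds_mem hx hi, aρ.nat vGround (by decide), hc₃.ground]
  refine Spec.block_cons (Spec.assignSet (· ∈ (∅ : Finset ℕ)) (hc₃.agree a₄ (by decide)).size
    (by decide) ?_) fun τ₅ a₅ h₅ => ?_
  · intro i hi ρ aρ hx _
    simp [Test.Holds]
  have a₄₅ := a₄.trans a₅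
  have a₃₅ := a₃.trans a₄₅
  have hc₅ := hc₃.agree a₄₅ (by decide)
  have hRem₅ : toSet n (τ₅.nat vRem) = V := by
    rw [a₅.nat vRem (by decide), h₄]; exact toSet_assign hc.V_subset
  have hA₅ : toSet n (τ₅.nat vA) = ∅ := by
    rw [h₅]; exact toSet_assign (by simp)
  have hd₅ : τ₅.real rD = d := by rw [a₃₅.real rD (by decide), hd₂]
  have hh₅ : τ₅.real rH 0 0 = h := by rw [a₃₅.real rH (by decide), hh₂]
  have hs₅ := score_agree a₄₅ (by decide)
  let Small := ∀ v ∈ V, 4 * (V.filter fun x => d v x ≤ quart).card < V.card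
  -- The last clause distinguishes whether `A` is still below `m / 8` points or the critical set
  -- `A'` has already been met. In the latter case `A'` is far from everything carved afterwards and
  -- from everything that remains.
  let Inv : ℕ → Store → Prop := fun k τ => BestInv n V T P τ ∧ score τ ≤ score τ₃ ∧
    ∃ A W, toSet n (τ.nat vA) = A ∧ toSet n (τ.nat vRem) = W ∧ A ⊆ V ∧ W ⊆ V ∧
      (∀ w ∈ W, k ≤ w) ∧ (∀ a ∈ A, ∀ w ∈ W, h < d a w) ∧ V.card ≤ 2 * A.card + W.card ∧
      (2 ≤ V.card → Small → (8 * A.card < V.card ∨ ∃ A' ⊆ A, Tested V P d (score τ) A' ∧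
        V.card ≤ 8 * A'.card ∧ 8 * A'.card ≤ 3 * V.card ∧
        (∀ a ∈ A', ∀ b ∈ A \ A', h < d a b) ∧ ∀ a ∈ A', ∀ b ∈ W, h < d a b))
  refine Spec.block_cons (Spec.forAll Inv hc₅.size (by decide) ?_ ?_ ?_)
    fun τ₆ a₆ h₆ => .block_nil ?_
  · rintro k τ τ' a ⟨i1, i2, A, W, i3, i4, i5⟩
    have e := score_agree a (by decide)
    refine ⟨i1.agree a (by decide), by rwa [e], A, W, ?_, ?_, ?_⟩
    · rw [a.nat vA (by decide), i3]
    · rw [a.nat vRem (by decide), i4]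
    · rwa [e]
  · refine ⟨b1.agree a₄₅ (by decide), hs₅.le, ∅, V, hA₅, hRem₅, by simp, subset_rfl, by simp,
      by simp, by simp, fun h2 _ => Or.inl ?_⟩
    simp only [Finset.card_empty]
    omega
  · rintro v hv τ a hτn hτv ⟨i1, i2, A, W, i3, i4, hAV, hWV, hge, hsep, hcnt, hsm⟩
    have hcτ := hc₅.agree a (by decide)
    have hdτ : τ.real rD = d := by rw [a.real rD (by decide), hd₅]
    have hhτ : τ.real rH 0 0 = h := by rw [a.real rH (by decide), hh₅]
    refine Spec.ite (fun ht => ?_) (fun ht => .skip ?_)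
    all_goals rw [holds_mem hτv hv, i4] at ht
    · have hvV := hWV ht
      refine Spec.block_cons (findRadius_spec hτn hdτ i4 hτv ht (hd.self v hvV) hhτ)
        fun τ₁ a₁ h₁ => ?_
      obtain ⟨j, hr, hj, hlast⟩ := h₁
      set r := (j : ℝ) * h with hrdef
      set B := W.filter fun x => d v x ≤ r with hBdef
      set W' := W.filter fun x => ¬ d v x ≤ r + h with hW'def
      have hτn₁ : τ₁.nat vN 0 0 = n := by rw [a₁.nat vN (by decide), hτn]
      have hv₁ : τ₁.nat vV 0 0 = v := by rw [a₁.nat vV (by decide), hτv]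
      have hd₁ : τ₁.real rD = d := by rw [a₁.real rD (by decide), hdτ]
      have hh₁ : τ₁.real rH 0 0 = h := by rw [a₁.real rH (by decide), hhτ]
      have hA₁ : toSet n (τ₁.nat vA) = A := by rw [a₁.nat vA (by decide), i3]
      have hW₁ : toSet n (τ₁.nat vRem) = W := by rw [a₁.nat vRem (by decide), i4]
      refine Spec.block_cons (Spec.assignSet (· ∈ A ∪ B) hτn₁ (by decide) ?_) fun τ₂ a₂ h₂ => ?_
      · intro i hi ρ aρ hx hold
        have hmemA : (mem vA vI).Holds ρ ↔ i ∈ A := by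
          rw [holds_mem hx hi, mem_toSet, hold, ← hA₁, mem_toSet]
        simp only [Test.Holds, hmemA, holds_mem hx hi, RExp.eval, NExp.eval, NExp.var, RExp.var,
          aρ.nat vRem (by decide), hW₁, aρ.real rD (by decide), hd₁, aρ.nat vV (by decide), hv₁,
          hx, aρ.real rR (by decide), hr, Finset.mem_union, hBdef, Finset.mem_filter]
      have hBV : B ⊆ V := (Finset.filter_subset _ _).trans hWV
      have hABV : A ∪ B ⊆ V := Finset.union_subset hAV hBV
      have hA₂ : toSet n (τ₂.nat vA) = A ∪ B := by
        rw [h₂]; exact toSet_assign (hABV.trans hc.V_subset)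
      have hW'V : W' ⊆ V := (Finset.filter_subset _ _).trans hWV
      refine Spec.block_cons (Spec.assignSet (· ∈ W')
        (by rw [a₂.nat vN (by decide), hτn₁]) (by decide) ?_) fun τ₃' a₃' h₃' => ?_
      · intro i hi ρ aρ hx hold
        have aρ' := a₂.trans aρ
        have hmemW : (mem vRem vI).Holds ρ ↔ i ∈ W := by
          rw [holds_mem hx hi, mem_toSet, hold, a₂.nat vRem (by decide), ← hW₁, mem_toSet]
        simp only [Test.Holds, hmemW, RExp.eval, NExp.eval, NExp.var, RExp.var,
          aρ'.real rD (by decide), hd₁, aρ'.nat vV (by decide), hv₁,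
          hx, aρ'.real rR (by decide), hr, aρ'.real rH (by decide), hh₁, hW'def, Finset.mem_filter]
      have hW₃ : toSet n (τ₃'.nat vRem) = W' := by
        rw [h₃']; exact toSet_assign (hW'V.trans hc.V_subset)
      have hA₃ : toSet n (τ₃'.nat vA) = A ∪ B := by rw [a₃'.nat vA (by decide), hA₂]
      have a₁₃ := (a₁.trans a₂).trans a₃'
      refine Spec.block_cons (sweep_spec (hcτ.agree a₁₃ (by decide)) (i1.agree a₁₃ (by decide)) hTV
        (by rw [a₁₃.real rD (by decide), hdτ]) hd hdT hA₃ hABV) fun τ₄' a₄' h₄' => .block_nil ?_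
      obtain ⟨g1, g2, g3⟩ := h₄'
      rw [score_agree a₁₃ (by decide)] at g2
      have hsepB : ∀ x ∈ B, ∀ w ∈ W', h < d x w := by
        intro x hx w hw
        have hx' := Finset.mem_filter.1 hx
        have hw' := Finset.mem_filter.1 hw
        have := hd.triangle v hvV x (hWV hx'.1) w (hWV hw'.1)
        have h1 := hx'.2
        have h2 := not_le.1 hw'.2
        linarith
      have hsepAB : ∀ a ∈ A ∪ B, ∀ w ∈ W', h < d a w := by
        intro x hx w hw
        rcases Finset.mem_union.1 hx with hx | hx
        · exact hsep x hx w (Finset.filter_subset _ _ hw)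
        · exact hsepB x hx w hw
      have hAW : Disjoint A W := by
        rw [Finset.disjoint_left]
        intro x hxA hxW
        have := hsep x hxA x hxW
        rw [hd.self x (hAV hxA)] at this
        linarith
      have hABcard : (A ∪ B).card = A.card + B.card :=
        Finset.card_union_of_disjoint (hAW.mono_right (Finset.filter_subset _ _))
      have hWcard : (W.filter fun x => d v x ≤ r + h).card + W'.card = W.card :=
        Finset.card_filter_add_card_filter_not _
      refine ⟨g1, g2.trans i2, A ∪ B, W', ?_, ?_, hABV, hW'V, ?_, hsepAB, ?_, fun h2 hsmall => ?_⟩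
      · rw [a₄'.nat vA (by decide), hA₃]
      · rw [a₄'.nat vRem (by decide), hW₃]
      · intro w hw
        have hw' := Finset.mem_filter.1 hw
        have h1 := hge w hw'.1
        have : w ≠ v := by
          rintro rfl
          apply hw'.2
          rw [hd.self w hvV]
          positivity
        omega
      · rw [hABcard]
        omega
      · rcases hsm h2 hsmall with hsm | ⟨A', hA'A, t1, t2, t3, t4, t5⟩
        · by_cases h8 : 8 * (A ∪ B).card < V.card
          · exact Or.inl h8
          · refine Or.inr ⟨A ∪ B, subset_rfl, g3, by omega, ?_, by simp, hsepAB⟩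
            -- The radius is `j h` with `2 ^ j ≤ m`, so `j ≤ 2 log m`; the step `h` is chosen so
            -- that `2 log m · h` is exactly `quart`.
            have hrq : r ≤ quart := by
              have hm : (2 : ℝ) ≤ V.card := by exact_mod_cast h2
              have hlog2 : (1 / 2 : ℝ) ≤ Real.log 2 := by have := Real.log_two_gt_d9; linarith
              have hlogm : 0 < Real.log V.card := Real.log_pos (by linarith)
              have hjm : (2 : ℝ) ^ j ≤ V.card := by
                exact_mod_cast hj.trans (Finset.card_le_card hWV)
              have hjlog := Real.log_le_log (by positivity) hjm
              rw [Real.log_pow] at hjlog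
              have hj2 : (j : ℝ) ≤ 2 * Real.log V.card := by nlinarith [j.cast_nonneg (α := ℝ)]
              calc r ≤ 2 * Real.log V.card * h := mul_le_mul_of_nonneg_right hj2 hh0
                _ = quart := by rw [hh, hquart]; field_simp; ring
            have hBball : B.card ≤ (V.filter fun x => d v x ≤ quart).card := by
              refine Finset.card_le_card fun x hx => ?_
              have hx' := Finset.mem_filter.1 hx
              exact Finset.mem_filter.2 ⟨hWV hx'.1, hx'.2.trans hrq⟩
            have := hsmall v hvV
            omega
        · refine Or.inr ⟨A', hA'A.trans Finset.subset_union_left, t1.mono g2, t2, t3, ?_, ?_⟩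
          · intro x hx y hy
            obtain ⟨hy1, hy2⟩ := Finset.mem_sdiff.1 hy
            rcases Finset.mem_union.1 hy1 with hy1 | hy1
            · exact t4 x hx y (Finset.mem_sdiff.2 ⟨hy1, hy2⟩)
            · exact t5 x hx y (Finset.filter_subset _ _ hy1)
          · exact fun x hx y hy => t5 x hx y (Finset.filter_subset _ _ hy)
    · refine ⟨i1, i2, A, W, i3, i4, hAV, hWV, fun w hw => ?_, hsep, hcnt, hsm⟩
      have h1 := hge w hw
      have : w ≠ v := fun e => ht (e ▸ hw)
      omega
  · obtain ⟨i1, i2, A, W, i3, i4, hAV, hWV, hge, hsep, hcnt, hsm⟩ := h₆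
    refine ⟨i1, i2.trans b2, fun v hv => (b3 v hv).mono i2, fun h2 hsmall => ?_⟩
    -- Every centre has been treated, and a treated point is no longer in `W`. Thus `m ≤ 2 |A|`, and
    -- `m / 2 - 3 m / 8` leaves `m / 8` points for `A \ A'`.
    have hW0 : W = ∅ := by
      rw [Finset.eq_empty_iff_forall_notMem]
      intro w hw
      have h1 := hge w hw
      have h3 := Finset.mem_range.1 (hc.V_subset (hWV hw))
      omega
    rw [hW0, Finset.card_empty] at hcnt
    rcases hsm h2 hsmall with hsm | ⟨A', hA'A, t1, t2, t3, t4, -⟩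
    · omega
    · refine ⟨A', A \ A', hA'A.trans hAV, Finset.sdiff_subset.trans hAV, t1, t2, ?_, t4⟩
      rw [Finset.card_sdiff_of_subset hA'A]
      omega

end RealRAM

/-! ### One iteration of the multiplicative weights scheme. -/

namespace RealRAM

variable {n K : ℕ} {V T : Finset ℕ} {P : ℕ → ℕ → ℝ} {σ τ : Store}

abbrev vL₁ : ℕ := 45
abbrev vL₂ : ℕ := 46
abbrev vL₃ : ℕ := 47
abbrev vL₄ : ℕ := 48

/-- The load of the pair `vI`, `vJ` relative to its capacity. -/
def RExp.congestion : RExp := .mul (.add (.at rG vI vJ) (.at rG vJ vI)) (.at rQ vI vJ)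

def maxCongestion : Cmd :=
  .block [.letReal rY (.ofNat (.lit 0)),
    forAll vI (forAll vJ (.ite (.and (.and (mem vGround vI) (mem vGround vJ))
      (.not (.realLe .congestion (.var rY)))) (.letReal rY .congestion) .skip))]

/-- One iteration of the algorithm of Garg and Könemann: shortest distances with respect to the
current lengths, a flow along shortest paths, rounding, and an update of the lengths. -/
def iteration : Cmd :=
  .block [
    forAll vI (forAll vJ (.setReal rD (.var vI) (.var vJ)
      (.mul (.at rLen vI vJ) (.at rQ vI vJ)))),
    floydWarshall,
    sumArray rD rAlpha (mem vGround vI) (mem vGround vJ),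
    forAll vI (forAll vJ (.setReal rG (.var vI) (.var vJ) (.ofNat (.lit 1)))),
    unwind,
    round,
    maxCongestion,
    forAll vI (forAll vJ (.setReal rLen (.var vI) (.var vJ)
      (.mul (.at rLen vI vJ) (.add (.ofNat (.lit 1)) (.div .congestion (.var rY))))))]

/-- The pairs of points of `V` that are not both in `T`. -/
def pairs (V T : Finset ℕ) : Finset (ℕ × ℕ) :=
  (V ×ˢ V).filter fun p => p.1 ≠ p.2 ∧ ¬ (p.1 ∈ T ∧ p.2 ∈ T)

theorem mem_pairs {x y : ℕ} :
    (x, y) ∈ pairs V T ↔ (x ∈ V ∧ y ∈ V) ∧ x ≠ y ∧ ¬ (x ∈ T ∧ y ∈ T) := by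
  simp [pairs]

theorem pairs_symm {x y : ℕ} (h : (x, y) ∈ pairs V T) : (y, x) ∈ pairs V T := by
  rw [mem_pairs] at h ⊢
  exact ⟨⟨h.1.2, h.1.1⟩, h.2.1.symm, fun h' => h.2.2 ⟨h'.2, h'.1⟩⟩

theorem sum_pairs {f : ℕ → ℕ → ℝ} (hf : ∀ x ∈ V, ∀ y ∈ V, (x, y) ∉ pairs V T → f x y = 0) :
    ∑ x ∈ V, ∑ y ∈ V, f x y = ∑ p ∈ pairs V T, f p.1 p.2 := by
  rw [← Finset.sum_product' V V f]
  symm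
  refine Finset.sum_subset (Finset.filter_subset _ _) fun p hp hp' => ?_
  rw [Finset.mem_product] at hp
  exact hf _ hp.1 _ hp.2 hp'

theorem cutDist_eq_zero {R : Finset ℕ} (hTR : T ⊆ R) {x y : ℕ} (hx : x ∈ V) (hy : y ∈ V)
    (h : (x, y) ∉ pairs V T) : cutDist R x y = 0 := by
  rw [mem_pairs] at h
  by_cases hxy : x = y
  · rw [hxy, cutDist_self]
  · have : x ∈ T ∧ y ∈ T := by
      by_contra h'
      exact h ⟨⟨hx, hy⟩, hxy, h'⟩
    simp [cutDist, hTR this.1, hTR this.2]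

/-- The state between two iterations; `t` is the number of iterations. -/
structure IterInv (n : ℕ) (V T : Finset ℕ) (P : ℕ → ℕ → ℝ) (η : ℝ) (t : ℕ) (τ : Store) :
    Prop where
  ctx : Ctx n V T P τ
  card : τ.nat vM 0 0 = V.card
  inv : ∀ x ∈ V, ∀ y ∈ V, τ.real rQ x y =
    if (x, y) ∈ pairs V T then 1 / (P x y + P y x + η) else 0
  best : BestInv n V T P τ
  one_le : ∀ x ∈ V, ∀ y ∈ V, 1 ≤ τ.real rLen x y
  symm : ∀ x ∈ V, ∀ y ∈ V, τ.real rLen x y = τ.real rLen y x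
  -- The admissible cut `R` serves to guarantee a pair of positive congestion; without one, the
  -- lengths may stay constant.
  growth : ∀ R : Finset ℕ, T ⊆ R → R ⊂ V → R.Nonempty →
    t * Real.log 2 ≤ ∑ e ∈ pairs V T, Real.log (τ.real rLen e.1 e.2)
  -- The bound is required for all `ρ` up to the current score. As the score only decreases, the
  -- range of `ρ` shrinks, and the instances needed later were already available earlier.
  potential : ∀ R : Finset ℕ, T ⊆ R → R ⊂ V → R.Nonempty → ∀ ρ : ℝ, 0 ≤ ρ → ρ ≤ score τ →
    (2 * ρ + η) / (256 * Real.log V.card) * (∑ x ∈ V, ∑ y ∈ V, cutDist R x y) * Real.log 2 *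
      (Real.log (∑ e ∈ pairs V T, τ.real rLen e.1 e.2) - Real.log (pairs V T).card) ≤
    ∑ e ∈ pairs V T, cutDist R e.1 e.2 * (P e.1 e.2 + P e.2 e.1 + η) *
      Real.log (τ.real rLen e.1 e.2)

theorem IterInv.agree {η : ℝ} {t : ℕ} (h : IterInv n V T P η t σ) {N R : List ℕ}
    (ha : Agree N R σ τ)
    (hW : (vN ∉ N ∧ vGround ∉ N ∧ vTerm ∉ N ∧ rP ∉ R) ∧ (vHave ∉ N ∧ vCut ∉ N ∧ rBest ∉ R) ∧
      vM ∉ N ∧ rQ ∉ R ∧ rLen ∉ R) : IterInv n V T P η t τ := by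
  obtain ⟨h1, h2, h3, h4, h5⟩ := hW
  have e := score_agree ha ⟨h2.1, h2.2.2⟩
  refine ⟨h.ctx.agree ha h1, ?_, ?_, h.best.agree ha h2, ?_, ?_, ?_, ?_⟩
  · rw [ha.nat _ h3]; exact h.card
  · rw [ha.real _ h4]; exact h.inv
  · rw [ha.real _ h5]; exact h.one_le
  · rw [ha.real _ h5]; exact h.symm
  · rw [ha.real _ h5]; exact h.growth
  · rw [ha.real _ h5, e]; exact h.potential

theorem maxCongestion_spec (hc : Ctx n V T P σ) {w : ℕ → ℕ → ℝ}
    (hw : ∀ x ∈ V, ∀ y ∈ V, (σ.real rG x y + σ.real rG y x) * σ.real rQ x y = w x y) :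
    Spec n K maxCongestion σ fun τ => 0 ≤ τ.real rY 0 0 ∧
      (∀ x ∈ V, ∀ y ∈ V, w x y ≤ τ.real rY 0 0) ∧
      (0 < τ.real rY 0 0 → ∃ x ∈ V, ∃ y ∈ V, w x y = τ.real rY 0 0) := by
  refine Spec.letReal_cons fun τ₀ a₀ h₀ => ?_
  have hc₀ := hc.agree a₀ (by decide)
  refine Spec.block_cons ((Spec.forAll₂ (fun i j τ => 0 ≤ τ.real rY 0 0 ∧
    (∀ x ∈ V, ∀ y ∈ V, x < i ∨ x = i ∧ y < j → w x y ≤ τ.real rY 0 0) ∧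
      (0 < τ.real rY 0 0 → ∃ x ∈ V, ∃ y ∈ V, w x y = τ.real rY 0 0)) hc₀.size (by decide)
      ?_ ?_ ?_ ?_).mono ?_) fun _ _ h => .block_nil h
  · rintro i j τ τ' a ⟨i1, i2, i3⟩
    rw [a.real rY (by decide)]
    exact ⟨i1, i2, i3⟩
  · have : τ₀.real rY 0 0 = 0 := by rw [h₀]; simp
    rw [this]
    exact ⟨le_rfl, fun x _ y _ h => by omega, fun h => absurd h (lt_irrefl 0)⟩
  · rintro i τ ⟨i1, i2, i3⟩
    refine ⟨i1, fun x hx y hy h => i2 x hx y hy ?_, i3⟩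
    have := Finset.mem_range.1 (hc.V_subset hy)
    omega
  · rintro i hi j hj τ a hτn hτi hτj ⟨i1, i2, i3⟩
    have hcτ := hc₀.agree a (by decide)
    have hev : i ∈ V → j ∈ V → RExp.congestion.eval τ = w i j := by
      intro hiV hjV
      rw [← hw i hiV j hjV]
      simp [RExp.congestion, hτi, hτj, (a₀.trans a).real rG (by decide),
        (a₀.trans a).real rQ (by decide)]
    refine Spec.ite (fun ht => .setReal ?_) (fun ht => .skip ?_)
    all_goals simp only [Test.Holds, holds_mem hτi hi, holds_mem hτj hj, hcτ.ground] at ht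
    · obtain ⟨⟨hiV, hjV⟩, hlt⟩ := ht
      rw [hev hiV hjV] at hlt
      simp only [RExp.eval, RExp.var, NExp.eval, not_le] at hlt
      simp only [hev hiV hjV, NExp.eval, Store.setReal_real_same, upd_same]
      refine ⟨i1.trans hlt.le, fun x hx y hy h => ?_, fun _ => ⟨i, hiV, j, hjV, rfl⟩⟩
      by_cases h' : x = i ∧ y = j
      · rw [h'.1, h'.2]
      · exact (i2 x hx y hy (by omega)).trans hlt.le
    · refine ⟨i1, fun x hx y hy h => ?_, i3⟩
      by_cases h' : x = i ∧ y = j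
      · obtain ⟨rfl, rfl⟩ := h'
        rw [hev hx hy] at ht
        simp only [RExp.eval, RExp.var, NExp.eval, not_and, not_not] at ht
        exact ht ⟨hx, hy⟩
      · exact i2 x hx y hy (by omega)
  · rintro τ - ⟨i1, i2, i3⟩
    exact ⟨i1, fun x hx y hy => i2 x hx y hy
      (Or.inl (Finset.mem_range.1 (hc.V_subset hx))), i3⟩

/-- The hypotheses of `potential_step` come from two sides: the rounding theorem for `d` bounds the
cost of the flow by the total length, and the cut condition of the flow bounds from below what
crosses `R`. -/
theorem iteration_spec {η : ℝ} (hη : 0 < η) (hP : ∀ x y, 0 ≤ P x y) (hTV : T ⊆ V) {t : ℕ}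
    (hI : IterInv n V T P η t σ) :
    Spec n K iteration σ (IterInv n V T P η (t + 1)) := by
  have hc := hI.ctx
  have hlt : ∀ x ∈ V, x < n := fun x hx => Finset.mem_range.1 (hc.V_subset hx)
  set u := σ.real rLen with hu
  set q := σ.real rQ with hq
  let c : ℕ → ℕ → ℝ := fun x y => P x y + P y x + η
  have hcpos : ∀ x y, 0 < c x y := fun x y => by
    have := hP x y; have := hP y x; simp only [c]; linarith
  have hcsymm : ∀ x y, c x y = c y x := fun x y => by simp only [c]; ring
  have hinv : ∀ x ∈ V, ∀ y ∈ V, q x y = if (x, y) ∈ pairs V T then 1 / c x y else 0 := hI.inv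
  have husymm : ∀ x ∈ V, ∀ y ∈ V, u x y = u y x := hI.symm
  have hq0 : ∀ x ∈ V, ∀ y ∈ V, 0 ≤ q x y := by
    intro x hx y hy
    rw [hinv x hx y hy]
    split_ifs
    · exact (one_div_pos.2 (hcpos x y)).le
    · exact le_rfl
  have hqE : ∀ x y, (x, y) ∈ pairs V T → q x y = 1 / c x y := by
    intro x y h
    have h' := (mem_pairs.1 h).1
    rw [hinv x h'.1 y h'.2, if_pos h]
  have hqN : ∀ x ∈ V, ∀ y ∈ V, (x, y) ∉ pairs V T → q x y = 0 := by
    intro x hx y hy h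
    rw [hinv x hx y hy, if_neg h]
  have hqsymm : ∀ x ∈ V, ∀ y ∈ V, q x y = q y x := by
    intro x hx y hy
    by_cases h : (x, y) ∈ pairs V T
    · rw [hqE _ _ h, hqE _ _ (pairs_symm h), hcsymm]
    · rw [hqN x hx y hy h, hqN y hy x hx fun h' => h (pairs_symm h')]
  -- the lengths
  refine Spec.block_cons (Spec.map₂ (a := rD) (fun i j => u i j * q i j) hc.size (by decide) (by decide) ?_)
    fun τ₁ a₁ h₁ => ?_
  · intro i hi j hj τ a hτi hτj _
    refine .setReal ?_
    simp [hτi, hτj, a.real rLen (by decide), a.real rQ (by decide), hu, hq]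
  set d₀ := τ₁.real rD with hd₀
  replace h₁ : ∀ x ∈ V, ∀ y ∈ V, d₀ x y = u x y * q x y :=
    fun x hx y hy => h₁ x (hlt x hx) y (hlt y hy)
  have hu0 : ∀ x ∈ V, ∀ y ∈ V, 0 ≤ u x y := fun x hx y hy =>
    zero_le_one.trans (hI.one_le x hx y hy)
  have hd₀nn : ∀ x ∈ V, ∀ y ∈ V, 0 ≤ d₀ x y := fun x hx y hy => by
    rw [h₁ x hx y hy]; exact mul_nonneg (hu0 x hx y hy) (hq0 x hx y hy)
  have hd₀N : ∀ x ∈ V, ∀ y ∈ V, (x, y) ∉ pairs V T → d₀ x y = 0 := fun x hx y hy h => by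
    rw [h₁ x hx y hy, hqN x hx y hy h, mul_zero]
  have hd₀symm : ∀ x ∈ V, ∀ y ∈ V, d₀ x y = d₀ y x := fun x hx y hy => by
    rw [h₁ x hx y hy, h₁ y hy x hx, husymm x hx y hy, hqsymm x hx y hy]
  have hc₁ := hc.agree a₁ (by decide)
  refine Spec.block_cons (floydWarshall_spec hc₁ rfl ⟨hd₀nn,
    fun x hx => hd₀N x hx x hx (by simp [mem_pairs]), hd₀symm, fun _ _ _ _ => le_rfl,
    fun k _ hk => absurd hk (Nat.not_lt_zero k)⟩) fun τ₂ a₂ h₂ => ?_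
  obtain ⟨hfw, hhist, htop⟩ := h₂
  set d := τ₂.real rD with hd
  have hsm : Semimetric V d := ⟨hfw.nonneg, hfw.self, hfw.symm,
    fun x hx y hy z hz => hfw.triangle y hy (hlt y hy) x hx z hz⟩
  have hdN : ∀ x ∈ V, ∀ y ∈ V, (x, y) ∉ pairs V T → d x y = 0 := fun x hx y hy h =>
    le_antisymm ((hfw.le x hx y hy).trans_eq (hd₀N x hx y hy h)) (hfw.nonneg x hx y hy)
  have hdT : ∀ s ∈ T, ∀ t ∈ T, d s t = 0 := fun s hs t ht =>
    hdN s (hTV hs) t (hTV ht) fun h => (mem_pairs.1 h).2.2 ⟨hs, ht⟩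
  have hc₂ := hc₁.agree a₂ (by decide)
  refine Spec.block_cons (Spec.sumArray (· ∈ V) (· ∈ V) hc₂.size (by decide) ?_ ?_)
    fun τ₃ a₃ h₃ => ?_
  · intro i hi τ a hx
    rw [holds_mem hx hi, a.nat vGround (by decide), hc₂.ground]
  · intro i hi τ a hx
    rw [holds_mem hx hi, a.nat vGround (by decide), hc₂.ground]
  rw [filter_mem_range hc.V_subset] at h₃
  set α := ∑ x ∈ V, ∑ y ∈ V, d x y with hα
  have hc₃ := hc₂.agree a₃ (by decide)
  refine Spec.block_cons (Spec.map₂ (a := rG) (fun _ _ => 1) hc₃.size (by decide) (by decide) ?_)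
    fun τ₄ a₄ h₄ => ?_
  · intro i hi j hj τ a hτi hτj _
    refine .setReal ?_
    simp [hτi, hτj]
  replace h₄ : ∀ x ∈ V, ∀ y ∈ V, τ₄.real rG x y = 1 :=
    fun x hx y hy => h₄ x (hlt x hx) y (hlt y hy)
  have a₃₄ := a₃.trans a₄
  have hd₄ : τ₄.real rD = d := a₃₄.real rD (by decide)
  have hflow : IsFlow V d α (τ₄.real rG) := by
    refine ⟨fun x hx y hy => by rw [h₄ x hx y hy]; norm_num, ?_, fun R => le_of_eq ?_⟩
    · exact Finset.sum_congr rfl fun x hx => Finset.sum_congr rfl fun y hy => by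
        rw [h₄ x hx y hy, one_mul]
    · exact Finset.sum_congr rfl fun x hx => Finset.sum_congr rfl fun y hy => by
        rw [h₄ x hx y hy, one_mul]
  have hc₄ := hc₃.agree a₄ (by decide)
  refine Spec.block_cons (unwind_spec hc₄.size (hhist.agree a₃₄ (by decide))
    (by rw [a₃₄.nat vTop (by decide)]; exact htop) (by rw [hd₄]; exact hflow))
    fun τ₅ a₅ hg => ?_
  set g := τ₅.real rG with hgdef
  have hc₅ := hc₄.agree a₅ (by decide)
  have a₁₅ := (((a₁.trans a₂).trans a₃).trans a₄).trans a₅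
  refine Spec.block_cons (round_spec hc₅ (hI.best.agree a₁₅ (by decide)) hTV
    (by rw [a₅.real rD (by decide), hd₄]) hsm hdT (by rw [a₁₅.nat vM (by decide), hI.card]) hα
    (by rw [(a₄.trans a₅).real rAlpha (by decide), h₃])) fun τ₆ a₆ h₆ => ?_
  obtain ⟨hbest, hscore, hball, hcarve⟩ := h₆
  rw [score_agree a₁₅ (by decide)] at hscore
  have hc₆ := hc₅.agree a₆ (by decide)
  have hg₆ : τ₆.real rG = g := a₆.real rG (by decide)
  have hq₆ : τ₆.real rQ = q := (a₁₅.trans a₆).real rQ (by decide)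
  have hu₆ : τ₆.real rLen = u := (a₁₅.trans a₆).real rLen (by decide)
  let w : ℕ → ℕ → ℝ := fun x y => g x y + g y x
  refine Spec.block_cons (maxCongestion_spec (w := fun x y => w x y * q x y) hc₆
    fun x _ y _ => by rw [hg₆, hq₆]) fun τ₇ a₇ h₇ => ?_
  obtain ⟨hy0, hymax, hyatt⟩ := h₇
  set y₀ := τ₇.real rY 0 0 with hy₀
  have hc₇ := hc₆.agree a₇ (by decide)
  refine Spec.block_cons (Spec.map₂ (a := rLen) (fun i j => u i j * (1 + w i j * q i j / y₀)) hc₇.size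
    (by decide) (by decide) ?_) fun τ₈ a₈ h₈ => .block_nil ?_
  · intro i hi j hj τ a hτi hτj hold
    refine .setReal ?_
    rw [a₇.real rLen (by decide), hu₆] at hold
    simp only [RExp.congestion, RExp.eval, NExp.eval, NExp.var, RExp.var, hτi, hτj,
      Store.setReal_real_same, hold, (a₇.trans a).real rG (by decide), hg₆,
      (a₇.trans a).real rQ (by decide), hq₆, a.real rY (by decide), Nat.cast_one, w, y₀]
  have a₁₈ := ((a₁₅.trans a₆).trans a₇).trans a₈
  have a₇₈ := a₇.trans a₈
  have hs₈ : score τ₈ = score τ₆ := score_agree a₇₈ (by decide)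
  replace h₈ : ∀ x ∈ V, ∀ y ∈ V, τ₈.real rLen x y = u x y * (1 + w x y * q x y / y₀) :=
    fun x hx y hy => h₈ x (hlt x hx) y (hlt y hy)
  have hw0 : ∀ x ∈ V, ∀ y ∈ V, 0 ≤ w x y := fun x hx y hy =>
    add_nonneg (hg.nonneg x hx y hy) (hg.nonneg y hy x hx)
  have hmemV : ∀ e ∈ pairs V T, e.1 ∈ V ∧ e.2 ∈ V := fun e he => (mem_pairs.1 he).1
  have hE8 : ∀ e ∈ pairs V T, τ₈.real rLen e.1 e.2 =
      u e.1 e.2 * (1 + w e.1 e.2 * (1 / c e.1 e.2) / y₀) := fun e he => by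
    rw [h₈ _ (hmemV e he).1 _ (hmemV e he).2, hqE _ _ he]
  have huE : ∀ e ∈ pairs V T, 1 ≤ u e.1 e.2 := fun e he =>
    hI.one_le _ (hmemV e he).1 _ (hmemV e he).2
  have hwE : ∀ e ∈ pairs V T, 0 ≤ w e.1 e.2 := fun e he => hw0 _ (hmemV e he).1 _ (hmemV e he).2
  have hyE : ∀ e ∈ pairs V T, w e.1 e.2 * (1 / c e.1 e.2) ≤ y₀ := fun e he => by
    rw [← hqE _ _ he]; exact hymax _ (hmemV e he).1 _ (hmemV e he).2
  -- The factor 2 appears because `w` adds the flows of both orientations of a pair.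
  have hcross : ∀ R : Finset ℕ, T ⊆ R →
      2 * ∑ x ∈ V, ∑ y ∈ V, cutDist R x y ≤ ∑ e ∈ pairs V T, cutDist R e.1 e.2 * w e.1 e.2 := by
    intro R hTR
    rw [← sum_pairs (V := V) (T := T) (f := fun x y => cutDist R x y * w x y) fun x hx y hy h => by
      rw [cutDist_eq_zero hTR hx hy h, zero_mul]]
    have h1 : ∑ x ∈ V, ∑ y ∈ V, cutDist R x y * g y x =
        ∑ x ∈ V, ∑ y ∈ V, g x y * cutDist R x y := by
      rw [Finset.sum_comm]
      exact Finset.sum_congr rfl fun x _ => Finset.sum_congr rfl fun y _ => by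
        rw [cutDist_comm, mul_comm]
    have h2 : ∑ x ∈ V, ∑ y ∈ V, cutDist R x y * g x y =
        ∑ x ∈ V, ∑ y ∈ V, g x y * cutDist R x y := by simp only [mul_comm]
    simp only [w, mul_add, Finset.sum_add_distrib, h1, h2]
    linarith [hg.cut R]
  -- Congestion zero would mean that nothing flows across `R`, but `R` separates some demand.
  have hypos : ∀ R : Finset ℕ, T ⊆ R → R ⊂ V → R.Nonempty → 0 < y₀ := by
    intro R hTR hRV hR
    have h1 := hcross R hTR
    have h2 := sum_cutDist_pos hR hRV
    by_contra hcon
    have h3 : ∑ e ∈ pairs V T, cutDist R e.1 e.2 * w e.1 e.2 ≤ 0 := by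
      refine Finset.sum_nonpos fun e he => ?_
      have h4 := hyE e he
      have h5 := hcpos e.1 e.2
      have h6 : w e.1 e.2 ≤ 0 := by
        by_contra h7
        have := mul_pos (not_le.1 h7) (one_div_pos.2 h5)
        linarith
      exact mul_nonpos_of_nonneg_of_nonpos (cutDist_nonneg _ _ _) h6
    linarith
  refine ⟨hc₇.agree a₈ (by decide), ?_, ?_, hbest.agree a₇₈ (by decide), ?_, ?_, ?_, ?_⟩
  · rw [a₁₈.nat vM (by decide), hI.card]
  · rw [a₁₈.real rQ (by decide)]; exact hI.inv
  · intro x hx y hy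
    rw [h₈ x hx y hy]
    have h1 := hI.one_le x hx y hy
    -- This includes `y₀ = 0`, where the quotient is zero and the lengths remain as they are.
    have h2 : 0 ≤ w x y * q x y / y₀ :=
      div_nonneg (mul_nonneg (hw0 x hx y hy) (hq0 x hx y hy)) hy0
    nlinarith
  · intro x hx y hy
    rw [h₈ x hx y hy, h₈ y hy x hx, husymm x hx y hy, hqsymm x hx y hy]
    simp only [w, add_comm]
  · intro R hTR hRV hR
    have hy := hypos R hTR hRV hR
    obtain ⟨x, hx, y, hy', hxy⟩ := hyatt hy
    have hxyE : (x, y) ∈ pairs V T := by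
      by_contra h
      rw [hqN x hx y hy' h, mul_zero] at hxy
      linarith
    have h1 := sum_log_step (E := pairs V T) (u := fun e => u e.1 e.2) (w := fun e => w e.1 e.2)
      (c := fun e => c e.1 e.2) huE hwE (fun e _ => hcpos _ _) hy hxyE
      (by simp only; rw [← hqE _ _ hxyE, hxy])
    have h2 := hI.growth R hTR hRV hR
    rw [Finset.sum_congr rfl fun e he => by rw [hE8 e he]]
    push_cast
    linarith
  · intro R hTR hRV hR ρ hρ hρs
    rw [hs₈] at hρs
    have hm2 : 2 ≤ V.card := by
      have := Finset.card_lt_card hRV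
      have := hR.card_pos
      omega
    have hlogm : 0 < Real.log V.card := Real.log_pos (by exact_mod_cast (by omega : 1 < V.card))
    -- Shortest distances are at most the direct lengths `u / c`, so the volume of `d` is at most
    -- the total length.
    have hL : ∑ x ∈ V, ∑ y ∈ V, c x y * d x y ≤ ∑ e ∈ pairs V T, u e.1 e.2 := by
      rw [sum_pairs (T := T) (f := fun x y => c x y * d x y) fun x hx y hy h => by
        rw [hdN x hx y hy h, mul_zero]]
      refine Finset.sum_le_sum fun e he => ?_
      have h1 : d e.1 e.2 ≤ d₀ e.1 e.2 := hfw.le _ (hmemV e he).1 _ (hmemV e he).2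
      rw [h₁ _ (hmemV e he).1 _ (hmemV e he).2, hqE _ _ he] at h1
      have h2 := hcpos e.1 e.2
      calc c e.1 e.2 * d e.1 e.2 ≤ c e.1 e.2 * (u e.1 e.2 * (1 / c e.1 e.2)) := by gcongr
        _ = u e.1 e.2 := by field_simp
    have hround := rounding (ρ := 2 * ρ + η) hsm (fun x _ y _ => (hcpos x y).le) (by positivity)
      hm2 hα hL (fun v hv => (hball v hv).swept hρs η) fun hsmall => by
        obtain ⟨A, B, hA, hB, ht, h1, h2, h3⟩ := hcarve hm2 hsmall
        exact ⟨A, B, hA, hB, ht.swept hρs η, h1, h2, h3⟩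
    -- As `u / c = d₀` on these pairs, this is the cost of the flow with respect to `d₀`, once for
    -- each orientation.
    have hcost : ∑ e ∈ pairs V T, u e.1 e.2 * (w e.1 e.2 * (1 / c e.1 e.2)) = 2 * α := by
      have h1 : ∑ x ∈ V, ∑ y ∈ V, d₀ x y * w x y = 2 * α := by
        have h2 : ∑ x ∈ V, ∑ y ∈ V, d₀ x y * g y x = α := by
          rw [Finset.sum_comm, ← hg.cost]
          exact Finset.sum_congr rfl fun x hx => Finset.sum_congr rfl fun y hy => by
            rw [hd₀symm y hy x hx, mul_comm]
        have h3 : ∑ x ∈ V, ∑ y ∈ V, d₀ x y * g x y = α := by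
          rw [← hg.cost]
          exact Finset.sum_congr rfl fun x _ => Finset.sum_congr rfl fun y _ => mul_comm _ _
        simp only [w, mul_add, Finset.sum_add_distrib, h2, h3]
        ring
      rw [sum_pairs (T := T) (f := fun x y => d₀ x y * w x y) fun x hx y hy h => by
        rw [hd₀N x hx y hy h, zero_mul]] at h1
      rw [← h1]
      refine Finset.sum_congr rfl fun e he => ?_
      rw [h₁ _ (hmemV e he).1 _ (hmemV e he).2, hqE _ _ he]
      ring
    have hstep := potential_step (E := pairs V T) (u := fun e => u e.1 e.2)
      (w := fun e => w e.1 e.2) (c := fun e => c e.1 e.2) (δ := fun e => cutDist R e.1 e.2)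
      huE hwE (fun e _ => hcpos _ _) (fun e _ => cutDist_nonneg _ _ _) (hypos R hTR hRV hR) hyE
      (β := (2 * ρ + η) / (256 * Real.log V.card)) (N := ∑ x ∈ V, ∑ y ∈ V, cutDist R x y)
      (ℓ := Real.log (pairs V T).card) (by positivity) (sum_cutDist_pos hR hRV).le ?_
      (hcross R hTR) (hI.potential R hTR hRV hR ρ hρ (hρs.trans hscore))
    · rw [Finset.sum_congr rfl hE8]
      refine hstep.trans_eq (Finset.sum_congr rfl fun e he => ?_)
      rw [hE8 e he]
    · rw [hcost, div_mul_eq_mul_div, div_le_iff₀ (by positivity)]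
      nlinarith

end RealRAM

/-! ### The approximation guarantee and the complete FindComp program. -/

namespace RealRAM

variable {n K : ℕ} {V T : Finset ℕ} {P : ℕ → ℕ → ℝ} {σ τ : Store}

/-- A non-zero numerator contains an entry of size at least `p`, and the denominator counts at most
`n ^ 2` ordered pairs. -/
theorem ratio_eq_zero_or_le (hP : ∀ x y, 0 ≤ P x y) (hV : V.card ≤ n) {p : ℝ} (hp : 0 < p)
    (hmin : ∀ x ∈ V, ∀ y ∈ V, P x y ≤ 0 ∨ p ≤ P x y) {S : Finset ℕ} (hS : S.Nonempty)
    (hSV : S ⊂ V) : ratio V P S = 0 ∨ p / (n : ℝ) ^ 2 ≤ ratio V P S := by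
  have hterm : ∀ x y, 0 ≤ cutDist S x y * P x y := fun x y =>
    mul_nonneg (cutDist_nonneg S x y) (hP x y)
  by_cases h : ∃ x ∈ V, ∃ y ∈ V, 0 < cutDist S x y * P x y
  · right
    obtain ⟨x, hx, y, hy, hxy⟩ := h
    have hd : cutDist S x y = 1 := by
      unfold cutDist at hxy ⊢
      split_ifs at hxy ⊢
      · simp at hxy
      · rfl
    have h1 : p ≤ ∑ x ∈ V, ∑ y ∈ V, cutDist S x y * P x y := by
      rw [hd, one_mul] at hxy
      calc p ≤ P x y := (hmin x hx y hy).resolve_left hxy.not_ge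
        _ = cutDist S x y * P x y := by rw [hd, one_mul]
        _ ≤ ∑ y ∈ V, cutDist S x y * P x y :=
          Finset.single_le_sum (f := fun y => cutDist S x y * P x y) (fun y _ => hterm x y) hy
        _ ≤ _ := Finset.single_le_sum (f := fun x => ∑ y ∈ V, cutDist S x y * P x y)
          (fun x _ => Finset.sum_nonneg fun y _ => hterm x y) hx
    have h2 : ∑ x ∈ V, ∑ y ∈ V, cutDist S x y ≤ (n : ℝ) ^ 2 := by
      calc ∑ x ∈ V, ∑ y ∈ V, cutDist S x y ≤ ∑ x ∈ V, ∑ y ∈ V, 1 := by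
            gcongr
            exact cutDist_le_one _ _ _
        _ = (V.card : ℝ) ^ 2 := by simp [sq]
        _ ≤ (n : ℝ) ^ 2 := by gcongr
    exact div_le_div₀ (hp.le.trans h1) h1 (sum_cutDist_pos hS hSV) h2
  · left
    push Not at h
    rw [ratio, Finset.sum_eq_zero fun x hx => Finset.sum_eq_zero fun y hy =>
      le_antisymm (h x hx y hy) (hterm x y), zero_div]

theorem IterInv.ratio_le {p η : ℝ} (hI : IterInv n V T P η (n ^ 4) τ) (hp : 0 < p)
    (hη : η = p / (1024 * n * n * n)) (hP : ∀ x y, 0 ≤ P x y)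
    (hmin : ∀ x ∈ V, ∀ y ∈ V, P x y ≤ 0 ∨ p ≤ P x y) {R : Finset ℕ} (hTR : T ⊆ R) (hRV : R ⊂ V)
    (hR : R.Nonempty) : τ.nat vHave 0 0 ≠ 0 ∧
      ratio V P (toSet n (τ.nat vCut)) ≤ 1536 * Real.log V.card * ratio V P R := by
  have hmn : V.card ≤ n := by simpa using Finset.card_le_card hI.ctx.V_subset
  have hm2 : 2 ≤ V.card := by
    have := Finset.card_lt_card hRV
    have := hR.card_pos
    omega
  have hn0 : (0 : ℝ) < n := by exact_mod_cast (by omega : 0 < n)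
  have hη0 : 0 < η := by rw [hη]; positivity
  have hlog : 0 < Real.log V.card := Real.log_pos (by exact_mod_cast (by omega : 1 < V.card))
  have hN := sum_cutDist_pos hR hRV
  set N := ∑ x ∈ V, ∑ y ∈ V, cutDist R x y with hNdef
  have hgrow := hI.growth R hTR hRV hR
  have hE : (pairs V T).Nonempty := by
    rw [Finset.nonempty_iff_ne_empty]
    intro h
    rw [h, Finset.sum_empty] at hgrow
    have : 0 < ((n ^ 4 : ℕ) : ℝ) * Real.log 2 :=
      mul_pos (by exact_mod_cast Nat.pow_pos (by omega)) (Real.log_pos (by norm_num))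
    linarith
  have hEn : (pairs V T).card ≤ n ^ 2 := by
    calc (pairs V T).card ≤ (V ×ˢ V).card := Finset.card_filter_le _ _
      _ = V.card ^ 2 := by rw [Finset.card_product, sq]
      _ ≤ n ^ 2 := Nat.pow_le_pow_left hmn 2
  have hcap : ∀ x y, 0 ≤ P x y + P y x + η := fun x y => by
    have := hP x y
    have := hP y x
    linarith
  have key : ∀ ρ : ℝ, 0 ≤ ρ → ρ ≤ score τ →
      2 * ρ + η ≤ 1024 * Real.log V.card * (2 * ratio V P R + η) := by
    intro ρ hρ hρs
    have h := potential_final (E := pairs V T) (u := fun e => τ.real rLen e.1 e.2)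
      (δ := fun e => cutDist R e.1 e.2) (c := fun e => P e.1 e.2 + P e.2 e.1 + η)
      (fun e he => hI.one_le _ (mem_pairs.1 he).1.1 _ (mem_pairs.1 he).1.2)
      (fun e _ => mul_nonneg (cutDist_nonneg _ _ _) (hcap _ _)) (hm2.trans hmn) hE hEn
      (β := (2 * ρ + η) / (256 * Real.log V.card)) (by positivity) hN.le hgrow
      (hI.potential R hTR hRV hR ρ hρ hρs)
    rw [← sum_pairs (f := fun x y => cutDist R x y * (P x y + P y x + η)) fun x hx y hy h => by
      rw [cutDist_eq_zero hTR hx hy h, zero_mul], sum_cutDist_mul_cap] at h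
    have hr : ∑ x ∈ V, ∑ y ∈ V, cutDist R x y * P x y = ratio V P R * N := by
      rw [ratio, div_mul_cancel₀ _ hN.ne']
    rw [hr, ← hNdef] at h
    have h' : (2 * ρ + η) / (256 * Real.log V.card) ≤ 4 * (2 * ratio V P R + η) := by
      refine le_of_mul_le_mul_right ?_ hN
      linarith
    rw [div_le_iff₀ (by positivity)] at h'
    linarith
  have hr0 := ratio_nonneg (V := V) hP R
  -- If no cut had been found, the score would be `⊤` and `key` would hold for every `ρ`. Taking for
  -- `ρ` the right-hand side of `key` itself is absurd, since `η > 0`.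
  have hhave : τ.nat vHave 0 0 ≠ 0 := by
    intro h
    have h1 : 0 ≤ 1024 * Real.log V.card * (2 * ratio V P R + η) := by positivity
    have h2 := key _ h1 (by simp [score, h])
    linarith
  obtain ⟨h1, h2, h3⟩ := hI.best.some hhave
  refine ⟨hhave, ratio_of_perturbed hm2 hmn hp hη hr0 ?_ (ratio_eq_zero_or_le hP hmn hp hmin hR hRV)
    (key _ (ratio_nonneg hP _) (by rw [score, if_neg hhave, h3]))⟩
  exact (ratio_eq_zero_or_le hP hmn hp hmin h1 h2).imp_left le_of_eq

/-- `rEta ←` the least positive entry of the matrix on `vGround`, or `1` if this is smaller. -/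
def minEntry : Cmd :=
  .block [.letReal rEta (.ofNat (.lit 1)),
    forAll vI (forAll vJ (.ite (.and (.and (mem vGround vI) (mem vGround vJ))
      (.and (.not (.realLe (.at rP vI vJ) (.ofNat (.lit 0))))
        (.not (.realLe (.var rEta) (.at rP vI vJ)))))
      (.letReal rEta (.at rP vI vJ)) .skip))]

theorem minEntry_spec (hc : Ctx n V T P σ) :
    Spec n K minEntry σ fun τ => 0 < τ.real rEta 0 0 ∧
      ∀ x ∈ V, ∀ y ∈ V, P x y ≤ 0 ∨ τ.real rEta 0 0 ≤ P x y := by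
  refine Spec.letReal_cons fun τ₀ a₀ h₀ => ?_
  have hc₀ := hc.agree a₀ (by decide)
  refine Spec.block_cons ((Spec.forAll₂ (fun i j τ => 0 < τ.real rEta 0 0 ∧
    ∀ x ∈ V, ∀ y ∈ V, x < i ∨ x = i ∧ y < j → P x y ≤ 0 ∨ τ.real rEta 0 0 ≤ P x y)
      hc₀.size (by decide) ?_ ?_ ?_ ?_).mono ?_) fun _ _ h => .block_nil h
  · rintro i j τ τ' a h
    rwa [a.real rEta (by decide)]
  · have : τ₀.real rEta 0 0 = 1 := by rw [h₀]; simp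
    rw [this]
    exact ⟨one_pos, fun x _ y _ h => by omega⟩
  · rintro i τ ⟨i1, i2⟩
    refine ⟨i1, fun x hx y hy h => i2 x hx y hy ?_⟩
    have := Finset.mem_range.1 (hc.V_subset hy)
    omega
  · rintro i hi j hj τ a hτn hτi hτj ⟨i1, i2⟩
    have hcτ := hc₀.agree a (by decide)
    refine Spec.ite (fun ht => .setReal ?_) (fun ht => .skip ?_)
    all_goals simp only [Test.Holds, holds_mem hτi hi, holds_mem hτj hj, hcτ.ground, RExp.eval,
      NExp.eval, NExp.var, RExp.var, hτi, hτj, hcτ.mat, Nat.cast_zero, not_le] at ht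
    · obtain ⟨-, hpos, hlt⟩ := ht
      simp only [RExp.eval, NExp.eval, NExp.var, hτi, hτj, hcτ.mat, Store.setReal_real_same,
        upd_same]
      refine ⟨hpos, fun x hx y hy h => ?_⟩
      by_cases h' : x = i ∧ y = j
      · rw [h'.1, h'.2]
        exact Or.inr le_rfl
      · exact (i2 x hx y hy (by omega)).imp_right fun h => hlt.le.trans h
    · refine ⟨i1, fun x hx y hy h => ?_⟩
      by_cases h' : x = i ∧ y = j
      · obtain ⟨rfl, rfl⟩ := h'
        by_contra hcon
        push Not at hcon
        exact ht ⟨⟨hx, hy⟩, hcon⟩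
      · exact i2 x hx y hy (by omega)
  · rintro τ - ⟨i1, i2⟩
    exact ⟨i1, fun x hx y hy => i2 x hx y hy (Or.inl (Finset.mem_range.1 (hc.V_subset hx)))⟩

/-- The inverse capacities and the initial lengths. -/
def prepare : Cmd :=
  .block [assignCard vM (mem vGround vI),
    minEntry,
    .letReal rEta (.div (.var rEta) (.mul (.mul (.mul (.ofNat (.lit 1024)) (.ofNat (.var vN)))
      (.ofNat (.var vN))) (.ofNat (.var vN)))),
    forAll vI (forAll vJ (.ite
      (.and (.and (mem vGround vI) (mem vGround vJ))
        (.and (.not (.natEq (.var vI) (.var vJ))) (.not (.and (mem vTerm vI) (mem vTerm vJ)))))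
      (.setReal rQ (.var vI) (.var vJ) (.div (.ofNat (.lit 1))
        (.add (.add (.at rP vI vJ) (.at rP vJ vI)) (.var rEta))))
      (.setReal rQ (.var vI) (.var vJ) (.ofNat (.lit 0))))),
    forAll vI (forAll vJ (.setReal rLen (.var vI) (.var vJ) (.ofNat (.lit 1))))]

theorem prepare_spec (hc : Ctx n V T P σ) (hb : BestInv n V T P σ) :
    Spec n K prepare σ fun τ => ∃ p η : ℝ, 0 < p ∧ η = p / (1024 * n * n * n) ∧
      (∀ x ∈ V, ∀ y ∈ V, P x y ≤ 0 ∨ p ≤ P x y) ∧ IterInv n V T P η 0 τ := by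
  have hlt : ∀ x ∈ V, x < n := fun x hx => Finset.mem_range.1 (hc.V_subset hx)
  refine Spec.block_cons (Spec.assignCard (· ∈ V) hc.size (by decide) ?_) fun τ₁ a₁ h₁ => ?_
  · intro i hi τ a hx
    rw [holds_mem hx hi, a.nat vGround (by decide), hc.ground]
  rw [filter_mem_range hc.V_subset] at h₁
  have hc₁ := hc.agree a₁ (by decide)
  refine Spec.block_cons (minEntry_spec hc₁) fun τ₂ a₂ h₂ => ?_
  obtain ⟨hp, hmin⟩ := h₂
  set p := τ₂.real rEta 0 0
  have hc₂ := hc₁.agree a₂ (by decide)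
  refine Spec.letReal_cons fun τ₃ a₃ h₃ => ?_
  -- Small enough that `1024 log m · η` stays below the gap `p / n ^ 2` between zero and the
  -- positive ratios.
  set η := τ₃.real rEta 0 0 with hη
  replace h₃ : η = p / (1024 * n * n * n) := by
    rw [h₃]; simp [p, hc₂.size]
  have hc₃ := hc₂.agree a₃ (by decide)
  refine Spec.block_cons (Spec.map₂ (a := rQ) (fun x y => if (x, y) ∈ pairs V T then
    1 / (P x y + P y x + η) else 0) hc₃.size (by decide) (by decide) ?_) fun τ₄ a₄ h₄ => ?_
  · intro i hi j hj τ a hτi hτj _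
    have hcτ := hc₃.agree a (by decide)
    refine Spec.ite (fun ht => .setReal ?_) (fun ht => .setReal ?_)
    all_goals
      simp only [Test.Holds, holds_mem hτi hi, holds_mem hτj hj, hcτ.ground, hcτ.term, NExp.eval,
        NExp.var, hτi, hτj, ← mem_pairs] at ht
      simp [ht, hτi, hτj, hcτ.mat, a.real rEta (by decide), hη]
  have hc₄ := hc₃.agree a₄ (by decide)
  refine Spec.block_cons (Spec.map₂ (a := rLen) (fun _ _ => 1) hc₄.size (by decide) (by decide) ?_)
    fun τ₅ a₅ h₅ => .block_nil ?_
  · intro i hi j hj τ a hτi hτj _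
    refine .setReal ?_
    simp [hτi, hτj]
  have a₁₅ := (((a₁.trans a₂).trans a₃).trans a₄).trans a₅
  have h1 : ∀ x ∈ V, ∀ y ∈ V, τ₅.real rLen x y = 1 :=
    fun x hx y hy => h₅ x (hlt x hx) y (hlt y hy)
  have hE : ∀ e ∈ pairs V T, τ₅.real rLen e.1 e.2 = 1 := fun e he =>
    h1 _ (mem_pairs.1 he).1.1 _ (mem_pairs.1 he).1.2
  refine ⟨p, η, hp, h₃, hmin, hc₄.agree a₅ (by decide), ?_, ?_, hb.agree a₁₅ (by decide), ?_, ?_,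
    ?_, ?_⟩
  · rw [(((a₂.trans a₃).trans a₄).trans a₅).nat vM (by decide), h₁]
  · intro x hx y hy
    rw [a₅.real rQ (by decide), h₄ x (hlt x hx) y (hlt y hy)]
  · exact fun x hx y hy => (h1 x hx y hy).ge
  · exact fun x hx y hy => by rw [h1 x hx y hy, h1 y hy x hx]
  · intro R _ _ _
    rw [Finset.sum_congr rfl fun e he => by rw [hE e he]]
    simp
  · intro R _ _ _ ρ _ _
    have h0 : ∑ e ∈ pairs V T, cutDist R e.1 e.2 * (P e.1 e.2 + P e.2 e.1 + η) *
        Real.log (τ₅.real rLen e.1 e.2) = 0 :=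
      Finset.sum_eq_zero fun e he => by rw [hE e he, Real.log_one, mul_zero]
    rw [h0, Finset.sum_congr rfl hE]
    simp

/-- An approximation algorithm for the sparsest cut problem with component constraints. -/
def findSparseCut : Cmd :=
  .block [prepare,
    forAll vL₁ (forAll vL₂ (forAll vL₃ (forAll vL₄ iteration))),
    assignCard vCnt (.and (mem vTerm vI) (mem vCut vI)),
    .ite (.natLt (.lit 0) (.var vCnt))
      (assignSet vCut (.and (mem vGround vI) (.not (mem vCut vI)))) .skip]

/-- Four nested loops of `n` rounds supply the `n ^ 4` iterations that `potential_final` asks for.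
-/
theorem iterations_spec {η : ℝ} (hη : 0 < η) (hP : ∀ x y, 0 ≤ P x y) (hTV : T ⊆ V)
    (hI : IterInv n V T P η 0 σ) :
    Spec n K (forAll vL₁ (forAll vL₂ (forAll vL₃ (forAll vL₄ iteration)))) σ
      (IterInv n V T P η (n ^ 4)) := by
  have hsize : ∀ t τ, IterInv n V T P η t τ → τ.nat vN 0 0 = n := fun _ _ h => h.ctx.size
  have h := Spec.iterate (x := vL₁) (K := K) (IterInv n V T P η) hsize (by decide)
    (fun t τ τ' a h => h.agree a (by decide))
    (Spec.iterate (x := vL₂) (IterInv n V T P η) hsize (by decide)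
      (fun t τ τ' a h => h.agree a (by decide))
      (Spec.iterate (x := vL₃) (IterInv n V T P η) hsize (by decide)
        (fun t τ τ' a h => h.agree a (by decide))
        (Spec.iterate (x := vL₄) (IterInv n V T P η) hsize (by decide)
          (fun t τ τ' a h => h.agree a (by decide))
          (fun t τ h => iteration_spec hη hP hTV h)))) 0 σ hI
  rwa [show 0 + n * (n * (n * (n * 1))) = n ^ 4 by ring] at h

/-- The best cut contains all of `T` or none of it. In the former case the program returns the
complement in `V`, which has the same ratio. -/
theorem findSparseCut_spec (hc : Ctx n V T P σ) (hb : BestInv n V T P σ) (hTV : T ⊆ V)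
    (hP : ∀ x y, 0 ≤ P x y) :
    Spec n K findSparseCut σ fun τ => toSet n (τ.nat vCut) ⊆ V \ T ∧
      ∀ R : Finset ℕ, T ⊆ R → R ⊂ V → R.Nonempty →
        (toSet n (τ.nat vCut)).Nonempty ∧ toSet n (τ.nat vCut) ⊂ V ∧
        ratio V P (toSet n (τ.nat vCut)) ≤ 1536 * Real.log V.card * ratio V P R := by
  refine Spec.block_cons (prepare_spec hc hb) fun τ₁ a₁ h₁ => ?_
  obtain ⟨p, η, hp, hη, hmin, hI⟩ := h₁
  refine Spec.block_cons (Q' := IterInv n V T P η (n ^ 4)) ?_ fun τ₂ a₂ hI₂ => ?_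
  -- For `n = 0` the quotient defining `η` is `0`, so the iteration lemma does not apply; but then
  -- no iteration takes place.
  · rcases Nat.eq_zero_or_pos n with rfl | hn
    · exact Spec.forAll (fun _ => IterInv 0 V T P η 0) hI.ctx.size (by decide)
        (fun _ _ _ a h => h.agree a (by decide)) hI fun k hk => absurd hk (Nat.not_lt_zero k)
    · have hn0 : (0 : ℝ) < n := by exact_mod_cast hn
      exact iterations_spec (by rw [hη]; positivity) hP hTV hI
  set S := toSet n (τ₂.nat vCut) with hS
  have hc₂ := hI₂.ctx
  refine Spec.block_cons (Spec.assignCard (fun i => i ∈ T ∧ i ∈ S) hc₂.size (by decide) ?_)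
    fun τ₃ a₃ h₃ => ?_
  · intro i hi τ a hx
    simp only [Test.Holds, holds_mem hx hi, a.nat vTerm (by decide), a.nat vCut (by decide),
      hc₂.term, hS]
  have hc₃ := hc₂.agree a₃ (by decide)
  have hcut₃ : toSet n (τ₃.nat vCut) = S := by rw [a₃.nat vCut (by decide)]
  have hSV : S ⊆ V := by
    by_cases h : τ₂.nat vHave 0 0 = 0
    · rw [hS, hI₂.best.none h]; exact Finset.empty_subset _
    · exact (hI₂.best.some h).2.1.1
  have hpos : 0 < τ₃.nat vCnt 0 0 ↔ ∃ t ∈ T, t ∈ S := by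
    rw [h₃, Finset.card_pos]
    constructor
    · rintro ⟨i, hi⟩
      exact ⟨i, (Finset.mem_filter.1 hi).2⟩
    · rintro ⟨i, hi⟩
      exact ⟨i, Finset.mem_filter.2 ⟨hc₂.V_subset (hTV hi.1), hi⟩⟩
  refine Spec.block_cons (Spec.ite (fun ht => ?_) (fun ht => .skip ?_)) fun _ _ h => .block_nil h
  all_goals
    simp only [Test.Holds, NExp.eval, NExp.var, hpos] at ht
  · refine (Spec.assignSet (· ∈ V \ S) hc₃.size (by decide) ?_).mono fun τ a h => ?_
    · intro i hi τ a hx hold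
      have hcτ := hc₃.agree (N := [vI, vCut]) (R := []) a (by decide)
      have hcut : 0 < τ.nat vCut i 0 ↔ i ∈ S := by
        rw [hold, ← hcut₃, mem_toSet]
        simp [hi]
      simp only [Test.Holds, holds_mem hx hi, hcτ.ground, Finset.mem_sdiff, mem_toSet, hi,
        true_and, hcut]
    · have hcut : toSet n (τ.nat vCut) = V \ S := by
        rw [h, toSet_assign (Finset.sdiff_subset.trans hc.V_subset)]
      obtain ⟨t, htT, htS⟩ := ht
      rw [hcut, ratio_sdiff]
      refine ⟨fun x hx => ?_, fun R hTR hRV hR => ?_⟩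
      · rw [Finset.mem_sdiff] at hx ⊢
        exact ⟨hx.1, fun hxT => hx.2 (hI₂.best.resp t htT x hxT htS)⟩
      · obtain ⟨h1, h2⟩ := hI₂.ratio_le hp hη hP hmin hTR hRV hR
        obtain ⟨h3, h4, -⟩ := hI₂.best.some h1
        exact ⟨Finset.sdiff_nonempty.2 h4.2, Finset.sdiff_ssubset h4.1 h3, h2⟩
  · rw [hcut₃]
    refine ⟨fun x hx => Finset.mem_sdiff.2 ⟨hSV hx, fun hxT => ht ⟨x, hxT, hx⟩⟩,
      fun R hTR hRV hR => ?_⟩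
    obtain ⟨h1, h2⟩ := hI₂.ratio_le hp hη hP hmin hTR hRV hR
    exact ⟨(hI₂.best.some h1).1, (hI₂.best.some h1).2.1, h2⟩

end RealRAM

/-! ### Back from sets of natural numbers to subsets of `Fin n`. -/

namespace RealRAM

section Fin

variable {n : ℕ}

theorem mem_map_valEmbedding {S : Finset (Fin n)} {i : Fin n} :
    (i : ℕ) ∈ S.map Fin.valEmbedding ↔ i ∈ S :=
  Finset.mem_map' Fin.valEmbedding

theorem map_valEmbedding_subset_range (S : Finset (Fin n)) :
    S.map Fin.valEmbedding ⊆ Finset.range n := by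
  intro x hx
  obtain ⟨i, -, rfl⟩ := Finset.mem_map.1 hx
  exact Finset.mem_range.2 i.2

theorem toSet_eq_map (σ : Store) (a : ℕ) :
    toSet n (σ.nat a) = (σ.set n a).map Fin.valEmbedding := by
  ext x
  rw [mem_toSet, Finset.mem_map]
  constructor
  · rintro ⟨h, h'⟩
    exact ⟨⟨x, h⟩, by simpa [Store.set] using h', rfl⟩
  · rintro ⟨i, hi, rfl⟩
    exact ⟨i.2, by simpa [Store.set] using hi⟩

theorem setArray_apply (S : Finset (Fin n)) (i : Fin n) :
    setArray S i 0 = if i ∈ S then 1 else 0 := by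
  unfold setArray
  congr 1
  rw [eq_iff_iff]
  constructor
  · rintro ⟨k, hk, hki, -⟩
    rwa [← Fin.ext hki]
  · exact fun h => ⟨i, h, rfl, rfl⟩

theorem set_eq_of_setArray {σ : Store} {a : ℕ} {S : Finset (Fin n)} (h : σ.nat a = setArray S) :
    σ.set n a = S := by
  ext i
  simp only [Store.set, h, setArray_apply, Finset.mem_filter_univ]
  split_ifs <;> simp_all

theorem matrixArray_apply (P : Matrix (Fin n) (Fin n) ℝ) (i j : Fin n) :
    matrixArray P i j = P i j := by
  simp [matrixArray]

theorem matrixArray_nonneg {P : Matrix (Fin n) (Fin n) ℝ} (hP : ∀ i j, 0 ≤ P i j) (x y : ℕ) :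
    0 ≤ matrixArray P x y := by
  unfold matrixArray
  split_ifs
  · exact hP _ _
  · exact le_rfl

theorem cutDist_map (S : Finset (Fin n)) (i j : Fin n) :
    cutDist (S.map Fin.valEmbedding) (i : ℕ) j = cutMetric S i j := by
  simp only [cutDist, cutMetric, mem_map_valEmbedding]

theorem ratio_map (V S : Finset (Fin n)) (P : Matrix (Fin n) (Fin n) ℝ) :
    ratio (V.map Fin.valEmbedding) (matrixArray P) (S.map Fin.valEmbedding) = cutRatio V P S := by
  simp only [ratio, cutRatio, Finset.sum_map, Fin.valEmbedding_apply, cutDist_map,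
    matrixArray_apply]

theorem map_valEmbedding_ssubset {R V : Finset (Fin n)} :
    R.map Fin.valEmbedding ⊂ V.map Fin.valEmbedding ↔ R ⊂ V := Finset.map_ssubset_map

theorem isFindComp_findSparseCut :
    ∃ q : Polynomial ℕ, IsFindComp findSparseCut 1536 q := by
  -- The program makes no calls, so any price for a call will do.
  obtain ⟨q, hq⟩ := Cmd.exists_polynomial_cost findSparseCut 0
  refine ⟨q, fun n V P T hP hTV => ?_⟩
  have hcut : toSet n ((findCompInput V P T).nat vCut) = ∅ := by
    ext i
    simp [findCompInput]
  have hc : Ctx n (V.map Fin.valEmbedding) (T.map Fin.valEmbedding) (matrixArray P)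
      (findCompInput V P T) := by
    refine ⟨rfl, ?_, ?_, rfl⟩
    · rw [toSet_eq_map, set_eq_of_setArray (S := V) rfl]
    · rw [toSet_eq_map, set_eq_of_setArray (S := T) rfl]
  have h := findSparseCut_spec (K := (0 : Polynomial ℕ).eval n) hc
    ⟨fun _ => hcut, fun h => absurd rfl h, fun s _ t _ hs => by simp [hcut] at hs⟩
    (Finset.map_subset_map.2 hTV) (matrixArray_nonneg hP)
  refine ⟨by rw [hq]; exact h.1, fun w σ t e => ?_⟩
  obtain ⟨h1, h2⟩ := h.2 w σ t e
  rw [toSet_eq_map] at h1 h2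
  refine ⟨fun i hi => ?_, fun R hTR hRV hR => ?_⟩
  · have := h1 (mem_map_valEmbedding.2 hi)
    rwa [Finset.mem_sdiff, mem_map_valEmbedding, mem_map_valEmbedding, ← Finset.mem_sdiff] at this
  · obtain ⟨g1, g2, g3⟩ := h2 (R.map Fin.valEmbedding) (Finset.map_subset_map.2 hTR)
      (map_valEmbedding_ssubset.2 hRV) (hR.map)
    rw [ratio_map, ratio_map, Finset.card_map] at g3
    exact ⟨Finset.map_nonempty.1 g1, map_valEmbedding_ssubset.1 g2, g3⟩

end Fin

end RealRAM

/-! ### Expansion and average internal mass. -/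

namespace RealRAM

section Expansion

variable {n : ℕ} {P : Matrix (Fin n) (Fin n) ℝ} {S T V : Finset (Fin n)} {β C : ℝ}

theorem sum_comm_of_isSymm (hP : P.IsSymm) (A B : Finset (Fin n)) :
    ∑ i ∈ A, ∑ j ∈ B, P i j = ∑ i ∈ B, ∑ j ∈ A, P i j :=
  Finset.sum_comm.trans <|
    Finset.sum_congr rfl fun _ _ => Finset.sum_congr rfl fun _ _ => hP.apply _ _

theorem cutRatio_eq_ratio (V S : Finset (Fin n)) (P : Matrix (Fin n) (Fin n) ℝ) :
    cutRatio V P S = ratio V (fun i j => P i j) S := rfl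

theorem expansion_nonneg (hP0 : ∀ i j, 0 ≤ P i j) (V S : Finset (Fin n)) : 0 ≤ expansion V P S :=
  div_nonneg (Finset.sum_nonneg fun i _ => Finset.sum_nonneg fun j _ => hP0 i j)
    (le_min (Nat.cast_nonneg _) (Nat.cast_nonneg _))

theorem expansion_sdiff (hP : P.IsSymm) (hSV : S ⊆ V) :
    expansion V P (V \ S) = expansion V P S := by
  rw [expansion, expansion, Finset.sdiff_sdiff_eq_self hSV, sum_comm_of_isSymm hP, min_comm]

/-- By symmetry the ratio is the boundary divided by `|S| · |V \ S|`, and this product is the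
minimum times the maximum of the two sizes. -/
theorem expansion_eq (hP : P.IsSymm) (hSV : S ⊂ V) (hS : S.Nonempty) :
    expansion V P S = cutRatio V P S * max (S.card : ℝ) (V \ S).card := by
  have h1 : (0 : ℝ) < S.card := by exact_mod_cast hS.card_pos
  have h2 : (0 : ℝ) < (V \ S).card := by
    exact_mod_cast Finset.card_pos.2 (Finset.sdiff_nonempty.2 hSV.2)
  have h3 : 0 < min (S.card : ℝ) (V \ S).card := lt_min h1 h2
  have h5 : cutRatio V P S = (∑ i ∈ S, ∑ j ∈ V \ S, P i j + ∑ i ∈ V \ S, ∑ j ∈ S, P i j) /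
      (2 * (S.card : ℝ) * (V \ S).card) :=
    congrArg₂ (· / ·) (sum_cutDist_mul hSV.1 fun i j => P i j) (sum_cutDist hSV.1)
  rw [h5, ← sum_comm_of_isSymm hP S, expansion, div_mul_eq_mul_div, div_eq_div_iff h3.ne' (by positivity)]
  have h4 := min_mul_max (S.card : ℝ) (V \ S).card
  linear_combination (-2 * ∑ i ∈ S, ∑ j ∈ V \ S, P i j) * h4

/-- The larger side of any cut has between `|V| / 2` and `|V|` points, so the conversion factors of
two cuts differ by at most 2. -/
theorem expansion_le_of_cutRatio_le (hP : P.IsSymm) (hP0 : ∀ i j, 0 ≤ P i j) {γ : ℝ} (hγ : 0 ≤ γ)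
    {R : Finset (Fin n)} (hSV : S ⊂ V) (hS : S.Nonempty) (hRV : R ⊂ V) (hR : R.Nonempty)
    (h : cutRatio V P S ≤ γ * cutRatio V P R) :
    expansion V P S ≤ 2 * γ * expansion V P R := by
  have hr : ∀ R, 0 ≤ cutRatio V P R := fun R => by
    rw [cutRatio_eq_ratio]; exact ratio_nonneg hP0 R
  have hcard : ∀ {R : Finset (Fin n)}, R ⊂ V → (R.card : ℝ) + (V \ R).card = V.card := by
    intro R hR
    rw [add_comm]
    exact_mod_cast Finset.card_sdiff_add_card_eq_card hR.1
  rw [expansion_eq hP hSV hS, expansion_eq hP hRV hR]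
  have h1 : max (S.card : ℝ) (V \ S).card ≤ V.card := by
    rw [← hcard hSV]
    exact max_le (by simp) (by simp)
  have h2 : (V.card : ℝ) ≤ 2 * max (R.card : ℝ) (V \ R).card := by
    rw [← hcard hRV]
    linarith [le_max_left (R.card : ℝ) (V \ R).card, le_max_right (R.card : ℝ) (V \ R).card]
  calc cutRatio V P S * max (S.card : ℝ) (V \ S).card
      ≤ (γ * cutRatio V P R) * (2 * max (R.card : ℝ) (V \ R).card) :=
        mul_le_mul h (h1.trans h2) (le_max_of_le_left (Nat.cast_nonneg _)) (mul_nonneg hγ (hr R))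
    _ = _ := by ring

theorem internalMass_univ (hrow : ∀ i, ∑ j, P i j = 1) (hn : 0 < n) :
    internalMass P Finset.univ = 1 := by
  have : (n : ℝ) ≠ 0 := by exact_mod_cast hn.ne'
  simp [internalMass, hrow, this]

/-- The rows of `S` have total mass `|S|`, of which at most `γ |S|` leaves `S`. -/
theorem le_internalMass_of_expansion_le (hrow : ∀ i, ∑ j, P i j = 1) (hS : S.Nonempty)
    (hSV : S ⊂ Finset.univ) {γ : ℝ} (hγ : 0 ≤ γ) (h : expansion Finset.univ P S ≤ γ) :
    1 - γ ≤ internalMass P S := by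
  have h1 : (0 : ℝ) < S.card := by exact_mod_cast hS.card_pos
  have h2 : (0 : ℝ) < (Finset.univ \ S).card := by
    exact_mod_cast Finset.card_pos.2 (Finset.sdiff_nonempty.2 hSV.2)
  rw [expansion, div_le_iff₀ (lt_min h1 h2)] at h
  have h3 : ∑ i ∈ S, ∑ j ∈ S, P i j + ∑ i ∈ S, ∑ j ∈ Finset.univ \ S, P i j = S.card := by
    rw [← Finset.sum_add_distrib, Finset.sum_congr rfl fun i _ => by
      rw [add_comm, Finset.sum_sdiff (Finset.subset_univ S), hrow i]]
    simp
  rw [internalMass, le_div_iff₀ h1]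
  have h4 := mul_le_mul_of_nonneg_left (min_le_left (S.card : ℝ) (Finset.univ \ S).card) hγ
  linarith

/-- The sets that Extract Component goes through. -/
structure Heavy (P : Matrix (Fin n) (Fin n) ℝ) (T : Finset (Fin n)) (β : ℝ)
    (S : Finset (Fin n)) : Prop where
  nonempty : S.Nonempty
  disjoint : Disjoint S T
  -- The first loss is the one admitted by the first cut. The second pays for all refinements
  -- together, in proportion to the logarithm of the factor by which the set has shrunk.
  le : 1 - β / 8 - β / (4 * Real.log n) * (Real.log n - Real.log S.card) ≤ internalMass P S

theorem log_card_le (S : Finset (Fin n)) : Real.log S.card ≤ Real.log n := by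
  rcases S.eq_empty_or_nonempty with rfl | h
  · simp [Real.log_natCast_nonneg]
  · apply Real.log_le_log (by exact_mod_cast h.card_pos)
    exact_mod_cast (by simpa using S.card_le_univ : S.card ≤ n)

theorem Heavy.of_le (hβ : 0 ≤ β) (hS : S.Nonempty) (hST : Disjoint S T)
    (h : 1 - β / 8 ≤ internalMass P S) : Heavy P T β S := by
  refine ⟨hS, hST, le_trans ?_ h⟩
  have h1 := log_card_le S
  have h2 : 0 ≤ Real.log n := Real.log_natCast_nonneg n
  have : 0 ≤ β / (4 * Real.log n) * (Real.log n - Real.log S.card) :=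
    mul_nonneg (by positivity) (by linarith)
  linarith

theorem Heavy.le_internalMass (h : Heavy P T β S) (hβ : 0 < β) : 1 - β ≤ internalMass P S := by
  refine le_trans ?_ h.le
  have h1 : 0 ≤ Real.log S.card := Real.log_natCast_nonneg _
  have h2 : 0 ≤ Real.log n := Real.log_natCast_nonneg n
  have h3 : β / (4 * Real.log n) * (Real.log n - Real.log S.card) ≤ β / 4 := by
    rcases h2.eq_or_lt with h2 | h2
    · rw [← h2]; simp; positivity
    · rw [div_mul_eq_mul_div, div_le_iff₀ (by positivity)]
      nlinarith
  linarith

/-- Passing to the better side of a sparse cut. -/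
theorem Heavy.of_cut (h : Heavy P T β S) (hP : P.IsSymm) (hβ : 0 < β) {A B : Finset (Fin n)}
    (hA : A.Nonempty) (hB : B.Nonempty) (hAB : Disjoint A B) (hS : A ∪ B = S)
    (hcut : ∑ i ∈ A, ∑ j ∈ B, P i j ≤ β / (8 * Real.log n) * B.card)
    (hle : internalMass P B ≤ internalMass P A) : Heavy P T β A := by
  have ha : (0 : ℝ) < A.card := by exact_mod_cast hA.card_pos
  have hb : (0 : ℝ) < B.card := by exact_mod_cast hB.card_pos
  have hcard : (S.card : ℝ) = A.card + B.card := by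
    rw [← hS]; exact_mod_cast Finset.card_union_of_disjoint hAB
  have hs : (0 : ℝ) < S.card := by rw [hcard]; positivity
  have h2 : 0 ≤ Real.log n := Real.log_natCast_nonneg n
  refine ⟨hA, h.disjoint.mono_left (hS ▸ Finset.subset_union_left), ?_⟩
  have eA : ∑ i ∈ A, ∑ j ∈ A, P i j = internalMass P A * A.card := by
    rw [internalMass, div_mul_cancel₀ _ ha.ne']
  have eB : ∑ i ∈ B, ∑ j ∈ B, P i j = internalMass P B * B.card := by
    rw [internalMass, div_mul_cancel₀ _ hb.ne']
  have eS : internalMass P S * S.card = ∑ i ∈ A, ∑ j ∈ A, P i j + ∑ i ∈ B, ∑ j ∈ B, P i j +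
      2 * ∑ i ∈ A, ∑ j ∈ B, P i j := by
    rw [internalMass, div_mul_cancel₀ _ hs.ne', ← hS, Finset.sum_union hAB]
    simp only [Finset.sum_union hAB, Finset.sum_add_distrib]
    rw [sum_comm_of_isSymm hP B A]
    ring
  set x := (B.card : ℝ) / S.card with hx
  -- From `log z ≤ z - 1` at `z = |A| / |S| = 1 - x`; this makes the losses telescope.
  have hlog : x ≤ Real.log S.card - Real.log A.card := by
    have h3 := Real.log_le_sub_one_of_pos (div_pos ha hs)
    rw [Real.log_div ha.ne' hs.ne'] at h3
    have h4 : (A.card : ℝ) / S.card = 1 - x := by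
      rw [hx, eq_sub_iff_add_eq, ← add_div, ← hcard, div_self hs.ne']
    linarith
  -- The mass of `S` is that of `A`, that of `B` and twice the cut; the factor 2 turns `8 log n`
  -- into `4 log n`.
  have hmass : internalMass P S - β / (4 * Real.log n) * x ≤ internalMass P A := by
    refine le_of_mul_le_mul_right ?_ hs
    have h5 : β / (4 * Real.log n) * x * S.card = 2 * (β / (8 * Real.log n) * B.card) := by
      rw [hx, mul_assoc, div_mul_cancel₀ _ hs.ne',
        show β / (4 * Real.log n) = 2 * (β / (8 * Real.log n)) by
          rw [show 8 * Real.log n = 2 * (4 * Real.log n) by ring, ← mul_div_assoc,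
            mul_div_mul_left _ _ (two_ne_zero)]]
      ring
    rw [sub_mul, h5, eS, eA, eB]
    have h6 := mul_le_mul_of_nonneg_right hle hb.le
    rw [hcard]
    linarith
  have h7 : 0 ≤ β / (4 * Real.log n) := by positivity
  have h8 := mul_le_mul_of_nonneg_left hlog h7
  have h9 := h.le
  linarith [mul_sub (β / (4 * Real.log n)) (Real.log n) (Real.log S.card),
    mul_sub (β / (4 * Real.log n)) (Real.log n) (Real.log A.card),
    mul_sub (β / (4 * Real.log n)) (Real.log S.card) (Real.log A.card)]

/-- Optimality up to a factor of the cut of a component that is not refined any more. -/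
theorem le_expansion_of_break (hP : P.IsSymm) (hP0 : ∀ i j, 0 ≤ P i j) (hC : 0 < C)
    {S' : Finset (Fin n)} (hS' : S'.Nonempty) (hSS' : S' ⊂ S) (hbreak : β / (8 * Real.log n) ≤ expansion S P S')
    {R : Finset (Fin n)} (hR : R.Nonempty) (hRS : R ⊂ S)
    (h : cutRatio S P S' ≤ C * Real.log S.card * cutRatio S P R) :
    1 / (16 * C) * (β / Real.log n ^ 2) ≤ expansion S P R := by
  have hl0 : 0 ≤ Real.log S.card := Real.log_natCast_nonneg _
  have hcard : 1 < S.card := by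
    have := Finset.card_lt_card hRS
    have := hR.card_pos
    omega
  have hlog : 0 < Real.log n :=
    (Real.log_pos (by exact_mod_cast hcard)).trans_le (log_card_le S)
  have h1 := expansion_le_of_cutRatio_le hP hP0 (by positivity) hSS' hS' hRS hR h
  have h2 : 2 * (C * Real.log S.card) * expansion S P R ≤
      2 * (C * Real.log n) * expansion S P R := by
    have := expansion_nonneg hP0 S R
    have := log_card_le S
    gcongr
  -- The constant `16 C` combines the 8 of the threshold with the 2 lost between ratio and
  -- expansion.
  have h3 := (hbreak.trans h1).trans h2
  rw [div_le_iff₀ (by positivity)] at h3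
  rw [one_div, inv_mul_eq_div, div_div, div_le_iff₀ (by positivity)]
  linarith

/-- Optimality up to a factor of the first cut. -/
theorem le_expansion_of_first_cut (hP : P.IsSymm) (hP0 : ∀ i j, 0 ≤ P i j) (hC : 0 < C)
    {S' R : Finset (Fin n)} (hS' : S'.Nonempty) (hSS' : S' ⊂ Finset.univ)
    (hbig : β / 8 ≤ expansion Finset.univ P S') (hR : R.Nonempty) (hRS : R ⊂ Finset.univ)
    (h : cutRatio Finset.univ P S' ≤ C * Real.log (Finset.univ : Finset (Fin n)).card *
      cutRatio Finset.univ P R) :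
    1 / (16 * C) * (β / Real.log n) ≤ expansion Finset.univ P R := by
  rw [Finset.card_fin] at h
  have hcard : 1 < n := by
    have := Finset.card_lt_card hRS
    have := hR.card_pos
    rw [Finset.card_fin] at *
    omega
  have hlog : 0 < Real.log n := Real.log_pos (by exact_mod_cast hcard)
  have h1 := hbig.trans (expansion_le_of_cutRatio_le hP hP0 (by positivity) hSS' hS' hRS hR h)
  rw [one_div, inv_mul_eq_div, div_div, div_le_iff₀ (by positivity)]
  linarith

end Expansion

end RealRAM

/-! ### The main loop of Extract Component. -/

namespace RealRAM

section Extract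

variable {n K : ℕ} {P : Matrix (Fin n) (Fin n) ℝ} {T V : Finset (Fin n)} {β C : ℝ}
  {q : Polynomial ℕ} {f : Cmd} {σ τ : Store}

theorem mem_set {a : ℕ} {i : Fin n} : i ∈ σ.set n a ↔ 0 < σ.nat a i 0 := by simp [Store.set]

theorem holds_mem_fin {a x : ℕ} {i : Fin n} (hx : τ.nat x 0 0 = i) :
    (mem a x).Holds τ ↔ i ∈ τ.set n a := by
  simp [mem, hx, mem_set]

theorem Agree.set {N R : List ℕ} (h : Agree N R σ τ) {a : ℕ} (ha : a ∉ N) :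
    τ.set n a = σ.set n a := by
  simp [Store.set, h.nat a ha]

theorem filter_range_map (S : Finset (Fin n)) :
    (Finset.range n).filter (fun i => i ∈ S.map Fin.valEmbedding) = S.map Fin.valEmbedding :=
  filter_mem_range (map_valEmbedding_subset_range S)

/-- FindComp is specified only on memories that equal `findCompInput` in every cell. So besides the
set kept in the array, the exact contents are needed, including zeros outside `[n]`; they are known
as soon as the old contents were an indicator array. -/
theorem Spec.assignSet_fin {a : ℕ} {p : Test} (S : Finset (Fin n)) (hn : σ.nat vN 0 0 = n)
    (ha : a ≠ vN ∧ a ≠ vI)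
    (hp : ∀ (i : Fin n) (τ : Store), Agree [vI, a] [] σ τ → τ.nat vI 0 0 = i →
      (i ∈ τ.set n a ↔ i ∈ σ.set n a) → (p.Holds τ ↔ i ∈ S)) :
    Spec n K (RealRAM.assignSet a p) σ fun τ => τ.set n a = S ∧
      ∀ S₀ : Finset (Fin n), σ.nat a = setArray S₀ → τ.nat a = setArray S := by
  refine (Spec.assignSet (· ∈ S.map Fin.valEmbedding) hn ha fun i hi τ a hx hold => ?_).mono
    fun τ _ h => ⟨?_, fun S₀ h₀ => ?_⟩
  · rw [hp ⟨i, hi⟩ τ a hx (by rw [mem_set, mem_set, hold]), ← mem_map_valEmbedding]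
  · ext i
    rw [mem_set, h, ← mem_map_valEmbedding]
    by_cases hi : (i : ℕ) ∈ S.map Fin.valEmbedding <;> simp only [hi, i.2] <;> simp
  · rw [h, h₀]
    funext i j
    by_cases hij : i < n ∧ j = 0
    · obtain ⟨hi, rfl⟩ := hij
      have hiS : i ∈ S.map Fin.valEmbedding ↔ ⟨i, hi⟩ ∈ S := mem_map_valEmbedding (i := ⟨i, hi⟩)
      rw [if_pos ⟨hi, rfl⟩, setArray_apply S ⟨i, hi⟩]
      simp only [hiS]
    · have : ∀ S : Finset (Fin n), setArray S i j = 0 := fun S =>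
        if_neg fun ⟨k, _, hk, hj⟩ => hij ⟨hk ▸ k.2, hj⟩
      rw [if_neg hij, this, this]

theorem Spec.assignCard_fin {x : ℕ} {p : Test} (S : Finset (Fin n)) (hn : σ.nat vN 0 0 = n)
    (hx : x ≠ vN ∧ x ≠ vI)
    (hp : ∀ (i : Fin n) (τ : Store), Agree [vI, x] [] σ τ → τ.nat vI 0 0 = i →
      (p.Holds τ ↔ i ∈ S)) :
    Spec n K (RealRAM.assignCard x p) σ fun τ => τ.nat x 0 0 = S.card := by
  refine (Spec.assignCard (· ∈ S.map Fin.valEmbedding) hn hx fun i hi τ a hx => ?_).mono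
    fun τ _ h => ?_
  · rw [hp ⟨i, hi⟩ τ a hx, ← mem_map_valEmbedding]
  · rw [h, filter_range_map, Finset.card_map]

theorem Spec.assignSum_fin {x : ℕ} {p p' : Test} (S S' : Finset (Fin n)) (hn : σ.nat vN 0 0 = n)
    (hmat : σ.real rP = matrixArray P) (hx : x ≠ rP)
    (hp : ∀ (i : Fin n) (τ : Store), Agree [vI, vJ] [x] σ τ → τ.nat vI 0 0 = i →
      (p.Holds τ ↔ i ∈ S))
    (hp' : ∀ (i : Fin n) (τ : Store), Agree [vI, vJ] [x] σ τ → τ.nat vJ 0 0 = i →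
      (p'.Holds τ ↔ i ∈ S')) :
    Spec n K (assignSum x p p') σ fun τ => τ.real x 0 0 = ∑ i ∈ S, ∑ j ∈ S', P i j := by
  rw [assignSum_eq]
  refine (Spec.sumArray (· ∈ S.map Fin.valEmbedding) (· ∈ S'.map Fin.valEmbedding) hn hx
    (fun i hi τ a hx => ?_) fun i hi τ a hx => ?_).mono fun τ _ h => ?_
  · rw [hp ⟨i, hi⟩ τ a hx, ← mem_map_valEmbedding]
  · rw [hp' ⟨i, hi⟩ τ a hx, ← mem_map_valEmbedding]
  · rw [h, filter_range_map, filter_range_map, hmat]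
    simp only [Finset.sum_map, Fin.valEmbedding_apply, matrixArray_apply]

/-- What Extract Component knows all the time. -/
structure Setting (n : ℕ) (P : Matrix (Fin n) (Fin n) ℝ) (β : ℝ) (σ : Store) : Prop where
  size : σ.nat vN = fun i j => if i = 0 ∧ j = 0 then n else 0
  mat : σ.real rP = matrixArray P
  beta : σ.real rBeta 0 0 = β

theorem Setting.agree (h : Setting n P β σ) {N R : List ℕ} (ha : Agree N R σ τ)
    (hW : vN ∉ N ∧ rP ∉ R ∧ rBeta ∉ R) : Setting n P β τ where
  size := by rw [ha.nat _ hW.1, h.size]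
  mat := by rw [ha.real _ hW.2.1, h.mat]
  beta := by rw [ha.real _ hW.2.2, h.beta]

theorem Setting.eq (h : Setting n P β σ) : σ.nat vN 0 0 = n := by rw [h.size]; simp

theorem Setting.frame_eq (h : Setting n P β σ) (hV : σ.nat vGround = setArray V)
    (hT : σ.nat vTerm = setArray T) : σ.frame = findCompInput V P T := by
  unfold Store.frame findCompInput
  congr 1
  · funext a
    match a with
    | 0 => exact h.size
    | 1 => exact hV
    | 2 => exact hT
    | (a + 3) => simp; rfl
  · funext a
    match a with
    | 0 => exact h.mat
    | (a + 1) => simp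

theorem Spec.call_findComp (hf : IsFindComp f C q) (h : Setting n P β σ)
    (hP0 : ∀ i j, 0 ≤ P i j) (hV : σ.nat vGround = setArray V) (hT : σ.nat vTerm = setArray T)
    (hTV : T ⊆ V) : Spec n (q.eval n) (.call f) σ fun τ => τ.set n vCut ⊆ V \ T ∧
      ∀ R : Finset (Fin n), T ⊆ R → R ⊂ V → R.Nonempty →
        (τ.set n vCut).Nonempty ∧ τ.set n vCut ⊂ V ∧
        cutRatio V P (τ.set n vCut) ≤ C * Real.log (V.card : ℝ) * cutRatio V P R := by
  obtain ⟨h1, h2⟩ := hf n V P T hP0 hTV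
  rw [← h.frame_eq hV hT] at h1 h2
  exact Spec.call h1 h2

theorem eval_min {e e' : NExp} : (NExp.min e e').eval σ = min (e.eval σ) (e'.eval σ) := by
  simp only [NExp.min, NExp.eval]
  omega

/-- The state in the main loop. -/
structure LoopInv (n : ℕ) (P : Matrix (Fin n) (Fin n) ℝ) (T : Finset (Fin n)) (β C : ℝ) (k : ℕ)
    (τ : Store) : Prop where
  setting : Setting n P β τ
  ground : ∃ S₀ : Finset (Fin n), τ.nat vGround = setArray S₀
  term : ∃ S₀ : Finset (Fin n), τ.nat vTerm = setArray S₀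
  heavy : Heavy P T β (τ.set n vS)
  card : τ.nat vSize 0 0 = (τ.set n vS).card
  run : τ.nat vRun 0 0 = 1 ∧ (τ.set n vS).card ≤ k ∨ τ.nat vRun 0 0 = 0 ∧
    ∀ R : Finset (Fin n), R.Nonempty → R ⊂ τ.set n vS →
      1 / (16 * C) * (β / Real.log (n : ℝ) ^ 2) ≤ expansion (τ.set n vS) P R

/-- Each iteration makes `S` strictly smaller or ends the loop, so `n` iterations suffice. The loop
ends either with a cut of large expansion, which bounds all cuts of `S` from below, or with a single
point, which has no cuts. -/
theorem refine_spec (hf : IsFindComp f C q) (hC : 0 < C) (hP : P.IsSymm) (hP0 : ∀ i j, 0 ≤ P i j)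
    (hβ : 0 < β) (hs : Setting n P β σ)
    (hg : ∃ S₀ : Finset (Fin n), σ.nat vGround = setArray S₀)
    (ht : ∃ S₀ : Finset (Fin n), σ.nat vTerm = setArray S₀) (hh : Heavy P T β (σ.set n vS)) :
    Spec n (q.eval n) (refine f) σ fun τ => Heavy P T β (τ.set n vS) ∧
      ∀ R : Finset (Fin n), R.Nonempty → R ⊂ τ.set n vS →
        1 / (16 * C) * (β / Real.log (n : ℝ) ^ 2) ≤ expansion (τ.set n vS) P R := by
  refine Spec.letNat_cons fun τ₁ a₁ h₁ => ?_
  have hs₁ := hs.agree a₁ (by decide)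
  refine Spec.block_cons (Spec.assignCard_fin (τ₁.set n vS) hs₁.eq (by decide) ?_)
    fun τ₂ a₂ h₂ => ?_
  · intro i τ a hx
    rw [holds_mem_fin hx, a.set (by decide)]
  have hs₂ := hs₁.agree a₂ (by decide)
  have a₁₂ := a₁.trans a₂
  refine Spec.block_cons (Spec.loop (LoopInv n P T β C) ?_ ?_ ?_) fun _ _ h => .block_nil h
  · refine ⟨hs₂, ?_, ?_, ?_, ?_, Or.inl ⟨?_, ?_⟩⟩
    · rwa [a₁₂.nat vGround (by decide)]
    · rwa [a₁₂.nat vTerm (by decide)]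
    · rwa [a₁₂.set (by decide)]
    · rw [h₂, a₂.set (by decide)]
    · rw [a₂.nat vRun (by decide), h₁]; rfl
    · simpa using (τ₂.set n vS).card_le_univ
  · intro k τ _ hI hb
    have hs := hI.setting
    obtain ⟨S₀, hS₀⟩ := hI.ground
    obtain ⟨T₀, hT₀⟩ := hI.term
    set S := τ.set n vS with hS
    have hsize : τ.nat vSize 0 0 = S.card := hI.card
    simp only [Test.Holds, NExp.eval, NExp.var, hsize] at hb
    obtain ⟨hrun, hcard⟩ := hb
    have hk : S.card ≤ k := by
      rcases hI.run with h | h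
      · exact h.2
      · exact absurd (hrun.symm.trans h.1) one_ne_zero
    refine ⟨k - 1, by omega, ?_⟩
    have hheavy := hI.heavy
    clear hI
    refine Spec.block_cons (Spec.assignSet_fin S hs.eq (by decide) ?_) fun τ₁ a₁ h₁ => ?_
    · intro i τ' a hx _
      rw [holds_mem_fin hx, a.set (by decide)]
    replace h₁ := h₁.2 S₀ hS₀
    have hs₁ := hs.agree a₁ (by decide)
    refine Spec.block_cons (Spec.assignSet_fin ∅ hs₁.eq (by decide) ?_) fun τ₂ a₂ h₂ => ?_
    · intro i τ' a hx _
      simp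
    replace h₂ := h₂.2 T₀ (by rw [a₁.nat vTerm (by decide), hT₀])
    have hs₂ := hs₁.agree a₂ (by decide)
    have hg₂ : τ₂.nat vGround = setArray S := by rw [a₂.nat vGround (by decide), h₁]
    refine Spec.block_cons (Spec.call_findComp hf hs₂ hP0 hg₂ h₂ (Finset.empty_subset _))
      fun τ₃ a₃ h₃ => ?_
    -- A call writes the result array only, whatever the subroutine; in this form later frame
    -- conditions no longer mention `f` and can be decided.
    replace a₃ : Agree [vCut] [] τ₂ τ₃ := a₃
    set S' := τ₃.set n vCut with hS'
    obtain ⟨x, hx⟩ : S.Nonempty := Finset.card_pos.1 (by omega)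
    -- As `|S| > 1`, a singleton is an admissible cut, which obliges FindComp to return a proper
    -- non-empty one.
    obtain ⟨hne, hss, -⟩ := h₃.2 {x} (Finset.empty_subset _) ⟨by simpa using hx, fun h => by
      have := Finset.card_le_card h
      rw [Finset.card_singleton] at this
      omega⟩ (Finset.singleton_nonempty x)
    have hopt : ∀ R : Finset (Fin n), R ⊂ S → R.Nonempty →
        cutRatio S P S' ≤ C * Real.log S.card * cutRatio S P R := fun R h h' =>
      (h₃.2 R (Finset.empty_subset _) h h').2.2
    clear h₃
    have hS₃ : τ₃.set n vS = S := ((a₁.trans a₂).trans a₃).set (by decide)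
    have hs₃ := hs₂.agree a₃ (by decide)
    have mS : ∀ i, i ∈ S ∧ i ∈ S' ↔ i ∈ S' := fun i => ⟨fun h => h.2, fun h => ⟨hss.1 h, h⟩⟩
    refine Spec.block_cons (Spec.assignSum_fin S' (S \ S') hs₃.eq hs₃.mat (by decide) ?_ ?_)
      fun τ₄ a₄ h₄ => ?_
    · intro i τ' a hx
      simp only [Test.Holds, holds_mem_fin hx, a.set (a := vS) (by decide),
        a.set (a := vCut) (by decide), hS₃, ← hS', mS]
    · intro i τ' a hx
      simp only [Test.Holds, holds_mem_fin hx, a.set (a := vS) (by decide),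
        a.set (a := vCut) (by decide), hS₃, ← hS', Finset.mem_sdiff]
    have hs₄ := hs₃.agree a₄ (by decide)
    have hS₄ : τ₄.set n vS = S := by rw [a₄.set (by decide), hS₃]
    have hc₄ : τ₄.set n vCut = S' := a₄.set (by decide)
    refine Spec.block_cons (Spec.assignCard_fin S' hs₄.eq (by decide) ?_) fun τ₅ a₅ h₅ => ?_
    · intro i τ' a hx
      simp only [Test.Holds, holds_mem_fin hx, a.set (a := vS) (by decide),
        a.set (a := vCut) (by decide), hS₄, hc₄, mS]
    have hs₅ := hs₄.agree a₅ (by decide)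
    have hS₅ : τ₅.set n vS = S := by rw [a₅.set (by decide), hS₄]
    have hc₅ : τ₅.set n vCut = S' := by rw [a₅.set (by decide), hc₄]
    refine Spec.block_cons (Spec.assignCard_fin (S \ S') hs₅.eq (by decide) ?_)
      fun τ₆ a₆ h₆ => ?_
    · intro i τ' a hx
      simp only [Test.Holds, holds_mem_fin hx, a.set (a := vS) (by decide),
        a.set (a := vCut) (by decide), hS₅, hc₅, Finset.mem_sdiff]
    have hs₆ := hs₅.agree a₆ (by decide)
    have e1 : τ₆.real rSum 0 0 = ∑ i ∈ S', ∑ j ∈ S \ S', P i j := by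
      rw [(a₅.trans a₆).real rSum (by decide), h₄]
    have e2 : τ₆.nat vLeft 0 0 = S'.card := by rw [a₆.nat vLeft (by decide), h₅]
    refine Spec.letReal_cons fun τ₇ a₇ h₇ => ?_
    replace h₇ : τ₇.real rV 0 0 = expansion S P S' := by
      rw [h₇]
      simp only [RExp.eval, RExp.var, NExp.eval, eval_min, NExp.var, e1, e2, h₆, Nat.cast_min]
      rfl
    have hs₇ := hs₆.agree a₇ (by decide)
    have a₆₇ := a₆.trans a₇
    have hS₇ : τ₇.set n vS = S := by rw [a₆₇.set (by decide), hS₅]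
    have hc₇ : τ₇.set n vCut = S' := by rw [a₆₇.set (by decide), hc₅]
    have hl₇ : τ₇.nat vLeft 0 0 = S'.card := by rw [a₇.nat vLeft (by decide), e2]
    have hr₇ : τ₇.nat vRight 0 0 = (S \ S').card := by rw [a₇.nat vRight (by decide), h₆]
    have hall := (((((a₁.trans a₂).trans a₃).trans a₄).trans a₅).trans a₆).trans a₇
    have hg₇ : ∃ S₀ : Finset (Fin n), τ₇.nat vGround = setArray S₀ :=
      ⟨S, by rw [((((a₃.trans a₄).trans a₅).trans a₆).trans a₇).nat vGround (by decide), hg₂]⟩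
    have ht₇ : ∃ S₀ : Finset (Fin n), τ₇.nat vTerm = setArray S₀ :=
      ⟨∅, by rw [((((a₃.trans a₄).trans a₅).trans a₆).trans a₇).nat vTerm (by decide), h₂]⟩
    have hrun₇ : τ₇.nat vRun 0 0 = 1 := by rw [hall.nat vRun (by decide), hrun]
    have hsize₇ : τ₇.nat vSize 0 0 = S.card := by rw [hall.nat vSize (by decide), hsize]
    refine Spec.block_cons (Spec.ite (fun ht => .setNat ?_) (fun ht => ?_))
      fun _ _ h => .block_nil h
    all_goals
      simp only [Test.Holds, RExp.eval, NExp.eval, RExp.var, NExp.var, h₇, hs₇.beta, hs₇.eq,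
        Nat.cast_ofNat] at ht
    · have a₈ := agree_setNat τ₇ vRun 0 0 0
      show LoopInv n P T β C (k - 1) (τ₇.setNat vRun 0 0 0)
      have hS₈ : (τ₇.setNat vRun 0 0 0).set n vS = S := by rw [a₈.set (by decide), hS₇]
      refine ⟨hs₇.agree a₈ (by decide), ?_, ?_, ?_, ?_, Or.inr ⟨by simp, ?_⟩⟩
      · rwa [a₈.nat vGround (by decide)]
      · rwa [a₈.nat vTerm (by decide)]
      · rwa [hS₈]
      · rw [hS₈, a₈.nat vSize (by decide), hsize₇]
      · rw [hS₈]
        exact fun R hR hRS => le_expansion_of_break hP hP0 hC hne hss ht hR hRS (hopt R hRS hR)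
    · have hA : (S \ S').Nonempty := Finset.sdiff_nonempty.2 hss.2
      have hmin : 0 < min (S'.card : ℝ) (S \ S').card :=
        lt_min (by exact_mod_cast hne.card_pos) (by exact_mod_cast hA.card_pos)
      have hln : 0 ≤ Real.log n := Real.log_natCast_nonneg n
      rw [expansion, not_le, div_lt_iff₀ hmin] at ht
      have hcut₁ := ht.le.trans (mul_le_mul_of_nonneg_left (min_le_left _ _) (by positivity))
      have hcut₂ := ht.le.trans (mul_le_mul_of_nonneg_left (min_le_right _ _) (by positivity))
      refine Spec.block_cons (Spec.assignSum_fin S' S' hs₇.eq hs₇.mat (by decide) ?_ ?_)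
        fun τ₈ a₈ h₈ => Spec.letReal_cons fun τ₉ a₉ h₉ => ?_
      · intro i τ' a hx
        simp only [Test.Holds, holds_mem_fin hx, a.set (a := vS) (by decide),
          a.set (a := vCut) (by decide), hS₇, hc₇, mS]
      · intro i τ' a hx
        simp only [Test.Holds, holds_mem_fin hx, a.set (a := vS) (by decide),
          a.set (a := vCut) (by decide), hS₇, hc₇, mS]
      have a₈₉ := a₈.trans a₉
      have hs₉ := hs₇.agree a₈₉ (by decide)
      have hS₉ : τ₉.set n vS = S := by rw [a₈₉.set (by decide), hS₇]
      have hc₉ : τ₉.set n vCut = S' := by rw [a₈₉.set (by decide), hc₇]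
      replace h₉ : τ₉.real rU 0 0 = internalMass P S' := by
        rw [h₉]
        simp only [RExp.eval, RExp.var, NExp.eval, NExp.var, h₈, a₈.nat vLeft (by decide), hl₇]
        rfl
      refine Spec.block_cons (Spec.assignSum_fin (S \ S') (S \ S') hs₉.eq hs₉.mat (by decide)
        ?_ ?_) fun τ₁₀ a₁₀ h₁₀ => Spec.letReal_cons fun τ₁₁ a₁₁ h₁₁ => ?_
      · intro i τ' a hx
        simp only [Test.Holds, holds_mem_fin hx, a.set (a := vS) (by decide),
          a.set (a := vCut) (by decide), hS₉, hc₉, Finset.mem_sdiff]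
      · intro i τ' a hx
        simp only [Test.Holds, holds_mem_fin hx, a.set (a := vS) (by decide),
          a.set (a := vCut) (by decide), hS₉, hc₉, Finset.mem_sdiff]
      have a₁₀₁₁ := a₁₀.trans a₁₁
      have hs₁₁ := hs₉.agree a₁₀₁₁ (by decide)
      have hS₁₁ : τ₁₁.set n vS = S := by rw [a₁₀₁₁.set (by decide), hS₉]
      have hc₁₁ : τ₁₁.set n vCut = S' := by rw [a₁₀₁₁.set (by decide), hc₉]
      replace h₉ : τ₁₁.real rU 0 0 = internalMass P S' := by rw [a₁₀₁₁.real rU (by decide), h₉]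
      replace h₁₁ : τ₁₁.real rU' 0 0 = internalMass P (S \ S') := by
        rw [h₁₁]
        simp only [RExp.eval, RExp.var, NExp.eval, NExp.var, h₁₀,
          (a₈₉.trans a₁₀).nat vRight (by decide), hr₇]
        rfl
      refine Spec.block_cons (Q' := fun τ => Heavy P T β (τ.set n vS) ∧
        (τ.set n vS).card ≤ k - 1) (Spec.ite (fun hle => ?_) fun hle => ?_) fun τ₁₂ a₁₂ h₁₂ => ?_
      · refine (Spec.assignSet_fin S' hs₁₁.eq (by decide) ?_).mono fun τ a h => ?_
        · intro i τ' a hx hold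
          rw [hS₁₁] at hold
          simp only [Test.Holds, holds_mem_fin hx, hold, a.set (a := vCut) (by decide), hc₁₁, mS]
        · simp only [Test.Holds, RExp.eval, NExp.eval, RExp.var, h₉, h₁₁] at hle
          rw [h.1]
          exact ⟨hheavy.of_cut hP hβ hne hA Finset.disjoint_sdiff
            (Finset.union_sdiff_of_subset hss.1) hcut₂ hle,
            by have := Finset.card_lt_card hss; omega⟩
      · refine (Spec.assignSet_fin (S \ S') hs₁₁.eq (by decide) ?_).mono fun τ a h => ?_
        · intro i τ' a hx hold
          rw [hS₁₁] at hold
          simp only [Test.Holds, holds_mem_fin hx, hold, a.set (a := vCut) (by decide), hc₁₁,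
            Finset.mem_sdiff]
        · simp only [Test.Holds, RExp.eval, NExp.eval, RExp.var, h₉, h₁₁, not_le] at hle
          rw [h.1]
          exact ⟨hheavy.of_cut hP hβ hA hne Finset.sdiff_disjoint
            (Finset.sdiff_union_of_subset hss.1) (by rwa [sum_comm_of_isSymm hP]) hle.le,
            by have := Finset.card_lt_card (Finset.sdiff_ssubset hss.1 hne); omega⟩
      have hs₁₂ := hs₁₁.agree a₁₂ (by decide)
      refine Spec.block_cons (Spec.assignCard_fin (τ₁₂.set n vS) hs₁₂.eq (by decide) ?_)
        fun τ₁₃ a₁₃ h₁₃ => .block_nil ?_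
      · intro i τ a hx
        rw [holds_mem_fin hx, a.set (by decide)]
      have hall' := ((a₈₉.trans a₁₀₁₁).trans a₁₂).trans a₁₃
      have hS₁₃ : τ₁₃.set n vS = τ₁₂.set n vS := a₁₃.set (by decide)
      refine ⟨hs₁₂.agree a₁₃ (by decide), ?_, ?_, ?_, ?_, Or.inl ⟨?_, ?_⟩⟩
      · rwa [hall'.nat vGround (by decide)]
      · rwa [hall'.nat vTerm (by decide)]
      · rw [hS₁₃]; exact h₁₂.1
      · rw [h₁₃, hS₁₃]
      · rw [hall'.nat vRun (by decide), hrun₇]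
      · rw [hS₁₃]; exact h₁₂.2
  · intro k τ _ hI hb
    simp only [Test.Holds, NExp.eval, NExp.var, hI.card] at hb
    refine ⟨hI.heavy, ?_⟩
    rcases hI.run with h | h
    -- The loop stopped without a break, so `|S| ≤ 1` and there is no such `R`.
    · intro R hR hRS
      have := Finset.card_lt_card hRS
      have := hR.card_pos
      exact absurd ⟨h.1, by omega⟩ hb
    · exact h.2

end Extract

end RealRAM

/-! ### Extract Component as a whole. -/

namespace RealRAM

section Extract

variable {n K : ℕ} {P : Matrix (Fin n) (Fin n) ℝ} {T V : Finset (Fin n)} {β C : ℝ}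
  {q : Polynomial ℕ} {f : Cmd} {σ τ : Store}

theorem Spec.setGround_univ (hn : σ.nat vN 0 0 = n)
    (hg : σ.nat vGround = setArray (∅ : Finset (Fin n))) :
    Spec n K (RealRAM.forAll vI (.setNat vGround (.var vI) (.lit 0) (.lit 1))) σ fun τ =>
      τ.nat vGround = setArray (Finset.univ : Finset (Fin n)) := by
  refine (Spec.forAll (fun k τ => τ.nat vGround =
    fun i j => if i < k ∧ j = 0 then 1 else 0) hn (by decide) ?_ ?_ ?_).mono fun τ _ h => ?_
  · intro k τ τ' a h
    rw [a.nat vGround (by decide), h]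
  · rw [hg]
    funext i j
    simp [setArray]
  · intro k _ τ a _ hk h
    refine .setNat ?_
    funext i j
    simp only [NExp.eval, NExp.var, hk, Store.setNat_nat_same, upd_apply, h]
    have : (i < k + 1 ∧ j = 0) ↔ (i = k ∧ j = 0) ∨ (i < k ∧ j = 0) := by omega
    simp only [this]
    by_cases h1 : i = k ∧ j = 0 <;> simp [h1]
  · rw [h]
    funext i j
    unfold setArray
    congr 1
    rw [eq_iff_iff]
    exact ⟨fun h => ⟨⟨i, h.1⟩, Finset.mem_univ _, rfl, h.2⟩,
      fun ⟨k, _, hk, hj⟩ => ⟨hk ▸ k.2, hj⟩⟩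

/-- Refinement starts from a set that is heavy for one of two reasons: it is the side of a cut of
expansion below `β / 8`, or it is `[n] \ T` and has passed the test of its mass directly. If False
is returned instead, both halves of that outcome are read off from the two tests. -/
theorem extractComponent_spec (hf : IsFindComp f C q) (hC : 0 < C) (hP : P.IsSymm)
    (hP0 : ∀ i j, 0 ≤ P i j) (hrow : ∀ i, ∑ j, P i j = 1) (hβ : 0 < β) :
    Spec n (q.eval n) (extractComponent f) (extractInput P T β) fun σ =>
      (∃ S : Finset (Fin n), σ.nat vAnswer 0 0 = 1 ∧ σ.set n vS = S ∧ S.Nonempty ∧ Disjoint S T ∧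
        1 - β ≤ internalMass P S ∧ ∀ R : Finset (Fin n), R.Nonempty → R ⊂ S →
          1 / (16 * C) * (β / Real.log (n : ℝ) ^ 2) ≤ expansion S P R) ∨
      (σ.nat vAnswer 0 0 = 0 ∧
        (∀ S : Finset (Fin n), S.Nonempty → S ⊆ Finset.univ \ T →
          1 / (16 * C) * (β / Real.log (n : ℝ)) ≤ expansion Finset.univ P S) ∧
        (T ≠ Finset.univ → internalMass P (Finset.univ \ T) ≤ 1 - β / 8)) := by
  set σ := extractInput P T β with hσ
  have hs : Setting n P β σ := ⟨rfl, rfl, rfl⟩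
  have hT : σ.set n vT = T := set_eq_of_setArray rfl
  have h0 : ∀ a, a ≠ vN → a ≠ vT → σ.nat a = setArray (∅ : Finset (Fin n)) := by
    intro a h1 h2
    funext i j
    simp [hσ, extractInput, h1, h2, setArray]
  refine Spec.block_cons (Spec.setGround_univ hs.eq (h0 _ (by decide) (by decide)))
    fun τ₁ a₁ h₁ => ?_
  have hs₁ := hs.agree a₁ (by decide)
  refine Spec.block_cons (Spec.assignSet_fin T hs₁.eq (by decide) ?_) fun τ₂ a₂ h₂ => ?_
  · intro i τ a hx _
    rw [holds_mem_fin hx, a.set (by decide), a₁.set (by decide), hT]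
  replace h₂ := h₂.2 ∅ (by rw [a₁.nat vTerm (by decide), h0 _ (by decide) (by decide)])
  have hs₂ := hs₁.agree a₂ (by decide)
  have hg₂ : τ₂.nat vGround = setArray (Finset.univ : Finset (Fin n)) := by
    rw [a₂.nat vGround (by decide), h₁]
  refine Spec.block_cons (Spec.call_findComp hf hs₂ hP0 hg₂ h₂ (Finset.subset_univ _))
    fun τ₃ a₃ h₃ => ?_
  replace a₃ : Agree [vCut] [] τ₂ τ₃ := a₃
  set S := τ₃.set n vCut with hS
  obtain ⟨hST, hcut⟩ := h₃
  have hs₃ := hs₂.agree a₃ (by decide)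
  refine Spec.block_cons (Spec.assignSet_fin S hs₃.eq (by decide) ?_) fun τ₄ a₄ h₄ => ?_
  · intro i τ a hx _
    rw [holds_mem_fin hx, a.set (by decide)]
  replace h₄ := h₄.1
  have hs₄ := hs₃.agree a₄ (by decide)
  refine Spec.block_cons (Spec.assignSum_fin S (Finset.univ \ S) hs₄.eq hs₄.mat (by decide) ?_ ?_)
    fun τ₅ a₅ h₅ => ?_
  · intro i τ a hx
    rw [holds_mem_fin hx, a.set (by decide), h₄]
  · intro i τ a hx
    simp only [Test.Holds, holds_mem_fin hx, a.set (a := vS) (by decide), h₄, Finset.mem_sdiff,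
      Finset.mem_univ, true_and]
  have hs₅ := hs₄.agree a₅ (by decide)
  have hS₅ : τ₅.set n vS = S := by rw [a₅.set (by decide), h₄]
  refine Spec.block_cons (Spec.assignCard_fin S hs₅.eq (by decide) ?_) fun τ₆ a₆ h₆ => ?_
  · intro i τ a hx
    rw [holds_mem_fin hx, a.set (by decide), hS₅]
  have hs₆ := hs₅.agree a₆ (by decide)
  have hS₆ : τ₆.set n vS = S := by rw [a₆.set (by decide), hS₅]
  refine Spec.block_cons (Spec.assignCard_fin (Finset.univ \ S) hs₆.eq (by decide) ?_)
    fun τ₇ a₇ h₇ => ?_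
  · intro i τ a hx
    simp only [Test.Holds, holds_mem_fin hx, a.set (a := vS) (by decide), hS₆, Finset.mem_sdiff,
      Finset.mem_univ, true_and]
  have hs₇ := hs₆.agree a₇ (by decide)
  have e1 : τ₇.real rSum 0 0 = ∑ i ∈ S, ∑ j ∈ Finset.univ \ S, P i j := by
    rw [(a₆.trans a₇).real rSum (by decide), h₅]
  have e2 : τ₇.nat vLeft 0 0 = S.card := by rw [a₇.nat vLeft (by decide), h₆]
  refine Spec.letReal_cons fun τ₈ a₈ h₈ => Spec.letNat_cons fun τ₉ a₉ h₉ => ?_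
  replace h₈ : τ₉.real rV 0 0 = expansion Finset.univ P S := by
    rw [a₉.real rV (by decide), h₈]
    simp only [RExp.eval, RExp.var, NExp.eval, eval_min, NExp.var, e1, e2, h₇, Nat.cast_min]
    rfl
  have a₈₉ := a₈.trans a₉
  have hs₉ := hs₇.agree a₈₉ (by decide)
  have hS₉ : τ₉.set n vS = S := by rw [(a₇.trans a₈₉).set (by decide), hS₆]
  have hl₉ : τ₉.nat vLeft 0 0 = S.card := by rw [a₈₉.nat vLeft (by decide), e2]
  have hr₉ : τ₉.nat vRight 0 0 = (Finset.univ \ S).card := by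
    rw [a₈₉.nat vRight (by decide), h₇]
  have hT₉ : τ₉.set n vT = T := by
    rw [((((((a₁.trans a₂).trans a₃).trans a₄).trans a₅).trans a₆).trans
      (a₇.trans a₈₉)).set (by decide), hT]
  have hg₉ : ∃ S₀ : Finset (Fin n), τ₉.nat vGround = setArray S₀ := ⟨Finset.univ, by
    rw [((((a₃.trans a₄).trans a₅).trans a₆).trans (a₇.trans a₈₉)).nat vGround (by decide), hg₂]⟩
  have ht₉ : ∃ S₀ : Finset (Fin n), τ₉.nat vTerm = setArray S₀ := ⟨T, by
    rw [((((a₃.trans a₄).trans a₅).trans a₆).trans (a₇.trans a₈₉)).nat vTerm (by decide), h₂]⟩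
  refine Spec.block_cons (Q' := fun τ => τ.nat vAnswer 0 0 = 1 ∧ Heavy P T β (τ.set n vS) ∨
    τ.nat vAnswer 0 0 = 0 ∧ (∀ S : Finset (Fin n), S.Nonempty → S ⊆ Finset.univ \ T →
          1 / (16 * C) * (β / Real.log (n : ℝ)) ≤ expansion Finset.univ P S) ∧
        (T ≠ Finset.univ → internalMass P (Finset.univ \ T) ≤ 1 - β / 8))
    (Spec.ite (fun ht => ?_) fun ht => .skip ?_) fun τ₁₀ a₁₀ h₁₀ => ?_
  · simp only [Test.Holds, eval_min, RExp.eval, NExp.eval, RExp.var, NExp.var, h₈, hl₉, hr₉,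
      hs₉.beta, Nat.cast_ofNat] at ht
    refine Spec.block_cons (Spec.assignSet_fin (Finset.univ \ T) hs₉.eq (by decide) ?_)
      fun π₁ b₁ g₁ => ?_
    · intro i τ a hx _
      simp only [Test.Holds, holds_mem_fin hx, a.set (a := vT) (by decide), hT₉, Finset.mem_sdiff,
        Finset.mem_univ, true_and]
    replace g₁ := g₁.1
    have hπ₁ := hs₉.agree b₁ (by decide)
    refine Spec.block_cons (Spec.assignSum_fin (Finset.univ \ T) (Finset.univ \ T) hπ₁.eq hπ₁.mat
      (by decide) ?_ ?_) fun π₂ b₂ g₂ => ?_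
    · intro i τ a hx
      rw [holds_mem_fin hx, a.set (by decide), g₁]
    · intro i τ a hx
      rw [holds_mem_fin hx, a.set (by decide), g₁]
    have hπ₂ := hπ₁.agree b₂ (by decide)
    refine Spec.block_cons (Spec.assignCard_fin (Finset.univ \ T) hπ₂.eq (by decide) ?_)
      fun π₃ b₃ g₃ => Spec.letReal_cons fun π₄ b₄ g₄ => ?_
    · intro i τ a hx
      rw [holds_mem_fin hx, a.set (by decide), b₂.set (by decide), g₁]
    have hπ₄ := hπ₂.agree (b₃.trans b₄) (by decide)
    replace g₄ : π₄.real rV 0 0 = internalMass P (Finset.univ \ T) := by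
      rw [g₄]
      simp only [RExp.eval, RExp.var, NExp.eval, NExp.var, g₃, b₃.real rSum (by decide), g₂]
      rfl
    have hl : π₄.nat vLeft 0 0 = (Finset.univ \ T).card := by
      rw [b₄.nat vLeft (by decide), g₃]
    have hS₄ : π₄.set n vS = Finset.univ \ T := by
      rw [((b₂.trans b₃).trans b₄).set (by decide), g₁]
    refine Spec.block_cons (Spec.ite (fun h => .setNat (Or.inr ⟨by simp, ?_⟩))
      fun h => .skip (Or.inl ⟨?_, ?_⟩)) fun _ _ h => .block_nil h
    all_goals
      simp only [Test.Holds, RExp.eval, NExp.eval, RExp.var, NExp.var, hl, g₄, hπ₄.beta,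
        Nat.cast_ofNat, Nat.cast_one, Finset.card_eq_zero, Finset.sdiff_eq_empty_iff_subset,
        Finset.univ_subset_iff] at h
    · refine ⟨fun R hR hRT => ?_, fun hTu => h.resolve_left hTu⟩
      -- `R = [n]` would force `T = ∅`, and then `u([n]) = 1` would have prevented the answer False.
      have hRu : R ⊂ Finset.univ := by
        rw [Finset.ssubset_univ_iff]
        rintro rfl
        have hTe : T = ∅ := by
          rw [Finset.eq_empty_iff_forall_notMem]
          exact fun i hi => (Finset.mem_sdiff.1 (hRT (Finset.mem_univ i))).2 hi
        obtain ⟨i, -⟩ := hR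
        have hn : 0 < n := i.pos
        rcases h with h | h
        · rw [hTe] at h
          exact absurd (h ▸ Finset.mem_univ i) (Finset.notMem_empty i)
        · rw [hTe, Finset.sdiff_empty, internalMass_univ hrow hn] at h
          linarith
      have hRc : (Finset.univ \ R).Nonempty := Finset.sdiff_nonempty.2 hRu.2
      -- A set that avoids `T` competes through its complement, which contains `T` and has the same
      -- expansion.
      obtain ⟨k1, k2, k3⟩ := hcut (Finset.univ \ R) (fun i hi => Finset.mem_sdiff.2
        ⟨Finset.mem_univ i, fun hiR => (Finset.mem_sdiff.1 (hRT hiR)).2 hi⟩)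
        (Finset.sdiff_ssubset hRu.1 hR) hRc
      have hbig : β / 8 ≤ expansion Finset.univ P S := by
        refine ht.resolve_left fun h => ?_
        have h1 := k1.card_pos
        have h2 := Finset.card_pos.2 (Finset.sdiff_nonempty.2 k2.2)
        omega
      rw [← expansion_sdiff hP hRu.1]
      exact le_expansion_of_first_cut hP hP0 hC k1 k2 hbig hRc (Finset.sdiff_ssubset hRu.1 hR) k3
    · rw [(((b₁.trans b₂).trans b₃).trans b₄).nat vAnswer (by decide), h₉]
      rfl
    · rw [not_or, not_le] at h
      rw [hS₄]
      refine .of_le hβ.le ?_ Finset.sdiff_disjoint h.2.le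
      rw [Finset.sdiff_nonempty, Finset.univ_subset_iff]
      exact h.1
  · simp only [Test.Holds, eval_min, RExp.eval, NExp.eval, RExp.var, NExp.var, h₈, hl₉, hr₉,
      hs₉.beta, Nat.cast_ofNat, not_or, not_le] at ht
    obtain ⟨hmin, hlt⟩ := ht
    have hne : S.Nonempty := Finset.card_pos.1 (by omega)
    have hss : S ⊂ Finset.univ := by
      refine (Finset.subset_univ S).ssubset_of_ne fun h => hmin ?_
      rw [h]
      simp
    refine Or.inl ⟨by rw [h₉]; rfl, ?_⟩
    rw [hS₉]
    exact .of_le hβ.le hne (Finset.disjoint_of_subset_left hST Finset.sdiff_disjoint)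
      (le_internalMass_of_expansion_le hrow hne hss (by positivity) hlt.le)
  have hs₁₀ := hs₉.agree a₁₀ (by decide)
  refine Spec.block_cons (Spec.ite (fun ht => ?_) fun ht => .skip ?_) fun _ _ h => .block_nil h
  all_goals simp only [Test.Holds, NExp.eval, NExp.var] at ht
  · have hh : Heavy P T β (τ₁₀.set n vS) := by
      rcases h₁₀ with h | h
      · exact h.2
      · exact absurd (ht.symm.trans h.1) one_ne_zero
    refine (refine_spec hf hC hP hP0 hβ hs₁₀ ?_ ?_ hh).mono fun τ a h => Or.inl ⟨_, ?_, rfl,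
      h.1.nonempty, h.1.disjoint, h.1.le_internalMass hβ, h.2⟩
    · rwa [a₁₀.nat vGround (by decide)]
    · rwa [a₁₀.nat vTerm (by decide)]
    -- The subroutine occurs only under `call`, so the write sets do not depend on it; with `.skip`
    -- in its place they can be computed.
    · replace a : Agree (refine .skip).natW (refine .skip).realW τ₁₀ τ := a
      rw [a.nat vAnswer (by decide), ht]
  · exact Or.inr (h₁₀.resolve_left fun h => ht h.1)

end Extract

end RealRAM

theorem mainTheorem4 :
    (∃ (findComp : RealRAM.Cmd) (C : ℝ) (q : Polynomial ℕ),
      0 < C ∧ RealRAM.IsFindComp findComp C q) ∧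
    ∀ C : ℝ, 0 < C → ∃ c : ℝ, 0 < c ∧
      ∀ q : Polynomial ℕ, ∃ p : Polynomial ℕ,
      ∀ findComp : RealRAM.Cmd, RealRAM.IsFindComp findComp C q →
      ∀ (n : ℕ) (P : Matrix (Fin n) (Fin n) ℝ) (T : Finset (Fin n)) (β : ℝ),
        P.IsSymm → (∀ i j, 0 ≤ P i j) → (∀ i, ∑ j, P i j = 1) → 0 < β →
        RealRAM.RunsWithin (RealRAM.extractComponent findComp)
          (RealRAM.extractInput P T β) (p.eval n) ∧
        ∀ (w : List Bool) (σ : RealRAM.Store) (t : ℕ),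
          RealRAM.Exec (RealRAM.extractComponent findComp) (RealRAM.extractInput P T β) w σ t →
          (∃ S : Finset (Fin n),
            σ.nat RealRAM.vAnswer 0 0 = 1 ∧ σ.set n RealRAM.vS = S ∧
            S.Nonempty ∧ Disjoint S T ∧
            1 - β ≤ RealRAM.internalMass P S ∧
            ∀ R : Finset (Fin n), R.Nonempty → R ⊂ S →
              c * (β / Real.log (n : ℝ) ^ 2) ≤ RealRAM.expansion S P R) ∨
          (σ.nat RealRAM.vAnswer 0 0 = 0 ∧
            (∀ S : Finset (Fin n), S.Nonempty → S ⊆ Finset.univ \ T →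
              c * (β / Real.log (n : ℝ)) ≤ RealRAM.expansion Finset.univ P S) ∧
            (T ≠ Finset.univ →
              RealRAM.internalMass P (Finset.univ \ T) ≤ 1 - β / 8)) := by
  obtain ⟨q, hq⟩ := RealRAM.isFindComp_findSparseCut
  refine ⟨⟨RealRAM.findSparseCut, 1536, q, by norm_num, hq⟩, fun C hC => ⟨1 / (16 * C),
    by positivity, fun q => ?_⟩⟩
  -- The cost bound charges a call by `q` alone, so the polynomial found for `.skip` serves all
  -- subroutines with that bound; this allows `p` to be chosen before `findComp`.
  obtain ⟨p, hp⟩ := (RealRAM.extractComponent .skip).exists_polynomial_cost q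
  refine ⟨p, fun f hf n P T β hP hP0 hrow hβ => ?_⟩
  have h := RealRAM.extractComponent_spec (T := T) hf hC hP hP0 hrow hβ
  exact ⟨by rw [hp]; exact h.1, h.2⟩
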